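/- Let $\rho_0\in L^\infty(\mathbb R)$ with $0\le\rho_0\le1$ and $\mathrm{TV}(\rho_0)<\infty$, and let $V:[0,1]\to[0,\infty)$ be Lipschitz continuous with $V'\le0$ a.e. For all $\varepsilon,h>0$ let $(\gamma_k^{\varepsilon,h})_{k\ge0}$ be real numbers such that 1. $\gamma_k^{\varepsilon,h}\ge\gamma_{k+1}^{\varepsilon,h}\ge0$ for all $k\ge0$; 2. $\sum_{k\ge0}\gamma_k^{\varepsilon,h}=1$; 3. $\gamma_{k-1}^{\varepsilon,h}+\gamma_{k+1}^{\varepsilon,h}-2\gamma_k^{\varepsilon,h}\ge0$ for all $k\ge1$; 4. $\displaystyle\lim_{R\to\infty}\sup_{\varepsilon,h>0}\sum_{k\ge0,\;kh/\varepsilon\ge R}\gamma_k^{\varepsilon,h}=0$. Fix $\lambda>0$ with $\lambda\big(\|V\|_{L^\infty}+2\|V'\|_{L^\infty}\big)\le1$ (norms on $[0,1]$), and for $h>0$ put $\tau=\lambda h$. For $\varepsilon,h>0$ define, for $j\in\mathbb Z$ and $n\ge0$, $$\rho_j^0=\frac1h\int_{(j-\frac12)h}^{(j+\frac12)h}\rho_0\,dx,\qquad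 W_j^n=\sum_{k=0}^\infty\gamma_k^{\varepsilon,h}\rho_{j+k}^n,\qquad \rho_j^{n+1}=\rho_j^n+\lambda\big(\rho_{j-1}^nV(W_j^n)-\rho_j^nV(W_{j+1}^n)\big),$$ and let $W_{\varepsilon,h}(t,x)=W_j^n$ for $(t,x)\in[n\tau,(n+1)\tau)\times[(j-\frac12)h,(j+\frac12)h)$. An entropy solution of $$\partial_t\rho+\partial_x\big(V(\rho)\rho\big)=0\ \text{ on }(0,\infty)\times\mathbb R,\qquad \rho(0,\cdot)=\rho_0,$$ is a measurable $\rho:(0,\infty)\times\mathbb R\to[0,1]$ such that, for all $c\in[0,1]$ and all nonnegative $\phi\in C^1_c([0,\infty)\times\mathbb R)$, $$\int_0^\infty\!\!\int_{\mathbb R}\Big(|\rho-c|\,\partial_t\phi+\operatorname{sgn}(\rho-c)\big(\rho V(\rho)-cV(c)\big)\partial_x\phi\Big)dx\,dt+\int_{\mathbb R}|\rho_0(x)-c|\,\phi(0,x)\,dx\ge0 .$$ Then there is an entropy solution $\rho$, it is unique up to null sets, and it has a representative in $C([0,\infty);L^1_{\mathrm{loc}}(\mathbb R))$ with $\rho(0,\cdot)=\rho_0$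 a.e., which we use below. As $(\varepsilon,h)\to(0,0)$ with $\varepsilon,h>0$ (along any path), $W_{\varepsilon,h}\to\rho$ in $L^1_{\mathrm{loc}}([0,\infty)\times\mathbb R)$. If moreover there is $c_\gamma>0$ such that $\sum_{k\ge0}k\,\gamma_k^{\varepsilon,h}\le c_\gamma\,\varepsilon/h$ for all $\varepsilon,h>0$, then $$\|W_{\varepsilon,h}(t,\cdot)-\rho(t,\cdot)\|_{L^1(\mathbb R)}\le K\big(\varepsilon+h+\sqrt{\varepsilon t}+\sqrt{ht}\big)\,\mathrm{TV}(\rho_0)\qquad\text{for all }\varepsilon,h,t>0,$$ where $K>0$ depends only on $\lambda$, $\|V\|_{L^\infty}$, $\|V'\|_{L^\infty}$ and $c_\gamma$. -/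

import Mathlib

open MeasureTheory Set Filter Topology
open scoped ENNReal NNReal

noncomputable section

/-- Norm of `L^∞([0,1])`. -/
def linftyNorm (f : ℝ → ℝ) : ℝ :=
  (eLpNorm f ⊤ (volume.restrict (Icc (0 : ℝ) 1))).toReal

/-- Total variation on the line of an almost-everywhere equivalence class: the least pointwise
variation of a representative. -/
def totalVariation (f : ℝ → ℝ) : ℝ≥0∞ :=
  ⨅ (g : ℝ → ℝ) (_ : g =ᵐ[volume] f), eVariationOn g univ

/-- Initial data: `ρ₀ ∈ L^∞(ℝ)`, `0 ≤ ρ₀ ≤ 1`, `TV(ρ₀) < ∞`. -/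
structure IsAdmissibleDatum (ρ₀ : ℝ → ℝ) : Prop where
  memLp : MemLp ρ₀ ⊤ volume
  mem_Icc : ∀ᵐ x : ℝ, ρ₀ x ∈ Icc (0 : ℝ) 1
  totalVariation_lt_top : totalVariation ρ₀ < ⊤

/-- Velocities: `V ∈ Lip([0,1])`, `V ≥ 0` and `V' ≤ 0` (almost everywhere) on `[0,1]`.
The values of `V` outside `[0,1]` are irrelevant. -/
structure IsAdmissibleVelocity (V : ℝ → ℝ) : Prop where
  lipschitz : ∃ L : ℝ≥0, LipschitzOnWith L V (Icc (0 : ℝ) 1)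
  nonneg : ∀ ξ ∈ Icc (0 : ℝ) 1, 0 ≤ V ξ
  deriv_nonpos : ∀ᵐ ξ ∂(volume.restrict (Icc (0 : ℝ) 1)), deriv V ξ ≤ 0

/-- A family `γ ε h k` of quadrature weights, `ε, h > 0`, that are nonnegative and nonincreasing
in `k`, of sum one, convex in `k`, and localized:
`lim_{R → ∞} sup_{ε, h > 0} ∑_{k h / ε ≥ R} γ ε h k = 0`. -/
structure IsAdmissibleWeights (γ : ℝ → ℝ → ℕ → ℝ) : Prop where
  nonneg : ∀ ε > 0, ∀ h > 0, ∀ k, 0 ≤ γ ε h k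
  mono : ∀ ε > 0, ∀ h > 0, ∀ k, γ ε h (k + 1) ≤ γ ε h k
  normalized : ∀ ε > 0, ∀ h > 0, HasSum (γ ε h) 1
  convex : ∀ ε > 0, ∀ h > 0, ∀ k ≥ 1, 0 ≤ γ ε h (k - 1) + γ ε h (k + 1) - 2 * γ ε h k
  localized : Tendsto
    (fun R : ℝ => ⨆ (ε : ℝ) (_ : 0 < ε) (h : ℝ) (_ : 0 < h),
      ∑' k : ℕ, if R ≤ (k : ℝ) * h / ε then ENNReal.ofReal (γ ε h k) else 0)
    atTop (𝓝 0)

/-- First moment condition `∑ k γ_k ≤ c ε / h`. -/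
def MomentBound (γ : ℝ → ℝ → ℕ → ℝ) (c : ℝ) : Prop :=
  ∀ ε > 0, ∀ h > 0, Summable (fun k : ℕ => (k : ℝ) * γ ε h k) ∧
    ∑' k : ℕ, (k : ℝ) * γ ε h k ≤ c * (ε / h)

/-- Discrete nonlocal impact `W_j = ∑_k w_k r_{j+k}`. -/
def nonlocalImpact (w : ℕ → ℝ) (r : ℤ → ℝ) (j : ℤ) : ℝ :=
  ∑' k : ℕ, w k * r (j + k)

/-- The discrete densities `ρ_j^n` of the Godunov-type scheme with weights `w`, ratio
`lam = τ / h` and mesh size `h`. -/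
def schemeDensity (V ρ₀ : ℝ → ℝ) (w : ℕ → ℝ) (lam h : ℝ) : ℕ → ℤ → ℝ
  | 0, j => (1 / h) * ∫ x in (((j : ℝ) - 1 / 2) * h)..(((j : ℝ) + 1 / 2) * h), ρ₀ x
  | n + 1, j =>
    let r := schemeDensity V ρ₀ w lam h n
    r j + lam * (r (j - 1) * V (nonlocalImpact w r j) - r j * V (nonlocalImpact w r (j + 1)))

/-- The discrete nonlocal impact `W_j^n` of the scheme. -/
def schemeImpact (V ρ₀ : ℝ → ℝ) (w : ℕ → ℝ) (lam h : ℝ) (n : ℕ) (j : ℤ) : ℝ :=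
  nonlocalImpact w (schemeDensity V ρ₀ w lam h n) j

/-- Piecewise constant reconstruction of `W_j^n` on the cells
`[nτ, (n+1)τ) × [(j-1/2)h, (j+1/2)h)`, with `τ = lam * h`. -/
def reconstruction (V ρ₀ : ℝ → ℝ) (w : ℕ → ℝ) (lam h : ℝ) (t x : ℝ) : ℝ :=
  ∑' n : ℕ, ∑' j : ℤ,
    (Ico ((n : ℝ) * (lam * h)) (((n : ℝ) + 1) * (lam * h)) ×ˢ
      Ico (((j : ℝ) - 1 / 2) * h) (((j : ℝ) + 1 / 2) * h)).indicator
      (fun _ : ℝ × ℝ => schemeImpact V ρ₀ w lam h n j) (t, x)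

/-- Kružkov entropy flux `sgn(ξ - c) (ξ V(ξ) - c V(c))` of the flux `ξ V(ξ)`. -/
def kruzkovFlux (V : ℝ → ℝ) (c ξ : ℝ) : ℝ :=
  Real.sign (ξ - c) * (ξ * V ξ - c * V c)

/-- Entropy solutions, in `L^∞((0,∞) × ℝ)`, of `∂_t ρ + ∂_x (V(ρ) ρ) = 0`, `ρ(0,·) = ρ₀`, with
values in the domain `[0,1]` of `V`. The test functions are the restrictions to `[0,∞) × ℝ` of
compactly supported `C¹` functions, nonnegative there. For a function with values in `[0,1]` the
Kružkov inequalities with `c ∉ [0,1]` follow from those with `c = 0` and `c = 1`. -/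
structure IsEntropySolution (V ρ₀ : ℝ → ℝ) (ρ : ℝ → ℝ → ℝ) : Prop where
  aestronglyMeasurable : AEStronglyMeasurable (Function.uncurry ρ)
    (volume.restrict (Ioi (0 : ℝ) ×ˢ (univ : Set ℝ)))
  mem_Icc : ∀ᵐ z ∂(volume.restrict (Ioi (0 : ℝ) ×ˢ (univ : Set ℝ))),
    ρ z.1 z.2 ∈ Icc (0 : ℝ) 1
  entropy : ∀ c ∈ Icc (0 : ℝ) 1, ∀ φ : ℝ × ℝ → ℝ, ContDiff ℝ 1 φ → HasCompactSupport φ →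
    (∀ t ≥ 0, ∀ x, 0 ≤ φ (t, x)) →
    0 ≤ (∫ z in Ioi (0 : ℝ) ×ˢ (univ : Set ℝ),
          (|ρ z.1 z.2 - c| * fderiv ℝ φ z (1, 0)
            + kruzkovFlux V c (ρ z.1 z.2) * fderiv ℝ φ z (0, 1)))
        + ∫ x : ℝ, |ρ₀ x - c| * φ (0, x)

/-- `ρ ∈ C([0,∞); L¹_loc(ℝ))`. -/
structure IsTimeContinuous (ρ : ℝ → ℝ → ℝ) : Prop where
  locallyIntegrable : ∀ t ≥ 0, LocallyIntegrable (ρ t) volume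
  tendsto : ∀ t ≥ 0, ∀ C : Set ℝ, IsCompact C →
    Tendsto (fun s => eLpNorm (fun x => ρ s x - ρ t x) 1 (volume.restrict C))
      (𝓝[Ici 0] t) (𝓝 0)

end

/-! ### Velocities -/

/-- A velocity on the whole line: nonincreasing, with values in `[0, A]`, Lipschitz constant `L`. -/
structure IsVelocity (V : ℝ → ℝ) (A L : ℝ) : Prop where
  anti : Antitone V
  nonneg : ∀ x, 0 ≤ V x
  le : ∀ x, V x ≤ A
  lip : ∀ x y, |V x - V y| ≤ L * |x - y|
  lip_nonneg : 0 ≤ L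

/-- Extension of a function on `[0,1]` to the line by its boundary values. -/
def clampExtend (V : ℝ → ℝ) (x : ℝ) : ℝ := V (max 0 (min 1 x))

lemma clampExtend_of_mem {V : ℝ → ℝ} {x : ℝ} (hx : x ∈ Icc (0 : ℝ) 1) :
    clampExtend V x = V x := by
  simp [clampExtend, hx.1, hx.2]

lemma abs_le_linftyNorm_of_ae {f : ℝ → ℝ} {C : ℝ}
    (hf : AEStronglyMeasurable f (volume.restrict (Icc (0 : ℝ) 1)))
    (hC : ∀ᵐ x ∂(volume.restrict (Icc (0 : ℝ) 1)), |f x| ≤ C) :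
    ∀ᵐ x ∂(volume.restrict (Icc (0 : ℝ) 1)), |f x| ≤ linftyNorm f := by
  have hm : MemLp f ⊤ (volume.restrict (Icc (0 : ℝ) 1)) :=
    memLp_top_of_bound hf C (by simpa [Real.norm_eq_abs] using hC)
  have h2 := ae_le_eLpNormEssSup (f := f) (μ := volume.restrict (Icc (0 : ℝ) 1))
  filter_upwards [h2] with x hx
  rw [← eLpNorm_exponent_top] at hx
  have := ENNReal.toReal_mono hm.2.ne hx
  simpa [linftyNorm] using this

lemma linftyNorm_nonneg (f : ℝ → ℝ) : 0 ≤ linftyNorm f := ENNReal.toReal_nonneg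

lemma IsAdmissibleVelocity.sub_eq_integral {V : ℝ → ℝ} (hV : IsAdmissibleVelocity V) {a b : ℝ}
    (ha : a ∈ Icc (0 : ℝ) 1) (hb : b ∈ Icc (0 : ℝ) 1) :
    ∫ x in a..b, deriv V x = V b - V a := by
  obtain ⟨K, hK⟩ := hV.lipschitz
  have hs : uIcc a b ⊆ Icc 0 1 := uIcc_subset_Icc ha hb
  exact (LipschitzOnWith.absolutelyContinuousOnInterval (hK.mono hs)).integral_deriv_eq_sub

lemma IsAdmissibleVelocity.ae_abs_deriv_le {V : ℝ → ℝ} (hV : IsAdmissibleVelocity V) :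
    ∀ᵐ x ∂(volume.restrict (Icc (0 : ℝ) 1)), |deriv V x| ≤ linftyNorm (deriv V) := by
  obtain ⟨K, hK⟩ := hV.lipschitz
  refine abs_le_linftyNorm_of_ae (C := K) (measurable_deriv V).aestronglyMeasurable ?_
  rw [restrict_Ioo_eq_restrict_Icc.symm]
  filter_upwards [ae_restrict_mem measurableSet_Ioo] with x hx
  exact norm_deriv_le_of_lipschitzOn (Icc_mem_nhds hx.1 hx.2) hK

lemma IsAdmissibleVelocity.ae_mem_of_uIoc {p : ℝ → Prop} {a b : ℝ}
    (hp : ∀ᵐ x ∂(volume.restrict (Icc (0 : ℝ) 1)), p x)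
    (ha : a ∈ Icc (0 : ℝ) 1) (hb : b ∈ Icc (0 : ℝ) 1) :
    ∀ᵐ x, x ∈ uIoc a b → p x := by
  rw [ae_restrict_iff' measurableSet_Icc] at hp
  filter_upwards [hp] with x hx hxab
  exact hx (uIcc_subset_Icc ha hb (uIoc_subset_uIcc hxab))

theorem IsAdmissibleVelocity.isVelocity {V : ℝ → ℝ} (hV : IsAdmissibleVelocity V) :
    IsVelocity (clampExtend V) (linftyNorm V) (linftyNorm (deriv V)) := by
  have hmem : ∀ x : ℝ, max 0 (min 1 x) ∈ Icc (0 : ℝ) 1 := fun x => by simp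
  have hcl : ∀ x y : ℝ, |max 0 (min 1 x) - max 0 (min 1 y)| ≤ |x - y| := fun x y =>
    (by simpa using abs_max_sub_max_le_max 0 (min 1 x) 0 (min 1 y) : _ ≤ |min 1 x - min 1 y|).trans
      (by simpa using abs_min_sub_min_le_max 1 x 1 y)
  refine ⟨fun x y hxy => ?_, fun x => hV.nonneg _ (hmem x), fun x => ?_, fun x y => ?_,
    linftyNorm_nonneg _⟩
  · have h := hV.sub_eq_integral (hmem x) (hmem y)
    have hle : max 0 (min 1 x) ≤ max 0 (min 1 y) := by gcongr
    have : ∫ z in (max 0 (min 1 x))..(max 0 (min 1 y)), deriv V z ≤ 0 := by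
      have h1 := IsAdmissibleVelocity.ae_mem_of_uIoc hV.deriv_nonpos (hmem x) (hmem y)
      rw [intervalIntegral.integral_of_le hle]
      refine integral_nonpos_of_ae ?_
      rw [uIoc_of_le hle] at h1
      exact (ae_restrict_iff' measurableSet_Ioc).2 h1
    unfold clampExtend
    linarith
  · obtain ⟨K, hK⟩ := hV.lipschitz
    have hcont := hK.continuousOn
    have h1 : ∀ᵐ x ∂(volume.restrict (Icc (0 : ℝ) 1)), |V x| ≤ linftyNorm V := by
      obtain ⟨C, hC⟩ := isCompact_Icc.exists_bound_of_continuousOn hcont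
      refine abs_le_linftyNorm_of_ae (C := C) (hcont.aestronglyMeasurable measurableSet_Icc) ?_
      exact (ae_restrict_iff' measurableSet_Icc).2 (Eventually.of_forall fun x hx => hC x hx)
    by_contra! hlt
    set y := max 0 (min 1 x) with hy
    have hlt' : linftyNorm V < V y := hlt
    have hn : ∀ᶠ z in 𝓝[Icc (0 : ℝ) 1] y, linftyNorm V < V z :=
      (hcont y (hmem x)).eventually (lt_mem_nhds hlt')
    have hn2 : ∀ᶠ z in 𝓝[Ioo (0 : ℝ) 1] y, linftyNorm V < V z :=
      hn.filter_mono (nhdsWithin_mono _ Ioo_subset_Icc_self)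
    obtain ⟨U, hU, hyU, hUV⟩ := mem_nhdsWithin.1 hn2
    have hne : (U ∩ Ioo (0 : ℝ) 1).Nonempty := by
      have : y ∈ closure (Ioo (0 : ℝ) 1) := by
        rw [closure_Ioo (by norm_num)]; exact hmem x
      exact mem_closure_iff.1 this U hU hyU
    have hpos : 0 < volume (U ∩ Ioo (0 : ℝ) 1) := (hU.inter isOpen_Ioo).measure_pos _ hne
    rw [ae_restrict_iff' measurableSet_Icc] at h1
    have hz : volume (U ∩ Ioo (0 : ℝ) 1) = 0 := by
      refine measure_mono_null (fun z hz => ?_) h1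
      simp only [mem_compl_iff, mem_ofPred_eq]
      intro hcon
      have h3 := hUV hz
      have h4 := hcon (Ioo_subset_Icc_self hz.2)
      exact absurd (le_abs_self _ |>.trans h4) (not_le.2 h3)
    exact hpos.ne' hz
  · have h := hV.sub_eq_integral (hmem y) (hmem x)
    have h1 := IsAdmissibleVelocity.ae_mem_of_uIoc hV.ae_abs_deriv_le (hmem y) (hmem x)
    have h2 := intervalIntegral.norm_integral_le_of_norm_le_const_ae
      (f := deriv V) (C := linftyNorm (deriv V)) h1
    rw [h] at h2
    exact h2.trans (mul_le_mul_of_nonneg_left (hcl x y) (linftyNorm_nonneg _))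

/-! ### Kružkov fluxes -/

/-- The deviation `sgn(w - c) (V(w) - V(c))` of the velocity. -/
def velDev (V : ℝ → ℝ) (c w : ℝ) : ℝ := V (max w c) - V (min w c)

lemma kruzkovFlux_eq (V : ℝ → ℝ) (c w : ℝ) :
    kruzkovFlux V c w = w * velDev V c w + V c * |w - c| := by
  unfold kruzkovFlux velDev
  rcases lt_trichotomy w c with h | h | h
  · rw [Real.sign_of_neg (by linarith), max_eq_right h.le, min_eq_left h.le,
      abs_of_neg (by linarith)]; ring
  · simp [h]
  · rw [Real.sign_of_pos (by linarith), max_eq_left h.le, min_eq_right h.le,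
      abs_of_pos (by linarith)]; ring

lemma kruzkovFlux_symm (V : ℝ → ℝ) (c w : ℝ) : kruzkovFlux V c w = kruzkovFlux V w c := by
  unfold kruzkovFlux
  rw [← neg_sub c w, Real.sign_neg]; ring

namespace IsVelocity

variable {V : ℝ → ℝ} {A L : ℝ}

lemma bound_nonneg (hV : IsVelocity V A L) : 0 ≤ A := (hV.nonneg 0).trans (hV.le 0)

lemma continuous (hV : IsVelocity V A L) : Continuous V := by
  have : LipschitzWith L.toNNReal V := LipschitzWith.of_dist_le_mul fun x y => by
    rw [Real.dist_eq, Real.dist_eq, Real.coe_toNNReal _ hV.lip_nonneg]; exact hV.lip x y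
  exact this.continuous

lemma abs_velDev_le (hV : IsVelocity V A L) (c w : ℝ) : |velDev V c w| ≤ A := by
  unfold velDev
  rw [abs_le]
  constructor <;> linarith [hV.nonneg (max w c), hV.nonneg (min w c), hV.le (max w c),
    hV.le (min w c)]

lemma abs_velDev_sub_le (hV : IsVelocity V A L) (c a b : ℝ) :
    |velDev V c a - velDev V c b| ≤ |V a - V b| := by
  wlog hab : a ≤ b generalizing a b
  · rw [abs_sub_comm, abs_sub_comm (V a)]; exact this b a (le_of_not_ge hab)
  have h1 := hV.anti hab
  rw [abs_of_nonneg (by linarith : 0 ≤ V a - V b)]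
  unfold velDev
  rw [abs_le]
  rcases le_total a c with h | h <;> rcases le_total b c with h' | h' <;>
    simp only [h, h', max_eq_left, max_eq_right, min_eq_left, min_eq_right] <;>
    constructor <;> linarith [hV.anti h, hV.anti h']

lemma abs_flux_sub_le (hV : IsVelocity V A L) {a b : ℝ} (ha : a ∈ Icc (0 : ℝ) 1) :
    |a * V a - b * V b| ≤ (A + L) * |a - b| := by
  have h : a * V a - b * V b = a * (V a - V b) + (a - b) * V b := by ring
  rw [h]
  refine (abs_add_le _ _).trans ?_
  rw [abs_mul, abs_mul, abs_of_nonneg ha.1, abs_of_nonneg (hV.nonneg b)]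
  have h1 : a * |V a - V b| ≤ 1 * (L * |a - b|) :=
    mul_le_mul ha.2 (hV.lip a b) (abs_nonneg _) zero_le_one
  have h2 : |a - b| * V b ≤ |a - b| * A := mul_le_mul_of_nonneg_left (hV.le b) (abs_nonneg _)
  linarith

lemma abs_kruzkovFlux_le (hV : IsVelocity V A L) {c w : ℝ} (hw : w ∈ Icc (0 : ℝ) 1) :
    |kruzkovFlux V c w| ≤ (A + L) * |w - c| := by
  unfold kruzkovFlux
  rw [abs_mul]
  have h1 : |Real.sign (w - c)| ≤ 1 := by
    rcases Real.sign_apply_eq (w - c) with h | h | h <;> simp [h]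
  calc _ ≤ 1 * |w * V w - c * V c| := mul_le_mul_of_nonneg_right h1 (abs_nonneg _)
    _ ≤ _ := by rw [one_mul]; exact hV.abs_flux_sub_le hw

lemma abs_kruzkovFlux_sub_le (hV : IsVelocity V A L) {c a b : ℝ}
    (ha : a ∈ Icc (0 : ℝ) 1) (hb : b ∈ Icc (0 : ℝ) 1) :
    |kruzkovFlux V c a - kruzkovFlux V c b| ≤ (A + L) * |a - b| := by
  wlog hab : a ≤ b generalizing a b
  · rw [abs_sub_comm, abs_sub_comm a]; exact this hb ha (le_of_not_ge hab)
  have hAL : 0 ≤ A + L := add_nonneg hV.bound_nonneg hV.lip_nonneg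
  rcases lt_or_ge b c with h | h
  · have e : kruzkovFlux V c a - kruzkovFlux V c b = b * V b - a * V a := by
      unfold kruzkovFlux
      rw [Real.sign_of_neg (by linarith), Real.sign_of_neg (by linarith)]; ring
    rw [e, abs_sub_comm a]; exact hV.abs_flux_sub_le hb
  · rcases lt_or_ge c a with h' | h'
    · have e : kruzkovFlux V c a - kruzkovFlux V c b = a * V a - b * V b := by
        unfold kruzkovFlux
        rw [Real.sign_of_pos (by linarith), Real.sign_of_pos (by linarith)]; ring
      rw [e]; exact hV.abs_flux_sub_le ha
    · have h1 := hV.abs_kruzkovFlux_le (c := c) ha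
      have h2 := hV.abs_kruzkovFlux_le (c := c) hb
      rw [abs_of_nonpos (by linarith : a - c ≤ 0)] at h1
      rw [abs_of_nonneg (by linarith : 0 ≤ b - c)] at h2
      rw [abs_of_nonpos (by linarith : a - b ≤ 0)]
      calc _ ≤ |kruzkovFlux V c a| + |kruzkovFlux V c b| := abs_sub _ _
        _ ≤ _ := by linarith

lemma continuous_kruzkovFlux (hV : IsVelocity V A L) :
    Continuous fun p : ℝ × ℝ => kruzkovFlux V p.1 p.2 := by
  have hc := hV.continuous
  simp only [kruzkovFlux_eq, velDev]
  fun_prop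

end IsVelocity


/-! ### Sequences on the integers: variation and summation by parts -/

/-- Total variation of a sequence indexed by the integers. -/
noncomputable def seqVar (u : ℤ → ℝ) : ℝ≥0∞ := ∑' j : ℤ, ‖u (j + 1) - u j‖ₑ

lemma enorm_sub_le_sum_range (u : ℤ → ℝ) (j : ℤ) (m : ℕ) :
    ‖u (j + m) - u j‖ₑ ≤ ∑ i ∈ Finset.range m, ‖u (j + i + 1) - u (j + i)‖ₑ := by
  induction m with
  | zero => simp
  | succ m ih =>
    rw [Finset.sum_range_succ]
    have : u (j + ((m + 1 : ℕ) : ℤ)) - u j = (u (j + m) - u j) + (u (j + m + 1) - u (j + m)) := by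
      push_cast; rw [← add_assoc]; ring
    rw [this]
    exact (enorm_add_le _ _).trans (by gcongr)

lemma tsum_int_shift (f : ℤ → ℝ≥0∞) (m : ℤ) : ∑' j, f (j + m) = ∑' j, f j :=
  (Equiv.addRight m).tsum_eq f

lemma tsum_enorm_shift_sub_le (u : ℤ → ℝ) (m : ℕ) :
    ∑' j : ℤ, ‖u (j + m) - u j‖ₑ ≤ m * seqVar u := by
  calc _ ≤ ∑' j : ℤ, ∑ i ∈ Finset.range m, ‖u (j + i + 1) - u (j + i)‖ₑ :=
        ENNReal.tsum_le_tsum fun j => enorm_sub_le_sum_range u j m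
    _ = ∑ i ∈ Finset.range m, ∑' j : ℤ, ‖u (j + i + 1) - u (j + i)‖ₑ :=
        Summable.tsum_finsetSum fun _ _ => ENNReal.summable
    _ = ∑ i ∈ Finset.range m, seqVar u := by
        refine Finset.sum_congr rfl fun i _ => ?_
        exact tsum_int_shift (fun j => ‖u (j + 1) - u j‖ₑ) i
    _ = _ := by simp

lemma tsum_nat_ite_le (f : ℕ → ℝ≥0∞) (l : ℕ) :
    ∑' k, (if l ≤ k then f k else 0) = ∑' k, f (l + k) := by
  rw [← ENNReal.summable.sum_add_tsum_nat_add' (k := l) (f := fun k => if l ≤ k then f k else 0)]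
  rw [Finset.sum_eq_zero fun i hi => if_neg (by simpa using hi), zero_add]
  exact tsum_congr fun k => by rw [if_pos (by omega), add_comm]

/-- Summation by parts for series of nonnegative terms. -/
lemma tsum_mul_sum_range_succ {b e a : ℕ → ℝ≥0∞} (hb : ∀ l, b l = ∑' k, e (l + k)) :
    ∑' k, e k * ∑ l ∈ Finset.range (k + 1), a l = ∑' l, b l * a l := by
  have h1 : ∀ k, e k * ∑ l ∈ Finset.range (k + 1), a l
      = ∑' l, (if l ≤ k then e k else 0) * a l := fun k => by
    rw [Finset.mul_sum, tsum_eq_sum (s := Finset.range (k + 1))]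
    · refine Finset.sum_congr rfl fun l hl => ?_
      rw [if_pos (by simpa [Nat.lt_succ_iff] using hl)]
    · intro l hl
      rw [if_neg (by simpa [Nat.lt_succ_iff] using hl), zero_mul]
  simp_rw [h1]
  rw [ENNReal.tsum_comm]
  refine tsum_congr fun l => ?_
  rw [ENNReal.tsum_mul_right, tsum_nat_ite_le, hb]

/-! ### Weights -/

/-- Nonnegative, nonincreasing, convex weights of sum one. -/
structure IsWeight (w : ℕ → ℝ) : Prop where
  nonneg : ∀ k, 0 ≤ w k
  mono : ∀ k, w (k + 1) ≤ w k
  hasSum : HasSum w 1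
  convex : ∀ k, 0 ≤ w k + w (k + 2) - 2 * w (k + 1)

lemma IsAdmissibleWeights.isWeight {γ : ℝ → ℝ → ℕ → ℝ} (hγ : IsAdmissibleWeights γ) {ε h : ℝ}
    (hε : 0 < ε) (hh : 0 < h) : IsWeight (γ ε h) where
  nonneg := hγ.nonneg ε hε h hh
  mono := hγ.mono ε hε h hh
  hasSum := hγ.normalized ε hε h hh
  convex k := hγ.convex ε hε h hh (k + 1) (by omega)

lemma hasSum_sub_succ {w : ℕ → ℝ} (hw : ∀ k, w (k + 1) ≤ w k) (h0 : Tendsto w atTop (𝓝 0)) :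
    HasSum (fun k => w k - w (k + 1)) (w 0) := by
  rw [hasSum_iff_tendsto_nat_of_nonneg (fun k => sub_nonneg.2 (hw k))]
  have : ∀ n, ∑ i ∈ Finset.range n, (w i - w (i + 1)) = w 0 - w n := fun n =>
    Finset.sum_range_sub' w n
  simp_rw [this]
  simpa using h0.const_sub (w 0)

lemma ofReal_eq_tsum_sub_succ {w : ℕ → ℝ} (hw : ∀ k, w (k + 1) ≤ w k)
    (h0 : Tendsto w atTop (𝓝 0)) (l : ℕ) :
    ENNReal.ofReal (w l) = ∑' k, ENNReal.ofReal (w (l + k) - w (l + k + 1)) := by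
  have h1 : HasSum (fun k => w (l + k) - w (l + k + 1)) (w l) := by
    have := hasSum_sub_succ (w := fun k => w (l + k)) (fun k => hw _)
      (h0.comp (tendsto_atTop_mono (fun k => by simp) tendsto_id))
    simpa [add_assoc] using this
  rw [← h1.tsum_eq, ENNReal.ofReal_tsum_of_nonneg (fun k => sub_nonneg.2 (hw _)) h1.summable]

namespace IsWeight

variable {w : ℕ → ℝ}

lemma tendsto (hw : IsWeight w) : Tendsto w atTop (𝓝 0) := hw.hasSum.summable.tendsto_atTop_zero

lemma zero_le_one (hw : IsWeight w) : w 0 ≤ 1 := le_hasSum hw.hasSum 0 fun k _ => hw.nonneg k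

lemma diff_nonneg (hw : IsWeight w) (k : ℕ) : 0 ≤ w k - w (k + 1) := sub_nonneg.2 (hw.mono k)

lemma hasSum_diff (hw : IsWeight w) : HasSum (fun k => w k - w (k + 1)) (w 0) :=
  hasSum_sub_succ hw.mono hw.tendsto

lemma diff_mono (hw : IsWeight w) (k : ℕ) : w (k + 1) - w (k + 2) ≤ w k - w (k + 1) := by
  linarith [hw.convex k]

lemma summable_mul (hw : IsWeight w) {s : ℕ → ℝ} {C : ℝ} (hs : ∀ k, |s k| ≤ C) :
    Summable fun k => w k * s k := by
  refine Summable.of_norm_bounded (hw.hasSum.summable.mul_right C) fun k => ?_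
  rw [Real.norm_eq_abs, abs_mul, abs_of_nonneg (hw.nonneg k)]
  exact mul_le_mul_of_nonneg_left (hs k) (hw.nonneg k)

lemma summable_diff_mul (hw : IsWeight w) {s : ℕ → ℝ} {C : ℝ} (hs : ∀ k, |s k| ≤ C) :
    Summable fun k => (w k - w (k + 1)) * s k := by
  refine Summable.of_norm_bounded (hw.hasSum_diff.summable.mul_right C) fun k => ?_
  rw [Real.norm_eq_abs, abs_mul, abs_of_nonneg (hw.diff_nonneg k)]
  exact mul_le_mul_of_nonneg_left (hs k) (hw.diff_nonneg k)

/-- Discrete differentiation of the nonlocal impact. -/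
lemma impact_sub (hw : IsWeight w) {s : ℤ → ℝ} {C : ℝ} (hs : ∀ j, |s j| ≤ C) (j : ℤ) :
    nonlocalImpact w s (j - 1) - nonlocalImpact w s j
      = w 0 * s (j - 1) - ∑' k : ℕ, (w k - w (k + 1)) * s (j + k) := by
  unfold nonlocalImpact
  have h1 : Summable fun k : ℕ => w k * s (j - 1 + k) := hw.summable_mul fun k => hs _
  have h2 : Summable fun k : ℕ => w k * s (j + k) := hw.summable_mul fun k => hs _
  have h4 : Summable fun k : ℕ => w (k + 1) * s (j + k) := by
    have := (summable_nat_add_iff 1).2 h1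
    refine this.congr fun k => ?_
    push_cast
    rw [show j - 1 + ((k : ℤ) + 1) = j + k by ring]
  rw [h1.tsum_eq_zero_add]
  have h5 : ∑' k : ℕ, (w k - w (k + 1)) * s (j + k)
      = ∑' k : ℕ, w k * s (j + k) - ∑' k : ℕ, w (k + 1) * s (j + k) := by
    rw [← h2.tsum_sub h4]
    exact tsum_congr fun k => by ring
  have h6 : ∑' k : ℕ, w (k + 1) * s (j - 1 + ((k + 1 : ℕ) : ℤ))
      = ∑' k : ℕ, w (k + 1) * s (j + k) := tsum_congr fun k => by
    push_cast
    rw [show j - 1 + ((k : ℤ) + 1) = j + k by ring]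
  rw [h5, h6, Nat.cast_zero, add_zero]
  ring

lemma impact_mem (hw : IsWeight w) {r : ℤ → ℝ} (hr : ∀ j, r j ∈ Icc (0 : ℝ) 1) (j : ℤ) :
    nonlocalImpact w r j ∈ Icc (0 : ℝ) 1 := by
  constructor
  · exact tsum_nonneg fun k => mul_nonneg (hw.nonneg k) (hr _).1
  · rw [← hw.hasSum.tsum_eq]
    have h : ∀ k : ℕ, |r (j + k)| ≤ 1 := fun k => by
      rw [abs_of_nonneg (hr _).1]; exact (hr _).2
    refine Summable.tsum_le_tsum (fun k => ?_) (hw.summable_mul h) hw.hasSum.summable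
    exact mul_le_of_le_one_right (hw.nonneg k) (hr _).2

end IsWeight

/-! ### One step of the scheme -/

/-- One step of the scheme. -/
noncomputable def schemeStep (V : ℝ → ℝ) (w : ℕ → ℝ) (lam : ℝ) (r : ℤ → ℝ) (j : ℤ) : ℝ :=
  r j + lam * (r (j - 1) * V (nonlocalImpact w r j) - r j * V (nonlocalImpact w r (j + 1)))

/-- Numerical entropy flux through the left end of the cell `j`. -/
noncomputable def entropyFlux (V : ℝ → ℝ) (w : ℕ → ℝ) (r : ℤ → ℝ) (c : ℝ) (j : ℤ) : ℝ :=
  V c * |nonlocalImpact w r (j - 1) - c|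
    + nonlocalImpact w (fun i => r i * velDev V c (nonlocalImpact w r (i + 1))) (j - 1)

/-- The data of one step of the scheme under the CFL condition. -/
structure StepData (V : ℝ → ℝ) (A L : ℝ) (w : ℕ → ℝ) (lam : ℝ) (r : ℤ → ℝ) : Prop where
  vel : IsVelocity V A L
  weight : IsWeight w
  lam_pos : 0 < lam
  cfl : lam * (A + L) ≤ 1
  mem : ∀ j, r j ∈ Icc (0 : ℝ) 1

namespace StepData

variable {V : ℝ → ℝ} {A L : ℝ} {w : ℕ → ℝ} {lam : ℝ} {r : ℤ → ℝ}

lemma abs_le (H : StepData V A L w lam r) (j : ℤ) : |r j| ≤ 1 := by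
  rw [abs_of_nonneg (H.mem j).1]; exact (H.mem j).2

lemma tsum_diff_le (H : StepData V A L w lam r) (j : ℤ) :
    ∑' k : ℕ, (w k - w (k + 1)) * r (j + k) ≤ w 0 := by
  rw [← H.weight.hasSum_diff.tsum_eq]
  refine Summable.tsum_le_tsum (fun k => ?_) (H.weight.summable_diff_mul fun k => H.abs_le _)
    H.weight.hasSum_diff.summable
  exact mul_le_of_le_one_right (H.weight.diff_nonneg k) (H.mem _).2

lemma tsum_diff_nonneg (H : StepData V A L w lam r) (j : ℤ) :
    0 ≤ ∑' k : ℕ, (w k - w (k + 1)) * r (j + k) :=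
  tsum_nonneg fun k => mul_nonneg (H.weight.diff_nonneg k) (H.mem _).1

/-- Maximum principle for the density. -/
lemma step_mem (H : StepData V A L w lam r) (j : ℤ) : schemeStep V w lam r j ∈ Icc (0 : ℝ) 1 := by
  obtain ⟨hV, hw, hl, hcfl, hr⟩ := id H
  set a := nonlocalImpact w r j
  set b := nonlocalImpact w r (j + 1)
  have hLn := hV.lip_nonneg
  have hlA : lam * V b ≤ 1 := by
    nlinarith [hV.le b]
  unfold schemeStep
  constructor
  · have h1 : 0 ≤ r j * (1 - lam * V b) := mul_nonneg (hr j).1 (by linarith)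
    have h2 : 0 ≤ lam * (r (j - 1) * V a) :=
      mul_nonneg hl.le (mul_nonneg (hr _).1 (hV.nonneg _))
    nlinarith
  · have h1 : a - b ≥ -(1 - r j) := by
      have h2 := hw.impact_sub H.abs_le (j + 1)
      rw [add_sub_cancel_right] at h2
      have h3 := H.tsum_diff_le (j + 1)
      have h4 := hw.zero_le_one
      have h5 := hw.nonneg 0
      have : w 0 * (1 - r j) ≤ 1 - r j := mul_le_of_le_one_left (by linarith [(hr j).2]) h4
      show nonlocalImpact w r j - nonlocalImpact w r (j + 1) ≥ _
      rw [h2]; nlinarith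
    have h6 : V a - V b ≤ L * (1 - r j) := by
      rcases le_total a b with h | h
      · have := hV.lip a b
        rw [abs_of_nonpos (by linarith : a - b ≤ 0)] at this
        have h7 : L * -(a - b) ≤ L * (1 - r j) := mul_le_mul_of_nonneg_left (by linarith) hLn
        linarith [le_abs_self (V a - V b)]
      · have := hV.anti h
        have : 0 ≤ L * (1 - r j) := mul_nonneg hLn (by linarith [(hr j).2])
        linarith
    have h8 : r (j - 1) * V a - r j * V b ≤ (1 - r j) * (A + L) := by
      have e1 : r (j - 1) * V a ≤ V a := mul_le_of_le_one_left (hV.nonneg _) (hr _).2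
      have e2 : r j * (V a - V b) ≤ L * (1 - r j) := by
        calc r j * (V a - V b) ≤ r j * (L * (1 - r j)) := mul_le_mul_of_nonneg_left h6 (hr j).1
          _ ≤ 1 * (L * (1 - r j)) := mul_le_mul_of_nonneg_right (hr j).2
              (mul_nonneg hLn (by linarith [(hr j).2]))
          _ = _ := one_mul _
      have e3 : (1 - r j) * V a ≤ (1 - r j) * A :=
        mul_le_mul_of_nonneg_left (hV.le a) (by linarith [(hr j).2])
      nlinarith
    have h9 : lam * ((1 - r j) * (A + L)) ≤ 1 - r j := by
      calc lam * ((1 - r j) * (A + L)) = (1 - r j) * (lam * (A + L)) := by ring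
        _ ≤ (1 - r j) * 1 := mul_le_mul_of_nonneg_left hcfl (by linarith [(hr j).2])
        _ = _ := mul_one _
    have := mul_le_mul_of_nonneg_left h8 hl.le
    linarith

lemma abs_mul_le (H : StepData V A L w lam r) {C : ℝ} {g : ℤ → ℝ} (hg : ∀ j, |g j| ≤ C) (j : ℤ) :
    |r j * g j| ≤ C := by
  rw [abs_mul]
  calc |r j| * |g j| ≤ 1 * |g j| := mul_le_mul_of_nonneg_right (H.abs_le j) (abs_nonneg _)
    _ ≤ C := by rw [one_mul]; exact hg j

lemma abs_vel_le (H : StepData V A L w lam r) (x : ℝ) : |V x| ≤ A := by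
  rw [abs_of_nonneg (H.vel.nonneg x)]; exact H.vel.le x

/-- Evolution of the nonlocal impact in conservative form. -/
lemma impact_step (H : StepData V A L w lam r) (j : ℤ) :
    nonlocalImpact w (schemeStep V w lam r) j = nonlocalImpact w r j
      + lam * (w 0 * (r (j - 1) * V (nonlocalImpact w r j))
        - ∑' k : ℕ, (w k - w (k + 1)) * (r (j + k) * V (nonlocalImpact w r (j + k + 1)))) := by
  have hb : ∀ i, |r i * V (nonlocalImpact w r (i + 1))| ≤ A := fun i =>
    H.abs_mul_le (g := fun i => V (nonlocalImpact w r (i + 1))) (fun i => H.abs_vel_le _) i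
  have h := H.weight.impact_sub (s := fun i => r i * V (nonlocalImpact w r (i + 1))) hb j
  simp only [sub_add_cancel] at h
  rw [← h]
  have h1 : Summable fun k : ℕ => w k * r (j + k) := H.weight.summable_mul fun k => H.abs_le _
  have h2 := H.weight.summable_mul (s := fun k : ℕ =>
    r (j - 1 + k) * V (nonlocalImpact w r (j - 1 + k + 1))) (fun k => hb _)
  have h3 := H.weight.summable_mul (s := fun k : ℕ =>
    r (j + k) * V (nonlocalImpact w r (j + k + 1))) (fun k => hb _)
  change ∑' k : ℕ, w k * schemeStep V w lam r (j + k) = ∑' k : ℕ, w k * r (j + k)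
    + lam * (∑' k : ℕ, w k * (r (j - 1 + k) * V (nonlocalImpact w r (j - 1 + k + 1)))
      - ∑' k : ℕ, w k * (r (j + k) * V (nonlocalImpact w r (j + k + 1))))
  rw [← h2.tsum_sub h3, ← tsum_mul_left, ← h1.tsum_add ((h2.sub h3).mul_left lam)]
  refine tsum_congr fun k => ?_
  unfold schemeStep
  rw [show j + (k : ℤ) - 1 = j - 1 + k by ring, show j - 1 + (k : ℤ) + 1 = j + k by ring]
  ring

/-- Discrete entropy inequality for the nonlocal impact. -/
lemma entropy_step (H : StepData V A L w lam r) (c : ℝ) (j : ℤ) :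
    |nonlocalImpact w (schemeStep V w lam r) j - c| ≤ |nonlocalImpact w r j - c|
      - lam * (entropyFlux V w r c (j + 1) - entropyFlux V w r c j) := by
  obtain ⟨hV, hw, hl, hcfl, hr⟩ := id H
  set W := nonlocalImpact w r with hW
  have hid := hw.impact_sub H.abs_le j
  have hQ := hw.impact_sub (s := fun i => r i * velDev V c (W (i + 1))) (C := A)
    (fun i => H.abs_mul_le (g := fun i => velDev V c (W (i + 1)))
      (fun i => hV.abs_velDev_le _ _) i) j
  simp only [sub_add_cancel] at hQ
  have hstep := H.impact_step j
  rw [← hW] at hid hstep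
  have hs0 := hw.summable_diff_mul (s := fun k : ℕ => r (j + k)) (fun k => H.abs_le _)
  have hs1 := hw.summable_diff_mul (s := fun k : ℕ => r (j + k) * V (W (j + k + 1))) (C := A)
    (fun k => H.abs_mul_le (g := fun i => V (W (i + 1))) (fun i => H.abs_vel_le _) _)
  have hs2 := hw.summable_diff_mul (s := fun k : ℕ => r (j + k) * velDev V c (W (j + k + 1)))
    (C := A) (fun k => H.abs_mul_le (g := fun i => velDev V c (W (i + 1)))
      (fun i => hV.abs_velDev_le _ _) _)
  have hdev : ∀ x, |V x - V c| = -velDev V c x := fun x => by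
    unfold velDev
    rcases le_total x c with h | h
    · rw [max_eq_right h, min_eq_left h, abs_of_nonneg (by linarith [hV.anti h])]; ring
    · rw [max_eq_left h, min_eq_right h, abs_of_nonpos (by linarith [hV.anti h])]
  have hsplit : ∑' k : ℕ, (w k - w (k + 1)) * (r (j + k) * (V (W (j + k + 1)) - V c))
      = ∑' k : ℕ, (w k - w (k + 1)) * (r (j + k) * V (W (j + k + 1)))
        - V c * ∑' k : ℕ, (w k - w (k + 1)) * r (j + k) := by
    rw [← tsum_mul_left, ← hs1.tsum_sub (hs0.mul_left (V c))]
    exact tsum_congr fun k => by ring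
  have hEq : nonlocalImpact w (schemeStep V w lam r) j - c
      = ((1 - lam * V c) * (W j - c) + lam * w 0 * r (j - 1) * (V (W j) - V c))
        + lam * V c * (W (j - 1) - c)
        - lam * ∑' k : ℕ, (w k - w (k + 1)) * (r (j + k) * (V (W (j + k + 1)) - V c)) := by
    rw [hstep, hsplit]
    linear_combination (-lam * V c) * hid
  have hT : |∑' k : ℕ, (w k - w (k + 1)) * (r (j + k) * (V (W (j + k + 1)) - V c))|
      ≤ -∑' k : ℕ, (w k - w (k + 1)) * (r (j + k) * velDev V c (W (j + k + 1))) := by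
    rw [← tsum_neg, ← Real.norm_eq_abs]
    refine tsum_of_norm_bounded hs2.neg.hasSum fun k => ?_
    rw [Real.norm_eq_abs, abs_mul, abs_mul, abs_of_nonneg (hw.diff_nonneg k),
      abs_of_nonneg (hr _).1, hdev]
    exact le_of_eq (by ring)
  have hc0 := hV.nonneg c
  have hcoef : 0 ≤ lam * w 0 * r (j - 1) :=
    mul_nonneg (mul_nonneg hl.le (hw.nonneg 0)) (hr _).1
  have hcoef2 : lam * w 0 * r (j - 1) ≤ lam := by
    rw [mul_assoc]
    refine mul_le_of_le_one_right hl.le (mul_le_one₀ hw.zero_le_one (hr _).1 (hr _).2)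
  have h1 : |(1 - lam * V c) * (W j - c) + lam * w 0 * r (j - 1) * (V (W j) - V c)|
      ≤ (1 - lam * V c) * |W j - c| + lam * w 0 * r (j - 1) * velDev V c (W j) := by
    have hlip := hV.lip (W j) c
    have hA := hV.le c
    have hLn := hV.lip_nonneg
    have hb : lam * w 0 * r (j - 1) * |V (W j) - V c| ≤ (1 - lam * V c) * |W j - c| := by
      calc _ ≤ lam * (L * |W j - c|) := mul_le_mul hcoef2 hlip (abs_nonneg _) hl.le
        _ = (lam * L) * |W j - c| := by ring
        _ ≤ _ := mul_le_mul_of_nonneg_right (by nlinarith) (abs_nonneg _)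
    have hd := hdev (W j)
    rw [hd] at hb
    rcases le_total (W j) c with h | h
    · have hs := hV.anti h
      rw [abs_of_nonneg (by linarith)] at hd
      rw [abs_of_nonpos (by linarith : W j - c ≤ 0)] at hb ⊢
      rw [abs_of_nonpos (by rw [hd]; linarith), hd]; linarith
    · have hs := hV.anti h
      rw [abs_of_nonpos (by linarith)] at hd
      rw [abs_of_nonneg (by linarith : 0 ≤ W j - c)] at hb ⊢
      have hd' : V (W j) - V c = velDev V c (W j) := by linarith
      rw [hd', abs_of_nonneg (by linarith)]
  have hfl : entropyFlux V w r c (j + 1) - entropyFlux V w r c j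
      = V c * |W j - c| - V c * |W (j - 1) - c| - (w 0 * (r (j - 1) * velDev V c (W j))
        - ∑' k : ℕ, (w k - w (k + 1)) * (r (j + k) * velDev V c (W (j + k + 1)))) := by
    unfold entropyFlux
    rw [← hQ, add_sub_cancel_right]; ring
  rw [hfl, hEq]
  refine (abs_sub _ _).trans ?_
  have h2 := abs_add_le ((1 - lam * V c) * (W j - c) + lam * w 0 * r (j - 1) * (V (W j) - V c))
    (lam * V c * (W (j - 1) - c))
  rw [abs_mul (lam * V c), abs_of_nonneg (mul_nonneg hl.le hc0)] at h2
  rw [abs_mul lam, abs_of_pos hl]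
  have h3 := mul_le_mul_of_nonneg_left hT hl.le
  nlinarith

end StepData


/-! ### Total variation estimates for the scheme -/

lemma tsum_triangle (e : ℕ → ℝ≥0∞) (R d : ℤ → ℝ≥0∞) :
    ∑' j : ℤ, ∑' k : ℕ, e k * (R (j + k) * ∑ i ∈ Finset.range (k + 1), d (j + i))
      = ∑' p : ℤ, d p * ∑' k : ℕ, e k * ∑ l ∈ Finset.range (k + 1), R (p + l) := by
  simp_rw [← ENNReal.tsum_mul_left]
  rw [ENNReal.tsum_comm, ENNReal.tsum_comm (α := ℤ)]
  refine tsum_congr fun k => ?_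
  have h1 : ∀ j : ℤ, e k * (R (j + k) * ∑ i ∈ Finset.range (k + 1), d (j + i))
      = ∑ i ∈ Finset.range (k + 1), e k * (R (j + k) * d (j + i)) := fun j => by
    rw [Finset.mul_sum, Finset.mul_sum]
  have h2 : ∀ p : ℤ, d p * (e k * ∑ l ∈ Finset.range (k + 1), R (p + l))
      = ∑ l ∈ Finset.range (k + 1), e k * (R (p + ((k - l : ℕ) : ℤ)) * d p) := fun p => by
    rw [← Finset.sum_range_reflect, Finset.mul_sum, Finset.mul_sum]
    refine Finset.sum_congr rfl fun l _ => ?_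
    rw [Nat.add_sub_cancel]; ring
  simp_rw [h1, h2]
  rw [Summable.tsum_finsetSum fun _ _ => ENNReal.summable,
    Summable.tsum_finsetSum fun _ _ => ENNReal.summable]
  refine Finset.sum_congr rfl fun i hi => ?_
  have hi' : i ≤ k := by simpa [Nat.lt_succ_iff] using hi
  rw [← tsum_int_shift (fun p : ℤ => e k * (R (p + ((k - i : ℕ) : ℤ)) * d p)) i]
  refine tsum_congr fun j => ?_
  rw [show j + (i : ℤ) + ((k - i : ℕ) : ℤ) = j + k by push_cast [hi']; ring]

namespace IsVelocity

variable {V : ℝ → ℝ} {A L : ℝ}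

lemma enorm_sub_le (hV : IsVelocity V A L) (x y : ℝ) :
    ‖V x - V y‖ₑ ≤ ENNReal.ofReal L * ‖x - y‖ₑ := by
  rw [Real.enorm_eq_ofReal_abs, Real.enorm_eq_ofReal_abs, ← ENNReal.ofReal_mul hV.lip_nonneg]
  exact ENNReal.ofReal_le_ofReal (hV.lip x y)

lemma seqVar_comp_le (hV : IsVelocity V A L) (u : ℤ → ℝ) :
    seqVar (fun j => V (u j)) ≤ ENNReal.ofReal L * seqVar u := by
  unfold seqVar
  rw [← ENNReal.tsum_mul_left]
  exact ENNReal.tsum_le_tsum fun j => hV.enorm_sub_le _ _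

end IsVelocity

namespace StepData

variable {V : ℝ → ℝ} {A L : ℝ} {w : ℕ → ℝ} {lam : ℝ} {r : ℤ → ℝ}

/-- The weighted sum of velocity differences that drives the impact. -/
lemma impact_step_sub (H : StepData V A L w lam r) (j : ℤ) :
    nonlocalImpact w (schemeStep V w lam r) j - nonlocalImpact w r j
      = lam * (V (nonlocalImpact w r j) * (nonlocalImpact w r (j - 1) - nonlocalImpact w r j)
        + ∑' k : ℕ, (w k - w (k + 1)) * (r (j + k)
          * (V (nonlocalImpact w r j) - V (nonlocalImpact w r (j + k + 1))))) := by
  set W := nonlocalImpact w r with hW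
  have hid := H.weight.impact_sub H.abs_le j
  have hstep := H.impact_step j
  rw [← hW] at hid hstep
  have hs0 := H.weight.summable_diff_mul (s := fun k : ℕ => r (j + k)) (fun k => H.abs_le _)
  have hs1 := H.weight.summable_diff_mul (s := fun k : ℕ => r (j + k) * V (W (j + k + 1))) (C := A)
    (fun k => H.abs_mul_le (g := fun i => V (W (i + 1))) (fun i => H.abs_vel_le _) _)
  have hsplit : ∑' k : ℕ, (w k - w (k + 1)) * (r (j + k) * (V (W j) - V (W (j + k + 1))))
      = V (W j) * ∑' k : ℕ, (w k - w (k + 1)) * r (j + k)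
        - ∑' k : ℕ, (w k - w (k + 1)) * (r (j + k) * V (W (j + k + 1))) := by
    rw [← tsum_mul_left, ← (hs0.mul_left (V (W j))).tsum_sub hs1]
    exact tsum_congr fun k => by ring
  rw [hstep, hsplit]
  linear_combination (-lam * V (W j)) * hid

/-- Evolution of the increments of the impact. -/
lemma impact_increment (H : StepData V A L w lam r) (j : ℤ) :
    nonlocalImpact w (schemeStep V w lam r) (j + 1) - nonlocalImpact w (schemeStep V w lam r) j
      = ((nonlocalImpact w r (j + 1) - nonlocalImpact w r j)
          * (1 - lam * V (nonlocalImpact w r (j + 1)))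
        - lam * (V (nonlocalImpact w r j) - V (nonlocalImpact w r (j + 1)))
          * ∑' k : ℕ, (w k - w (k + 1)) * r (j + k))
        + lam * V (nonlocalImpact w r j) * (nonlocalImpact w r j - nonlocalImpact w r (j - 1))
        + lam * ∑' k : ℕ, (w k - w (k + 1) - (w (k + 1) - w (k + 2))) * (r (j + 1 + k)
          * (V (nonlocalImpact w r (j + 1)) - V (nonlocalImpact w r (j + 1 + k + 1)))) := by
  set W := nonlocalImpact w r with hW
  have hid := H.weight.impact_sub H.abs_le j
  have hid1 := H.weight.impact_sub H.abs_le (j + 1)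
  have hstep := H.impact_step j
  have hstep1 := H.impact_step (j + 1)
  rw [← hW] at hid hstep hid1 hstep1
  rw [add_sub_cancel_right] at hid1 hstep1
  have hs0 := fun i : ℤ => H.weight.summable_diff_mul (s := fun k : ℕ => r (i + k))
    (fun k => H.abs_le _)
  have hs1 := fun i : ℤ => H.weight.summable_diff_mul
    (s := fun k : ℕ => r (i + k) * V (W (i + k + 1))) (C := A)
    (fun k => H.abs_mul_le (g := fun i => V (W (i + 1))) (fun i => H.abs_vel_le _) _)
  have e : ∀ k : ℕ, j + ((k + 1 : ℕ) : ℤ) = j + 1 + k := fun k => by push_cast; ring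
  have z0 := (hs0 j).tsum_eq_zero_add
  have z1 := (hs1 j).tsum_eq_zero_add
  have s0 := (summable_nat_add_iff 1).2 (hs0 j)
  have s1 := (summable_nat_add_iff 1).2 (hs1 j)
  simp only [e, Nat.cast_zero, add_zero, add_assoc, one_add_one_eq_two, zero_add] at z0 z1 s0 s1
  simp only [← add_assoc] at z0 z1 s0 s1
  have hsplit : ∑' k : ℕ, (w k - w (k + 1) - (w (k + 1) - w (k + 2))) * (r (j + 1 + k)
        * (V (W (j + 1)) - V (W (j + 1 + k + 1))))
      = V (W (j + 1)) * (∑' k : ℕ, (w k - w (k + 1)) * r (j + 1 + k)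
          - ∑' k : ℕ, (w (k + 1) - w (k + 2)) * r (j + 1 + k))
        - (∑' k : ℕ, (w k - w (k + 1)) * (r (j + 1 + k) * V (W (j + 1 + k + 1)))
          - ∑' k : ℕ, (w (k + 1) - w (k + 2)) * (r (j + 1 + k) * V (W (j + 1 + k + 1)))) := by
    rw [← (hs0 (j + 1)).tsum_sub s0, ← (hs1 (j + 1)).tsum_sub s1, ← tsum_mul_left,
      ← (((hs0 (j + 1)).sub s0).mul_left _).tsum_sub ((hs1 (j + 1)).sub s1)]
    exact tsum_congr fun k => by ring
  rw [hstep, hstep1, hsplit]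
  linear_combination (lam * V (W j)) * hid - (lam * V (W (j + 1))) * hid1
    - (lam * V (W (j + 1))) * z0 + lam * z1

lemma abs_increment_le (H : StepData V A L w lam r) {D du u b Y X : ℝ}
    (huA : u ≤ A) (hb1 : b ≤ 1) (hs : 0 ≤ D * du)
    (hdu : |du| ≤ L * |D|) :
    |(D * (1 - lam * u) - lam * du * b) + Y + X| + lam * (|du| * b) + lam * (u * |D|)
      ≤ |D| + |Y| + |X| := by
  have hl := H.lam_pos
  have hLn := H.vel.lip_nonneg
  have h0 : lam * (|du| * b) ≤ |D| * (1 - lam * u) := by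
    calc lam * (|du| * b) ≤ lam * (L * |D|) := by
          refine mul_le_mul_of_nonneg_left ?_ hl.le
          exact (mul_le_of_le_one_right (abs_nonneg _) hb1).trans hdu
      _ = |D| * (lam * L) := by ring
      _ ≤ _ := by
          refine mul_le_mul_of_nonneg_left ?_ (abs_nonneg _)
          have := H.cfl
          have : lam * u ≤ lam * A := mul_le_mul_of_nonneg_left huA hl.le
          linarith
  have h1 : |D * (1 - lam * u) - lam * du * b| ≤ |D| * (1 - lam * u) - lam * (|du| * b) := by
    rcases lt_trichotomy D 0 with h | h | h
    · have hd : du ≤ 0 := by by_contra! hc; nlinarith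
      rw [abs_of_neg h, abs_of_nonpos hd] at *
      rw [abs_of_nonpos (by linarith)]; linarith
    · subst h
      have : du = 0 := by simpa using hdu
      simp [this]
    · have hd : 0 ≤ du := by by_contra! hc; nlinarith
      rw [abs_of_pos h, abs_of_nonneg hd] at *
      rw [abs_of_nonneg (by linarith)]; linarith
  have h2 := abs_add_three (D * (1 - lam * u) - lam * du * b) Y X
  nlinarith

/-- The total variation of the impact does not increase. -/
theorem seqVar_impact_step_le (H : StepData V A L w lam r) :
    seqVar (nonlocalImpact w (schemeStep V w lam r)) ≤ seqVar (nonlocalImpact w r) := by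
  by_cases htop : seqVar (nonlocalImpact w r) = ⊤
  · rw [htop]; exact le_top
  obtain ⟨hV, hw, hl, hcfl, hr⟩ := id H
  set W := nonlocalImpact w r with hW
  set W' := nonlocalImpact w (schemeStep V w lam r) with hW'
  set b : ℤ → ℝ := fun j => ∑' k : ℕ, (w k - w (k + 1)) * r (j + k) with hbdef
  set X : ℤ → ℝ := fun j => ∑' k : ℕ, (w k - w (k + 1) - (w (k + 1) - w (k + 2)))
    * (r (j + k) * (V (W j) - V (W (j + k + 1)))) with hX
  set d : ℤ → ℝ≥0∞ := fun j => ‖V (W (j + 1)) - V (W j)‖ₑ with hd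
  have hb0 : ∀ j, 0 ≤ b j := H.tsum_diff_nonneg
  have hb1 : ∀ j, b j ≤ 1 := fun j => (H.tsum_diff_le j).trans hw.zero_le_one
  have hpt : ∀ j, |W' (j + 1) - W' j| + lam * (|V (W (j + 1)) - V (W j)| * b j)
      + lam * (V (W (j + 1)) * |W (j + 1) - W j|)
      ≤ |W (j + 1) - W j| + lam * (V (W j) * |W j - W (j - 1)|) + lam * |X (j + 1)| := fun j => by
    have h := H.impact_increment j
    rw [← hW, ← hW'] at h
    have hs : 0 ≤ (W (j + 1) - W j) * (V (W j) - V (W (j + 1))) := by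
      rcases le_total (W j) (W (j + 1)) with h | h
      · exact mul_nonneg (by linarith) (by linarith [hV.anti h])
      · exact mul_nonneg_of_nonpos_of_nonpos (by linarith) (by linarith [hV.anti h])
    have hdu : |V (W j) - V (W (j + 1))| ≤ L * |W (j + 1) - W j| := by
      rw [abs_sub_comm (W (j + 1))]; exact hV.lip _ _
    have h2 := H.abs_increment_le (hV.le (W (j + 1))) (hb1 j) hs hdu
      (Y := lam * V (W j) * (W j - W (j - 1))) (X := lam * X (j + 1))
    rw [← h, abs_mul, abs_mul lam, abs_of_pos hl, abs_mul lam, abs_of_pos hl,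
      abs_of_nonneg (hV.nonneg _), abs_sub_comm (V (W j))] at h2
    rwa [← mul_assoc lam (V (W j))]
  have hXle : ∀ j, ‖X j‖ₑ ≤ ∑' k : ℕ, ENNReal.ofReal (w k - w (k + 1) - (w (k + 1) - w (k + 2)))
      * (ENNReal.ofReal (r (j + k)) * ∑ i ∈ Finset.range (k + 1), d (j + i)) := fun j => by
    refine (enorm_tsum_le_tsum_enorm).trans (ENNReal.tsum_le_tsum fun k => ?_)
    rw [enorm_mul, enorm_mul, Real.enorm_of_nonneg (by linarith [hw.diff_mono k]),
      Real.enorm_of_nonneg (hr _).1]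
    gcongr
    rw [← enorm_neg, neg_sub]
    have := enorm_sub_le_sum_range (fun j => V (W j)) j (k + 1)
    refine le_trans (le_of_eq ?_) this
    push_cast
    rw [← add_assoc]
  have hbe : ∀ p : ℤ, ENNReal.ofReal (b p)
      = ∑' k : ℕ, ENNReal.ofReal (w k - w (k + 1) - (w (k + 1) - w (k + 2)))
        * ∑ l ∈ Finset.range (k + 1), ENNReal.ofReal (r (p + l)) := fun p => by
    have h0 : Tendsto (fun k => w k - w (k + 1)) atTop (𝓝 0) :=
      hw.hasSum_diff.summable.tendsto_atTop_zero
    rw [tsum_mul_sum_range_succ (b := fun k => ENNReal.ofReal (w k - w (k + 1)))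
      (fun l => ofReal_eq_tsum_sub_succ (w := fun k => w k - w (k + 1)) hw.diff_mono h0 l)]
    rw [hbdef]
    simp only
    rw [ENNReal.ofReal_tsum_of_nonneg
      (fun k => mul_nonneg (hw.diff_nonneg k) (hr _).1)
      (hw.summable_diff_mul fun k => H.abs_le _)]
    exact tsum_congr fun k => ENNReal.ofReal_mul (hw.diff_nonneg k)
  have hXsum : ∑' j, ‖X (j + 1)‖ₑ ≤ ∑' j, d j * ENNReal.ofReal (b j) := by
    rw [tsum_int_shift (fun j => ‖X j‖ₑ) 1]
    refine (ENNReal.tsum_le_tsum hXle).trans (le_of_eq ?_)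
    rw [tsum_triangle _ (fun j => ENNReal.ofReal (r j)) d]
    exact tsum_congr fun p => by rw [hbe]
  have hE : ∀ j, ‖W' (j + 1) - W' j‖ₑ + ENNReal.ofReal lam * (d j * ENNReal.ofReal (b j))
      + ENNReal.ofReal lam * (ENNReal.ofReal (V (W (j + 1))) * ‖W (j + 1) - W j‖ₑ)
      ≤ ‖W (j + 1) - W j‖ₑ
        + ENNReal.ofReal lam * (ENNReal.ofReal (V (W j)) * ‖W j - W (j - 1)‖ₑ)
        + ENNReal.ofReal lam * ‖X (j + 1)‖ₑ := fun j => by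
    have h := ENNReal.ofReal_le_ofReal (hpt j)
    have n1 := hV.nonneg (W (j + 1))
    have n2 := hV.nonneg (W j)
    have n3 := hb0 j
    rw [ENNReal.ofReal_add (by positivity) (by positivity),
      ENNReal.ofReal_add (by positivity) (by positivity),
      ENNReal.ofReal_add (by positivity) (by positivity),
      ENNReal.ofReal_add (by positivity) (by positivity),
      ENNReal.ofReal_mul hl.le, ENNReal.ofReal_mul hl.le, ENNReal.ofReal_mul hl.le,
      ENNReal.ofReal_mul hl.le, ENNReal.ofReal_mul (abs_nonneg _),
      ENNReal.ofReal_mul n1, ENNReal.ofReal_mul n2] at h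
    simpa only [hd, Real.enorm_eq_ofReal_abs] using h
  have hsum := ENNReal.tsum_le_tsum hE
  rw [ENNReal.tsum_add, ENNReal.tsum_add, ENNReal.tsum_add, ENNReal.tsum_add,
    ENNReal.tsum_mul_left, ENNReal.tsum_mul_left, ENNReal.tsum_mul_left,
    ENNReal.tsum_mul_left] at hsum
  have hshift : ∑' j, ENNReal.ofReal (V (W j)) * ‖W j - W (j - 1)‖ₑ
      = ∑' j, ENNReal.ofReal (V (W (j + 1))) * ‖W (j + 1) - W j‖ₑ := by
    rw [← tsum_int_shift (fun j => ENNReal.ofReal (V (W j)) * ‖W j - W (j - 1)‖ₑ) 1]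
    simp
  rw [hshift] at hsum
  set P := ∑' j, ENNReal.ofReal (V (W (j + 1))) * ‖W (j + 1) - W j‖ₑ
  set Q := ∑' j, d j * ENNReal.ofReal (b j)
  have hP : P ≠ ⊤ := by
    refine ne_top_of_le_ne_top (ENNReal.mul_ne_top ENNReal.ofReal_ne_top htop :
      ENNReal.ofReal A * seqVar W ≠ ⊤) ?_
    unfold seqVar
    rw [← ENNReal.tsum_mul_left]
    exact ENNReal.tsum_le_tsum fun j => by gcongr; exact hV.le _
  have hQ : Q ≠ ⊤ := by
    refine ne_top_of_le_ne_top (ENNReal.mul_ne_top ENNReal.ofReal_ne_top htop :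
      ENNReal.ofReal L * seqVar W ≠ ⊤) ?_
    refine le_trans (ENNReal.tsum_le_tsum fun j => ?_) (hV.seqVar_comp_le W)
    calc _ ≤ d j * 1 := by gcongr; exact ENNReal.ofReal_le_one.2 (hb1 j)
      _ = _ := by simp [hd]
  have h3 : seqVar W' + (ENNReal.ofReal lam * Q + ENNReal.ofReal lam * P)
      ≤ seqVar W + (ENNReal.ofReal lam * Q + ENNReal.ofReal lam * P) := by
    calc _ = seqVar W' + ENNReal.ofReal lam * Q + ENNReal.ofReal lam * P := by ring
      _ ≤ seqVar W + ENNReal.ofReal lam * P + ENNReal.ofReal lam * ∑' j, ‖X (j + 1)‖ₑ := hsum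
      _ ≤ seqVar W + ENNReal.ofReal lam * P + ENNReal.ofReal lam * Q := by gcongr
      _ = _ := by ring
  refine (ENNReal.add_le_add_iff_right ?_).1 h3
  exact ENNReal.add_ne_top.2 ⟨ENNReal.mul_ne_top ENNReal.ofReal_ne_top hQ,
    ENNReal.mul_ne_top ENNReal.ofReal_ne_top hP⟩

/-- Continuity in time of the impact. -/
theorem tsum_enorm_impact_step_sub_le (H : StepData V A L w lam r) :
    ∑' j, ‖nonlocalImpact w (schemeStep V w lam r) j - nonlocalImpact w r j‖ₑ
      ≤ seqVar (nonlocalImpact w r) := by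
  obtain ⟨hV, hw, hl, hcfl, hr⟩ := id H
  set W := nonlocalImpact w r with hW
  set d : ℤ → ℝ≥0∞ := fun j => ‖V (W (j + 1)) - V (W j)‖ₑ with hd
  have hpt : ∀ j, ‖nonlocalImpact w (schemeStep V w lam r) j - W j‖ₑ
      ≤ ENNReal.ofReal lam * (ENNReal.ofReal A * ‖W (j - 1 + 1) - W (j - 1)‖ₑ
        + ∑' k : ℕ, ENNReal.ofReal (w k - w (k + 1))
          * (1 * ∑ i ∈ Finset.range (k + 1), d (j + i))) := fun j => by
    have h := H.impact_step_sub j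
    rw [← hW] at h
    rw [h, enorm_mul, Real.enorm_of_nonneg hl.le, sub_add_cancel]
    gcongr
    refine (enorm_add_le _ _).trans ?_
    gcongr
    · rw [enorm_mul, Real.enorm_of_nonneg (hV.nonneg _), ← enorm_neg, neg_sub]
      gcongr
      exact hV.le _
    · refine (enorm_tsum_le_tsum_enorm).trans (ENNReal.tsum_le_tsum fun k => ?_)
      rw [enorm_mul, enorm_mul, Real.enorm_of_nonneg (hw.diff_nonneg k),
        Real.enorm_of_nonneg (hr _).1]
      gcongr
      · exact ENNReal.ofReal_le_one.2 (hr _).2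
      rw [← enorm_neg, neg_sub]
      have := enorm_sub_le_sum_range (fun j => V (W j)) j (k + 1)
      refine le_trans (le_of_eq ?_) this
      push_cast
      rw [← add_assoc]
  refine (ENNReal.tsum_le_tsum hpt).trans ?_
  rw [ENNReal.tsum_mul_left, ENNReal.tsum_add, ENNReal.tsum_mul_left,
    tsum_triangle _ (fun _ => 1) d,
    show ∑' j, ‖W (j - 1 + 1) - W (j - 1)‖ₑ = _ from
      tsum_int_shift (fun j => ‖W (j + 1) - W j‖ₑ) (-1)]
  have h1 : ∑' k : ℕ, ENNReal.ofReal (w k - w (k + 1)) * ∑ l ∈ Finset.range (k + 1), (1 : ℝ≥0∞)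
      = 1 := by
    rw [tsum_mul_sum_range_succ (b := fun k => ENNReal.ofReal (w k)) (a := fun _ => 1)
      (fun l => ofReal_eq_tsum_sub_succ hw.mono hw.tendsto l)]
    simp only [mul_one]
    rw [← ENNReal.ofReal_tsum_of_nonneg hw.nonneg hw.hasSum.summable, hw.hasSum.tsum_eq]
    simp
  simp only [h1, mul_one]
  calc _ ≤ ENNReal.ofReal lam * (ENNReal.ofReal A * seqVar W + ENNReal.ofReal L * seqVar W) := by
        gcongr
        · exact le_rfl
        · exact hV.seqVar_comp_le W
    _ = ENNReal.ofReal (lam * (A + L)) * seqVar W := by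
        rw [ENNReal.ofReal_mul hl.le, ENNReal.ofReal_add hV.bound_nonneg hV.lip_nonneg]; ring
    _ ≤ 1 * seqVar W := by gcongr; exact ENNReal.ofReal_le_one.2 hcfl
    _ = _ := one_mul _

/-- Consistency of the numerical entropy flux. -/
lemma abs_entropyFlux_sub_le (H : StepData V A L w lam r) (c : ℝ) (j : ℤ) :
    |entropyFlux V w r c j - kruzkovFlux V c (nonlocalImpact w r j)|
      ≤ 2 * A * |nonlocalImpact w r j - nonlocalImpact w r (j - 1)|
        + L * ∑' k : ℕ, w k * |nonlocalImpact w r (j + k) - nonlocalImpact w r j| := by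
  obtain ⟨hV, hw, hl, hcfl, hr⟩ := id H
  set W := nonlocalImpact w r with hW
  have hmem : ∀ i, W i ∈ Icc (0 : ℝ) 1 := hw.impact_mem hr
  have hs0 := hw.summable_mul (s := fun k : ℕ => r (j - 1 + k)) (fun k => H.abs_le _)
  have hs1 := hw.summable_mul (s := fun k : ℕ => r (j - 1 + k) * velDev V c (W (j + k))) (C := A)
    (fun k => by
      have := H.abs_mul_le (g := fun i => velDev V c (W (i + 1))) (C := A)
        (fun i => hV.abs_velDev_le _ _) (j - 1 + k)
      rwa [show j - 1 + (k : ℤ) + 1 = j + k by ring] at this)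
  have hs2 := hw.summable_mul (s := fun k : ℕ => |W (j + k) - W j|) (C := 1) (fun k => by
    rw [abs_abs, _root_.abs_le]
    constructor <;> linarith [(hmem (j + k)).1, (hmem (j + k)).2, (hmem j).1, (hmem j).2])
  have hP : nonlocalImpact w (fun i => r i * velDev V c (W (i + 1))) (j - 1)
      - W (j - 1) * velDev V c (W j)
      = ∑' k : ℕ, w k * (r (j - 1 + k) * (velDev V c (W (j + k)) - velDev V c (W j))) := by
    have e1 : nonlocalImpact w (fun i => r i * velDev V c (W (i + 1))) (j - 1)
        = ∑' k : ℕ, w k * (r (j - 1 + k) * velDev V c (W (j + k))) := tsum_congr fun k => by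
      simp only
      rw [show j - 1 + (k : ℤ) + 1 = j + k by ring]
    have e2 : W (j - 1) = ∑' k : ℕ, w k * r (j - 1 + k) := rfl
    rw [e1, e2, ← tsum_mul_right, ← hs1.tsum_sub (hs0.mul_right _)]
    exact tsum_congr fun k => by ring
  have hPle : |∑' k : ℕ, w k * (r (j - 1 + k) * (velDev V c (W (j + k)) - velDev V c (W j)))|
      ≤ L * ∑' k : ℕ, w k * |W (j + k) - W j| := by
    rw [← tsum_mul_left, ← Real.norm_eq_abs]
    refine tsum_of_norm_bounded (hs2.mul_left L).hasSum fun k => ?_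
    rw [Real.norm_eq_abs, abs_mul, abs_mul, abs_of_nonneg (hw.nonneg k)]
    have h1 : |r (j - 1 + k)| * |velDev V c (W (j + k)) - velDev V c (W j)|
        ≤ 1 * (L * |W (j + k) - W j|) :=
      mul_le_mul (H.abs_le _) ((hV.abs_velDev_sub_le _ _ _).trans (hV.lip _ _)) (abs_nonneg _)
        zero_le_one
    calc _ ≤ w k * (1 * (L * |W (j + k) - W j|)) := mul_le_mul_of_nonneg_left h1 (hw.nonneg k)
      _ = _ := by ring
  have hEq : entropyFlux V w r c j - kruzkovFlux V c (W j)
      = V c * (|W (j - 1) - c| - |W j - c|) + (W (j - 1) - W j) * velDev V c (W j)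
        + ∑' k : ℕ, w k * (r (j - 1 + k) * (velDev V c (W (j + k)) - velDev V c (W j))) := by
    rw [← hP, kruzkovFlux_eq, entropyFlux]; ring
  rw [hEq]
  refine (abs_add_three _ _ _).trans ?_
  have h1 : |V c * (|W (j - 1) - c| - |W j - c|)| ≤ A * |W j - W (j - 1)| := by
    rw [abs_mul, abs_of_nonneg (hV.nonneg c)]
    refine mul_le_mul (hV.le c) ?_ (abs_nonneg _) hV.bound_nonneg
    rw [abs_sub_comm (W j) (W (j - 1))]
    refine (abs_abs_sub_abs_le_abs_sub _ _).trans (le_of_eq ?_)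
    rw [sub_sub_sub_cancel_right]
  have h2 : |(W (j - 1) - W j) * velDev V c (W j)| ≤ A * |W j - W (j - 1)| := by
    rw [abs_mul, abs_sub_comm, mul_comm]
    exact mul_le_mul_of_nonneg_right (hV.abs_velDev_le _ _) (abs_nonneg _)
  linarith

end StepData


/-! ### Functions of bounded variation and step functions on the line -/

lemma tsum_int_le_of_range {f : ℤ → ℝ≥0∞} {C : ℝ≥0∞}
    (h : ∀ a : ℤ, ∀ n : ℕ, ∑ i ∈ Finset.range n, f (a + i) ≤ C) : ∑' k, f k ≤ C := by
  rw [ENNReal.tsum_eq_iSup_sum]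
  refine iSup_le fun s => ?_
  obtain ⟨N, hN⟩ : ∃ N : ℕ, ∀ k ∈ s, k.natAbs < N := by
    refine ⟨s.sup Int.natAbs + 1, fun k hk => Nat.lt_succ_of_le (Finset.le_sup hk)⟩
  refine le_trans ?_ (h (-N) (2 * N))
  rw [← Finset.sum_image (f := f) (s := Finset.range (2 * N)) (g := fun i : ℕ => -(N : ℤ) + i)
    (fun a _ b _ hab => by simpa using hab)]
  refine Finset.sum_le_sum_of_subset fun k hk => ?_
  have := hN k hk
  exact Finset.mem_image.2 ⟨(k + N).toNat, Finset.mem_range.2 (by omega), by omega⟩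

lemma tsum_eVariationOn_Icc_le (g : ℝ → ℝ) {a : ℤ → ℝ} (ha : Monotone a) :
    ∑' k, eVariationOn g (Icc (a k) (a (k + 1))) ≤ eVariationOn g univ := by
  refine tsum_int_le_of_range fun m n => ?_
  have hmono : Monotone fun i : ℕ => a (m + i) := fun i j hij => ha (by simpa using hij)
  have h := eVariationOn.sum' g hmono (n := n)
  calc _ = ∑ i ∈ Finset.range n, eVariationOn g (Icc (a (m + i)) (a (m + ((i + 1 : ℕ) : ℤ)))) := by
        refine Finset.sum_congr rfl fun i _ => ?_
        push_cast; rw [add_assoc]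
    _ = _ := h
    _ ≤ _ := eVariationOn.mono _ (subset_univ _)

lemma enorm_sub_le_eVariationOn (g : ℝ → ℝ) {s : Set ℝ} {x y : ℝ} (hx : x ∈ s) (hy : y ∈ s) :
    ‖g x - g y‖ₑ ≤ eVariationOn g s := by
  rw [← edist_eq_enorm_sub]; exact eVariationOn.edist_le g hx hy

lemma tsum_enorm_sub_le_eVariationOn (g : ℝ → ℝ) {a b : ℤ → ℝ} (hab : ∀ k, a k ≤ b k)
    (hba : ∀ k, b k ≤ a (k + 1)) : ∑' k, ‖g (b k) - g (a k)‖ₑ ≤ eVariationOn g univ := by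
  have ha : Monotone a := monotone_int_of_le_succ fun k => (hab k).trans (hba k)
  refine le_trans (ENNReal.tsum_le_tsum fun k => ?_) (tsum_eVariationOn_Icc_le g ha)
  exact enorm_sub_le_eVariationOn g ⟨hab k, hba k⟩ ⟨le_rfl, (hab k).trans (hba k)⟩

/-- Decomposition of an integral over the line into integrals over translated cells. -/
lemma lintegral_eq_tsum_Ico {z : ℝ} (hz : 0 < z) (a : ℝ) (f : ℝ → ℝ≥0∞) :
    ∫⁻ x, f x = ∑' k : ℤ, ∫⁻ x in Ico a (a + z), f (x + k * z) := by
  have h1 := iUnion_Ico_add_zsmul hz a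
  have h2 := pairwise_disjoint_Ico_add_zsmul a z
  rw [← setLIntegral_univ, ← h1, lintegral_iUnion (fun _ => measurableSet_Ico) h2]
  refine tsum_congr fun k => ?_
  have := (measurePreserving_add_right volume ((k : ℝ) * z)).setLIntegral_comp_preimage_emb
    (MeasurableEquiv.addRight ((k : ℝ) * z)).measurableEmbedding f
    (Ico (a + k • z) (a + (k + 1) • z))
  rw [← this]
  congr 2
  ext x
  simp only [mem_Ico, mem_preimage, zsmul_eq_mul]
  push_cast
  constructor <;> rintro ⟨h3, h4⟩ <;> constructor <;> linarith

lemma aemeasurable_comp_add {g : ℝ → ℝ} (hg : AEMeasurable g) (z : ℝ) :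
    AEMeasurable fun x => g (x + z) :=
  hg.comp_quasiMeasurePreserving (measurePreserving_add_right volume z).quasiMeasurePreserving

/-- `L¹` continuity of translations for functions of bounded variation. -/
lemma lintegral_enorm_translate_sub_le {g : ℝ → ℝ} (hg : AEMeasurable g) {z : ℝ} (hz : 0 < z) :
    ∫⁻ x, ‖g (x + z) - g x‖ₑ ≤ ENNReal.ofReal z * eVariationOn g univ := by
  rw [lintegral_eq_tsum_Ico hz 0, ← lintegral_tsum]
  · calc _ ≤ ∫⁻ _ in Ico 0 (0 + z), eVariationOn g univ := by
          refine lintegral_mono fun x => ?_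
          exact tsum_enorm_sub_le_eVariationOn g (a := fun k => x + k * z)
            (b := fun k => x + k * z + z) (fun k => by linarith)
            (fun k => by push_cast; linarith)
      _ = _ := by simp [mul_comm]
  · intro k
    have h1 := aemeasurable_comp_add hg (k * z + z)
    have h2 := aemeasurable_comp_add hg (k * z)
    simp only [← add_assoc] at h1
    exact ((h1.sub h2).enorm).restrict

/-- Index of the cell `[(j - 1/2) h, (j + 1/2) h)` that contains `x`. -/
noncomputable def cellIndex (h x : ℝ) : ℤ := ⌊x / h + 1 / 2⌋

lemma cellIndex_eq_iff {h x : ℝ} (hh : 0 < h) (j : ℤ) :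
    cellIndex h x = j ↔ x ∈ Ico (((j : ℝ) - 1 / 2) * h) (((j : ℝ) + 1 / 2) * h) := by
  unfold cellIndex
  rw [Int.floor_eq_iff, mem_Ico, ← le_div_iff₀ hh, ← div_lt_iff₀ hh]
  constructor <;> rintro ⟨h1, h2⟩ <;> constructor <;> linarith

lemma cellIndex_mem {h : ℝ} (hh : 0 < h) (x : ℝ) :
    x ∈ Ico (((cellIndex h x : ℝ) - 1 / 2) * h) (((cellIndex h x : ℝ) + 1 / 2) * h) :=
  (cellIndex_eq_iff hh _).1 rfl

lemma monotone_cellIndex {h : ℝ} (hh : 0 < h) : Monotone (cellIndex h) := fun x y hxy => by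
  unfold cellIndex; gcongr

lemma measurable_cellIndex (h : ℝ) : Measurable (cellIndex h) :=
  Int.measurable_floor.comp (by fun_prop)

lemma cellIndex_add_self {h : ℝ} (hh : 0 < h) (x : ℝ) : cellIndex h (x + h) = cellIndex h x + 1 := by
  unfold cellIndex
  rw [← Int.floor_add_one, add_div, div_self hh.ne']
  congr 1; ring

/-- Decomposition of an integral over the line into integrals over the cells. -/
lemma lintegral_eq_tsum_cell {h : ℝ} (hh : 0 < h) (f : ℝ → ℝ≥0∞) :
    ∫⁻ x, f x
      = ∑' j : ℤ, ∫⁻ x in Ico (((j : ℝ) - 1 / 2) * h) (((j : ℝ) + 1 / 2) * h), f x := by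
  have hU : ⋃ j : ℤ, Ico (((j : ℝ) - 1 / 2) * h) (((j : ℝ) + 1 / 2) * h) = univ := by
    refine eq_univ_of_forall fun x => mem_iUnion.2 ⟨cellIndex h x, cellIndex_mem hh x⟩
  have hd : Pairwise (Function.onFun Disjoint fun j : ℤ =>
      Ico (((j : ℝ) - 1 / 2) * h) (((j : ℝ) + 1 / 2) * h)) := fun i j hij => by
    refine Set.disjoint_left.2 fun x hx hx' => hij ?_
    rw [← (cellIndex_eq_iff hh i).2 hx, ← (cellIndex_eq_iff hh j).2 hx']
  rw [← setLIntegral_univ, ← hU, lintegral_iUnion (fun _ => measurableSet_Ico) hd]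

lemma volume_cell {h : ℝ} (j : ℤ) :
    volume (Ico (((j : ℝ) - 1 / 2) * h) (((j : ℝ) + 1 / 2) * h)) = ENNReal.ofReal h := by
  rw [Real.volume_Ico]; congr 1; ring

lemma lintegral_comp_cellIndex {h : ℝ} (hh : 0 < h) (F : ℤ → ℝ≥0∞) :
    ∫⁻ x, F (cellIndex h x) = ENNReal.ofReal h * ∑' j, F j := by
  rw [lintegral_eq_tsum_cell hh, ← ENNReal.tsum_mul_left]
  refine tsum_congr fun j => ?_
  rw [setLIntegral_congr_fun (g := fun _ => F j) measurableSet_Ico fun x hx => by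
    rw [(cellIndex_eq_iff hh j).2 hx]]
  rw [setLIntegral_const, volume_cell, mul_comm]

lemma eVariationOn_comp_cellIndex_le {h : ℝ} (hh : 0 < h) (u : ℤ → ℝ) :
    eVariationOn (fun x => u (cellIndex h x)) univ ≤ seqVar u := by
  refine (eVariationOn.comp_le_of_monotoneOn u (t := univ) (s := univ) (cellIndex h)
    ((monotone_cellIndex hh).monotoneOn _) (mapsTo_univ _ _)).trans ?_
  unfold eVariationOn
  refine iSup_le fun p => ?_
  obtain ⟨n, f, hf, hfu⟩ := p
  simp only
  set m : ℤ := f 0 with hm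
  have hmono : ∀ i, m ≤ f i := fun i => hf (Nat.zero_le i)
  have key : ∀ n, ∑ i ∈ Finset.range n, edist (u (f (i + 1))) (u (f i))
      ≤ ∑ i ∈ Finset.range (f n - m).toNat, ‖u (m + i + 1) - u (m + i)‖ₑ := fun n => by
    induction n with
    | zero => simp
    | succ n ih =>
      rw [Finset.sum_range_succ]
      have h1 : f n ≤ f (n + 1) := hf (Nat.le_succ n)
      have h2 : (f (n + 1) - m).toNat = (f n - m).toNat + (f (n + 1) - f n).toNat := by
        have := hmono n; omega
      rw [h2, Finset.sum_range_add]
      refine add_le_add ih ?_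
      rw [edist_eq_enorm_sub]
      have h3 := enorm_sub_le_sum_range u (f n) (f (n + 1) - f n).toNat
      have h4 : f n + ((f (n + 1) - f n).toNat : ℤ) = f (n + 1) := by omega
      rw [h4] at h3
      refine h3.trans (le_of_eq (Finset.sum_congr rfl fun i _ => ?_))
      have h5 : m + (((f n - m).toNat + i : ℕ) : ℤ) = f n + i := by
        have := hmono n; push_cast; omega
      rw [h5]
  refine (key n).trans ?_
  have h6 := ENNReal.sum_le_tsum (f := fun i : ℕ => ‖u (m + i + 1) - u (m + i)‖ₑ)
    (Finset.range (f n - m).toNat)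
  refine h6.trans ?_
  unfold seqVar
  exact ENNReal.tsum_comp_le_tsum_of_injective (f := fun i : ℕ => m + (i : ℤ))
    (fun a b hab => by simpa using hab) (fun j => ‖u (j + 1) - u j‖ₑ)

/-! ### Cell averages of the datum -/

/-- The average of `ρ₀` over the cell `j`. -/
noncomputable def cellAverage (ρ₀ : ℝ → ℝ) (h : ℝ) (j : ℤ) : ℝ :=
  (1 / h) * ∫ x in (((j : ℝ) - 1 / 2) * h)..(((j : ℝ) + 1 / 2) * h), ρ₀ x

lemma cellAverage_congr {f g : ℝ → ℝ} (hfg : f =ᵐ[volume] g) (h : ℝ) :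
    cellAverage f h = cellAverage g h := by
  ext j
  unfold cellAverage
  rw [intervalIntegral.integral_congr_ae (hfg.mono fun x hx _ => hx)]

lemma intervalIntegrable_of_mem_Icc {g : ℝ → ℝ} (hg : AEMeasurable g)
    (hg01 : ∀ᵐ x : ℝ, g x ∈ Icc (0 : ℝ) 1) (a b : ℝ) : IntervalIntegrable g volume a b := by
  rw [intervalIntegrable_iff]
  refine Measure.integrableOn_of_bounded (M := 1) (by simp) hg.aestronglyMeasurable ?_
  refine ae_restrict_of_ae (hg01.mono fun x hx => ?_)
  rw [Real.norm_eq_abs, abs_of_nonneg hx.1]; exact hx.2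

lemma cellAverage_mem {g : ℝ → ℝ} (hg : AEMeasurable g)
    (hg01 : ∀ᵐ x : ℝ, g x ∈ Icc (0 : ℝ) 1) {h : ℝ} (hh : 0 < h) (j : ℤ) : cellAverage g h j ∈ Icc (0 : ℝ) 1 := by
  unfold cellAverage
  have hle : ((j : ℝ) - 1 / 2) * h ≤ ((j : ℝ) + 1 / 2) * h := by nlinarith
  have hi := intervalIntegrable_of_mem_Icc hg hg01
  constructor
  · refine mul_nonneg (by positivity) (intervalIntegral.integral_nonneg_of_ae hle ?_)
    exact hg01.mono fun x hx => hx.1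
  · have := intervalIntegral.integral_mono_ae hle (hi _ _)
      (intervalIntegrable_const (c := (1 : ℝ))) (hg01.mono fun x hx => hx.2)
    rw [intervalIntegral.integral_const, smul_eq_mul, mul_one] at this
    rw [one_div, inv_mul_le_iff₀ hh]
    linarith

lemma seqVar_cellAverage_le {g : ℝ → ℝ} (hg : AEMeasurable g)
    (hg01 : ∀ᵐ x : ℝ, g x ∈ Icc (0 : ℝ) 1) {h : ℝ} (hh : 0 < h) :
    seqVar (cellAverage g h) ≤ eVariationOn g univ := by
  have hi := intervalIntegrable_of_mem_Icc hg hg01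
  have hpt : ∀ j : ℤ, ‖cellAverage g h (j + 1) - cellAverage g h j‖ₑ
      ≤ ENNReal.ofReal (1 / h) * ∫⁻ x in Ico (((j : ℝ) - 1 / 2) * h) (((j : ℝ) + 1 / 2) * h),
        ‖g (x + h) - g x‖ₑ := fun j => by
    have hle : ((j : ℝ) - 1 / 2) * h ≤ ((j : ℝ) + 1 / 2) * h := by nlinarith
    have e : cellAverage g h (j + 1) - cellAverage g h j = (1 / h)
        * ∫ x in (((j : ℝ) - 1 / 2) * h)..(((j : ℝ) + 1 / 2) * h), (g (x + h) - g x) := by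
      unfold cellAverage
      rw [intervalIntegral.integral_sub _ (hi _ _), intervalIntegral.integral_comp_add_right,
        ← mul_sub]
      · congr 4 <;> push_cast <;> ring
      · simpa using (hi ((((j : ℝ) - 1 / 2) * h) + h) ((((j : ℝ) + 1 / 2) * h) + h)).comp_add_right h
    rw [e, enorm_mul, Real.enorm_of_nonneg (by positivity), intervalIntegral.integral_of_le hle,
      ← integral_Ico_eq_integral_Ioc]
    gcongr
    exact enorm_integral_le_lintegral_enorm _
  refine (ENNReal.tsum_le_tsum hpt).trans ?_
  rw [ENNReal.tsum_mul_left, ← lintegral_eq_tsum_cell hh]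
  calc _ ≤ ENNReal.ofReal (1 / h) * (ENNReal.ofReal h * eVariationOn g univ) := by
        gcongr; exact lintegral_enorm_translate_sub_le hg hh
    _ = _ := by
        rw [← mul_assoc, ← ENNReal.ofReal_mul (by positivity), one_div, inv_mul_cancel₀ hh.ne']
        simp

lemma lintegral_cellAverage_sub_le {g : ℝ → ℝ} (hg : AEMeasurable g)
    (hg01 : ∀ᵐ x : ℝ, g x ∈ Icc (0 : ℝ) 1) {h : ℝ} (hh : 0 < h) :
    ∫⁻ x, ‖cellAverage g h (cellIndex h x) - g x‖ₑ
      ≤ ENNReal.ofReal h * eVariationOn g univ := by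
  have hi := intervalIntegrable_of_mem_Icc hg hg01
  have ha : Monotone fun j : ℤ => ((j : ℝ) - 1 / 2) * h := fun i j hij => by
    have : (i : ℝ) ≤ j := by exact_mod_cast hij
    simp only; gcongr
  refine le_trans ?_ (mul_le_mul_right (tsum_eVariationOn_Icc_le g ha) _)
  rw [lintegral_eq_tsum_cell hh, ← ENNReal.tsum_mul_left]
  refine ENNReal.tsum_le_tsum fun j => ?_
  have hle : ((j : ℝ) - 1 / 2) * h ≤ ((j : ℝ) + 1 / 2) * h := by nlinarith
  set I := Icc (((j : ℝ) - 1 / 2) * h) ((((j + 1 : ℤ) : ℝ) - 1 / 2) * h) with hI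
  have hsub : Ico (((j : ℝ) - 1 / 2) * h) (((j : ℝ) + 1 / 2) * h) ⊆ I := fun x hx =>
    ⟨hx.1, by push_cast; linarith [hx.2]⟩
  rw [← volume_cell (h := h) j, mul_comm (volume _), ← setLIntegral_const]
  refine setLIntegral_mono measurable_const fun x hx => ?_
  rw [(cellIndex_eq_iff hh j).2 hx]
  have e : cellAverage g h j - g x = (1 / h)
      * ∫ y in (((j : ℝ) - 1 / 2) * h)..(((j : ℝ) + 1 / 2) * h), (g y - g x) := by
    unfold cellAverage
    rw [intervalIntegral.integral_sub (hi _ _) intervalIntegrable_const,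
      intervalIntegral.integral_const, smul_eq_mul]
    field_simp
    ring
  rw [e, enorm_mul, Real.enorm_of_nonneg (by positivity), intervalIntegral.integral_of_le hle,
    ← integral_Ico_eq_integral_Ioc]
  calc _ ≤ ENNReal.ofReal (1 / h) * ∫⁻ y in Ico (((j : ℝ) - 1 / 2) * h) (((j : ℝ) + 1 / 2) * h),
        ‖g y - g x‖ₑ := by gcongr; exact enorm_integral_le_lintegral_enorm _
    _ ≤ ENNReal.ofReal (1 / h) * ∫⁻ _ in Ico (((j : ℝ) - 1 / 2) * h) (((j : ℝ) + 1 / 2) * h),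
        eVariationOn g I := by
        refine mul_le_mul_right (setLIntegral_mono measurable_const fun y hy => ?_) _
        exact enorm_sub_le_eVariationOn g (hsub hy) (hsub hx)
    _ = _ := by
        rw [setLIntegral_const, volume_cell, mul_comm (eVariationOn g I), ← mul_assoc,
          ← ENNReal.ofReal_mul (by positivity), one_div, inv_mul_cancel₀ hh.ne']
        simp

namespace IsAdmissibleDatum

variable {ρ₀ : ℝ → ℝ}

lemma aemeasurable (hρ : IsAdmissibleDatum ρ₀) : AEMeasurable ρ₀ :=
  hρ.memLp.aestronglyMeasurable.aemeasurable

lemma seqVar_le (hρ : IsAdmissibleDatum ρ₀) {h : ℝ} (hh : 0 < h) :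
    seqVar (cellAverage ρ₀ h) ≤ totalVariation ρ₀ := by
  refine le_iInf₂ fun g hg => ?_
  rw [← cellAverage_congr hg]
  exact seqVar_cellAverage_le (hρ.aemeasurable.congr hg.symm)
    (by filter_upwards [hg, hρ.mem_Icc] with x h1 h2; rwa [h1]) hh

lemma lintegral_cellAverage_sub_le (hρ : IsAdmissibleDatum ρ₀) {h : ℝ} (hh : 0 < h) :
    ∫⁻ x, ‖cellAverage ρ₀ h (cellIndex h x) - ρ₀ x‖ₑ
      ≤ ENNReal.ofReal h * totalVariation ρ₀ := by
  unfold totalVariation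
  rw [ENNReal.mul_iInf_of_ne (by simpa using hh) ENNReal.ofReal_ne_top]
  refine le_iInf fun g => ?_
  rw [ENNReal.mul_iInf_of_ne (by simpa using hh) ENNReal.ofReal_ne_top]
  refine le_iInf fun hg => ?_
  rw [← cellAverage_congr hg]
  refine le_trans (le_of_eq (lintegral_congr_ae ?_)) (_root_.lintegral_cellAverage_sub_le
    (hρ.aemeasurable.congr hg.symm)
    (by filter_upwards [hg, hρ.mem_Icc] with x h1 h2; rwa [h1]) hh)
  filter_upwards [hg] with x hx
  rw [hx]

end IsAdmissibleDatum


/-! ### The scheme as a discrete entropy solution -/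

/-- A sequence of grid functions with values in `[0,1]`, of variation at most `B` in space and in
one time step, that satisfies discrete entropy inequalities with numerical fluxes `Q`, whose
consistency error is at most `E`. -/
structure IsDiscreteEntropySolution (V : ℝ → ℝ) (lam : ℝ) (B : ℝ≥0∞) (u : ℕ → ℤ → ℝ)
    (Q : ℕ → ℤ → ℝ → ℝ) (E : ℕ → ℤ → ℝ) : Prop where
  mem : ∀ n j, u n j ∈ Icc (0 : ℝ) 1
  var : ∀ n, seqVar (u n) ≤ B
  time : ∀ n, ∑' j, ‖u (n + 1) j - u n j‖ₑ ≤ B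
  entropy : ∀ n j c, |u (n + 1) j - c| ≤ |u n j - c| - lam * (Q n (j + 1) c - Q n j c)
  flux : ∀ n j c, |Q n j c - kruzkovFlux V c (u n j)| ≤ E n j

/-- Mean oscillation of a sequence to the right of `j`. -/
noncomputable def spread (w : ℕ → ℝ) (u : ℤ → ℝ) (j : ℤ) : ℝ := ∑' k : ℕ, w k * |u (j + k) - u j|

/-- Bound for the consistency error of the entropy flux. -/
noncomputable def fluxError (A L : ℝ) (w : ℕ → ℝ) (u : ℤ → ℝ) (j : ℤ) : ℝ :=
  2 * A * |u j - u (j - 1)| + L * spread w u j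

/-- The data of the scheme under the CFL condition. -/
structure SchemeData (V : ℝ → ℝ) (A L : ℝ) (ρ₀ : ℝ → ℝ) (w : ℕ → ℝ) (lam h : ℝ) : Prop where
  vel : IsVelocity V A L
  datum : IsAdmissibleDatum ρ₀
  weight : IsWeight w
  lam_pos : 0 < lam
  cfl : lam * (A + L) ≤ 1
  h_pos : 0 < h

lemma IsWeight.seqVar_impact_le {w : ℕ → ℝ} (hw : IsWeight w) {r : ℤ → ℝ} {C : ℝ}
    (hr : ∀ j, |r j| ≤ C) : seqVar (nonlocalImpact w r) ≤ seqVar r := by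
  have hpt : ∀ j : ℤ, ‖nonlocalImpact w r (j + 1) - nonlocalImpact w r j‖ₑ
      ≤ ∑' k : ℕ, ENNReal.ofReal (w k) * ‖r (j + k + 1) - r (j + k)‖ₑ := fun j => by
    have h1 := hw.summable_mul (s := fun k : ℕ => r (j + 1 + k)) (fun k => hr _)
    have h2 := hw.summable_mul (s := fun k : ℕ => r (j + k)) (fun k => hr _)
    unfold nonlocalImpact
    rw [← h1.tsum_sub h2]
    refine (enorm_tsum_le_tsum_enorm).trans (ENNReal.tsum_le_tsum fun k => ?_)
    rw [← mul_sub, enorm_mul, Real.enorm_of_nonneg (hw.nonneg k),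
      show j + 1 + (k : ℤ) = j + k + 1 by ring]
  refine (ENNReal.tsum_le_tsum hpt).trans ?_
  rw [ENNReal.tsum_comm]
  simp_rw [ENNReal.tsum_mul_left]
  have : ∀ k : ℕ, ∑' j : ℤ, ‖r (j + k + 1) - r (j + k)‖ₑ = seqVar r := fun k =>
    tsum_int_shift (fun j => ‖r (j + 1) - r j‖ₑ) k
  simp_rw [this]
  rw [ENNReal.tsum_mul_right, ← ENNReal.ofReal_tsum_of_nonneg hw.nonneg hw.hasSum.summable,
    hw.hasSum.tsum_eq]
  simp

namespace SchemeData

variable {V : ℝ → ℝ} {A L : ℝ} {ρ₀ : ℝ → ℝ} {w : ℕ → ℝ} {lam h : ℝ}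

lemma density_mem (H : SchemeData V A L ρ₀ w lam h) (n : ℕ) (j : ℤ) :
    schemeDensity V ρ₀ w lam h n j ∈ Icc (0 : ℝ) 1 := by
  induction n generalizing j with
  | zero => exact cellAverage_mem H.datum.aemeasurable H.datum.mem_Icc H.h_pos j
  | succ n ih => exact StepData.step_mem ⟨H.vel, H.weight, H.lam_pos, H.cfl, ih⟩ j

lemma stepData (H : SchemeData V A L ρ₀ w lam h) (n : ℕ) :
    StepData V A L w lam (schemeDensity V ρ₀ w lam h n) :=
  ⟨H.vel, H.weight, H.lam_pos, H.cfl, H.density_mem n⟩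

lemma seqVar_le (H : SchemeData V A L ρ₀ w lam h) (n : ℕ) :
    seqVar (schemeImpact V ρ₀ w lam h n) ≤ totalVariation ρ₀ := by
  induction n with
  | zero =>
    exact (H.weight.seqVar_impact_le (H.stepData 0).abs_le).trans (H.datum.seqVar_le H.h_pos)
  | succ n ih => exact (H.stepData n).seqVar_impact_step_le.trans ih

theorem isDiscreteEntropySolution (H : SchemeData V A L ρ₀ w lam h) :
    IsDiscreteEntropySolution V lam (totalVariation ρ₀) (schemeImpact V ρ₀ w lam h)
      (fun n j c => entropyFlux V w (schemeDensity V ρ₀ w lam h n) c j)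
      (fun n => fluxError A L w (schemeImpact V ρ₀ w lam h n)) where
  mem n := H.weight.impact_mem (H.density_mem n)
  var := H.seqVar_le
  time n := (H.stepData n).tsum_enorm_impact_step_sub_le.trans (H.seqVar_le n)
  entropy n j c := (H.stepData n).entropy_step c j
  flux n j c := (H.stepData n).abs_entropyFlux_sub_le c j

end SchemeData

lemma schemeDensity_clampExtend {V : ℝ → ℝ} {A L : ℝ} {ρ₀ : ℝ → ℝ} {w : ℕ → ℝ} {lam h : ℝ}
    (H : SchemeData (clampExtend V) A L ρ₀ w lam h) (n : ℕ) :
    schemeDensity V ρ₀ w lam h n = schemeDensity (clampExtend V) ρ₀ w lam h n := by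
  induction n with
  | zero => rfl
  | succ n ih =>
    ext j
    have hm := H.weight.impact_mem (H.density_mem n)
    simp only [schemeDensity, ih]
    rw [clampExtend_of_mem (hm _), clampExtend_of_mem (hm _)]

/-! ### Reconstruction -/

/-- The piecewise constant function of time and space with the values `u n j` on the cells. -/
noncomputable def gridFun (u : ℕ → ℤ → ℝ) (lam h t x : ℝ) : ℝ :=
  u ⌊t / (lam * h)⌋₊ (cellIndex h x)

lemma reconstruction_eq_gridFun (V ρ₀ : ℝ → ℝ) (w : ℕ → ℝ) {lam h t : ℝ} (hl : 0 < lam)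
    (hh : 0 < h) (ht : 0 ≤ t) (x : ℝ) :
    reconstruction V ρ₀ w lam h t x = gridFun (schemeImpact V ρ₀ w lam h) lam h t x := by
  have hτ : 0 < lam * h := mul_pos hl hh
  have hn : ∀ n : ℕ, t ∈ Ico ((n : ℝ) * (lam * h)) (((n : ℝ) + 1) * (lam * h))
      ↔ ⌊t / (lam * h)⌋₊ = n := fun n => by
    rw [Nat.floor_eq_iff (by positivity), mem_Ico, le_div_iff₀ hτ, div_lt_iff₀ hτ]
  unfold reconstruction gridFun
  rw [tsum_eq_single ⌊t / (lam * h)⌋₊, tsum_eq_single (cellIndex h x)]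
  · rw [indicator_of_mem]
    exact ⟨(hn _).2 rfl, cellIndex_mem hh x⟩
  · intro j hj
    refine indicator_of_notMem (fun hm => hj ?_) _
    exact ((cellIndex_eq_iff hh j).2 hm.2).symm
  · intro n hne
    refine (tsum_congr fun j => indicator_of_notMem (fun hm => hne ?_) _).trans tsum_zero
    exact ((hn n).1 hm.1).symm

lemma measurable_gridFun (u : ℕ → ℤ → ℝ) (lam h : ℝ) :
    Measurable (Function.uncurry (gridFun u lam h)) := by
  have h1 : Measurable fun z : ℝ × ℝ => (⌊z.1 / (lam * h)⌋₊, cellIndex h z.2) :=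
    (Nat.measurable_floor.comp (by fun_prop)).prodMk ((measurable_cellIndex h).comp measurable_snd)
  exact (measurable_of_countable (fun p : ℕ × ℤ => u p.1 p.2)).comp h1

lemma measurable_gridFun_apply (u : ℕ → ℤ → ℝ) (lam h t : ℝ) : Measurable (gridFun u lam h t) :=
  (measurable_gridFun u lam h).of_uncurry_left

namespace IsDiscreteEntropySolution

variable {V : ℝ → ℝ} {lam : ℝ} {B : ℝ≥0∞} {u : ℕ → ℤ → ℝ} {Q : ℕ → ℤ → ℝ → ℝ} {E : ℕ → ℤ → ℝ}

lemma tsum_enorm_time_sub_le_of_le (H : IsDiscreteEntropySolution V lam B u Q E) (n m : ℕ) :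
    ∑' j, ‖u (n + m) j - u n j‖ₑ ≤ m * B := by
  induction m with
  | zero => simp
  | succ m ih =>
    calc _ ≤ ∑' j, (‖u (n + m + 1) j - u (n + m) j‖ₑ + ‖u (n + m) j - u n j‖ₑ) := by
          refine ENNReal.tsum_le_tsum fun j => ?_
          rw [← add_assoc, ← sub_add_sub_cancel _ (u (n + m) j) _]
          exact enorm_add_le _ _
      _ ≤ B + m * B := by
          rw [ENNReal.tsum_add]
          exact add_le_add (H.time _) ih
      _ = _ := by push_cast; ring

lemma tsum_enorm_time_sub_le (H : IsDiscreteEntropySolution V lam B u Q E) (n m : ℕ) :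
    ∑' j, ‖u n j - u m j‖ₑ ≤ ENNReal.ofReal |(n : ℝ) - m| * B := by
  rcases le_total m n with hle | hle
  · obtain ⟨k, rfl⟩ := Nat.exists_eq_add_of_le hle
    refine (H.tsum_enorm_time_sub_le_of_le m k).trans (le_of_eq ?_)
    simp
  · obtain ⟨k, rfl⟩ := Nat.exists_eq_add_of_le hle
    simp_rw [← enorm_neg (u n _ - _), neg_sub]
    refine (H.tsum_enorm_time_sub_le_of_le n k).trans (le_of_eq ?_)
    simp

lemma gridFun_mem (H : IsDiscreteEntropySolution V lam B u Q E) (h t x : ℝ) :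
    gridFun u lam h t x ∈ Icc (0 : ℝ) 1 := H.mem _ _

lemma eVariationOn_gridFun_le (H : IsDiscreteEntropySolution V lam B u Q E) {h : ℝ} (hh : 0 < h)
    (t : ℝ) : eVariationOn (gridFun u lam h t) univ ≤ B :=
  (eVariationOn_comp_cellIndex_le hh _).trans (H.var _)

lemma lintegral_gridFun_sub_le (H : IsDiscreteEntropySolution V lam B u Q E) {h : ℝ} (hh : 0 < h)
    (hl : 0 < lam) {s t : ℝ} (hs : 0 ≤ s) (ht : 0 ≤ t) :
    ∫⁻ x, ‖gridFun u lam h t x - gridFun u lam h s x‖ₑ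
      ≤ ENNReal.ofReal (|t - s| / lam + h) * B := by
  unfold gridFun
  rw [lintegral_comp_cellIndex hh (fun j => ‖u ⌊t / (lam * h)⌋₊ j - u ⌊s / (lam * h)⌋₊ j‖ₑ)]
  have hτ : 0 < lam * h := mul_pos hl hh
  have h1 := H.tsum_enorm_time_sub_le ⌊t / (lam * h)⌋₊ ⌊s / (lam * h)⌋₊
  have h2 : |(⌊t / (lam * h)⌋₊ : ℝ) - ⌊s / (lam * h)⌋₊| ≤ |t - s| / (lam * h) + 1 := by
    have a1 := Nat.floor_le (by positivity : 0 ≤ t / (lam * h))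
    have a2 := Nat.lt_floor_add_one (t / (lam * h))
    have b1 := Nat.floor_le (by positivity : 0 ≤ s / (lam * h))
    have b2 := Nat.lt_floor_add_one (s / (lam * h))
    have c : |t / (lam * h) - s / (lam * h)| = |t - s| / (lam * h) := by
      rw [← sub_div, abs_div, abs_of_pos hτ]
    rw [← c, abs_le]
    constructor <;> linarith [le_abs_self (t / (lam * h) - s / (lam * h)),
      neg_abs_le (t / (lam * h) - s / (lam * h))]
  calc _ ≤ ENNReal.ofReal h * (ENNReal.ofReal (|t - s| / (lam * h) + 1) * B) := by
        gcongr
        exact h1.trans (by gcongr)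
    _ = _ := by
        rw [← mul_assoc, ← ENNReal.ofReal_mul hh.le]
        congr 2
        field_simp

end IsDiscreteEntropySolution


/-! ### Poisson weights -/

/-- Poisson weights `e^{-x} x^n / n!`. -/
noncomputable def poissonWeight (n : ℕ) (x : ℝ) : ℝ := Real.exp (-x) * (x ^ n / n.factorial)

lemma poissonWeight_nonneg (n : ℕ) {x : ℝ} (hx : 0 ≤ x) : 0 ≤ poissonWeight n x := by
  unfold poissonWeight; positivity

lemma hasSum_poissonWeight (x : ℝ) : HasSum (fun n => poissonWeight n x) 1 := by
  have h := (NormedSpace.expSeries_div_hasSum_exp (𝔸 := ℝ) x).mul_left (Real.exp (-x))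
  rw [← Real.exp_eq_exp_ℝ, ← Real.exp_add, neg_add_cancel, Real.exp_zero] at h
  exact h

lemma poissonWeight_succ_mul (n : ℕ) (x : ℝ) :
    ((n + 1 : ℕ) : ℝ) * poissonWeight (n + 1) x = x * poissonWeight n x := by
  unfold poissonWeight
  rw [Nat.factorial_succ]
  push_cast
  have : (n.factorial : ℝ) ≠ 0 := by positivity
  field_simp
  ring

lemma hasSum_nat_mul_poissonWeight (x : ℝ) :
    HasSum (fun n : ℕ => (n : ℝ) * poissonWeight n x) x := by
  rw [← hasSum_nat_add_iff' 1]
  simp only [poissonWeight_succ_mul]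
  simpa using (hasSum_poissonWeight x).mul_left x

lemma hasSum_sq_sub_mul_poissonWeight (x : ℝ) :
    HasSum (fun n : ℕ => ((n : ℝ) - x) ^ 2 * poissonWeight n x) x := by
  have h2 : HasSum (fun n : ℕ => (n : ℝ) * ((n : ℝ) - 1) * poissonWeight n x) (x * x) := by
    rw [← hasSum_nat_add_iff' 1]
    have : ∀ n : ℕ, ((n + 1 : ℕ) : ℝ) * (((n + 1 : ℕ) : ℝ) - 1) * poissonWeight (n + 1) x
        = x * ((n : ℝ) * poissonWeight n x) := fun n => by
      have := poissonWeight_succ_mul n x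
      push_cast at this ⊢
      linear_combination (n : ℝ) * this
    simp only [this]
    simpa using (hasSum_nat_mul_poissonWeight x).mul_left x
  have h := (h2.add ((hasSum_nat_mul_poissonWeight x).mul_left (1 - 2 * x))).add
    ((hasSum_poissonWeight x).mul_left (x ^ 2))
  convert h using 1
  · ext n; ring
  · ring

lemma poissonWeight_zero_right (n : ℕ) : poissonWeight n 0 = if n = 0 then 1 else 0 := by
  unfold poissonWeight
  split_ifs with h
  · simp [h]
  · simp [h]

/-- The mean deviation of a Poisson variable is at most the standard deviation. -/
lemma tsum_abs_sub_mul_poissonWeight_le {x : ℝ} (hx : 0 ≤ x) :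
    ∑' n : ℕ, ENNReal.ofReal (poissonWeight n x) * ENNReal.ofReal |(n : ℝ) - x|
      ≤ ENNReal.ofReal √x := by
  rcases hx.eq_or_lt with rfl | hx
  · refine le_of_eq ?_
    rw [Real.sqrt_zero, ENNReal.ofReal_zero, ENNReal.tsum_eq_zero]
    intro n
    rw [poissonWeight_zero_right]
    split_ifs with h <;> simp [h]
  have hs := Real.sqrt_pos.2 hx
  have hsq := Real.sq_sqrt hx.le
  have hsum : HasSum (fun n : ℕ => (√x / 2) * poissonWeight n x
      + (1 / (2 * √x)) * (((n : ℝ) - x) ^ 2 * poissonWeight n x)) √x := by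
    have h := ((hasSum_poissonWeight x).mul_left (√x / 2)).add
      ((hasSum_sq_sub_mul_poissonWeight x).mul_left (1 / (2 * √x)))
    have e : 1 / (2 * √x) * x = √x / 2 := by
      nth_rewrite 2 [← hsq]
      field_simp
    rwa [e, mul_one, add_halves] at h
  rw [← hsum.tsum_eq, ENNReal.ofReal_tsum_of_nonneg _ hsum.summable]
  · refine ENNReal.tsum_le_tsum fun n => ?_
    have hp := poissonWeight_nonneg n hx.le
    rw [← ENNReal.ofReal_mul hp]
    refine ENNReal.ofReal_le_ofReal ?_
    have h1 : |(n : ℝ) - x| ≤ √x / 2 + 1 / (2 * √x) * ((n : ℝ) - x) ^ 2 := by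
      rw [← sq_abs ((n : ℝ) - x)]
      have e : √x / 2 + 1 / (2 * √x) * |(n : ℝ) - x| ^ 2 - |(n : ℝ) - x|
          = 1 / (2 * √x) * (√x - |(n : ℝ) - x|) ^ 2 := by
        field_simp
        ring
      have : 0 ≤ 1 / (2 * √x) * (√x - |(n : ℝ) - x|) ^ 2 := by positivity
      linarith
    nlinarith
  · intro n
    have hp := poissonWeight_nonneg n hx.le
    positivity

lemma hasDerivAt_poissonWeight_zero (x : ℝ) :
    HasDerivAt (poissonWeight 0) (-poissonWeight 0 x) x := by
  have h := (hasDerivAt_neg x).exp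
  unfold poissonWeight
  simpa using h

lemma hasDerivAt_poissonWeight_succ (n : ℕ) (x : ℝ) :
    HasDerivAt (poissonWeight (n + 1)) (poissonWeight n x - poissonWeight (n + 1) x) x := by
  have h := (hasDerivAt_neg x).exp.mul ((hasDerivAt_pow (n + 1) x).div_const ((n + 1).factorial : ℝ))
  unfold poissonWeight
  refine h.congr_deriv ?_
  simp only [Nat.factorial_succ, Nat.add_sub_cancel]
  push_cast
  have : (n.factorial : ℝ) ≠ 0 := by positivity
  field_simp
  ring

lemma contDiff_poissonWeight (n : ℕ) : ContDiff ℝ 1 (poissonWeight n) := by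
  unfold poissonWeight
  exact (Real.contDiff_exp.comp contDiff_neg).mul ((contDiff_id.pow n).div_const _)

/-! ### Smoothed step functions -/

/-- A smoothed Heaviside function `F` of width `δ`, with derivative `f`. -/
structure IsSmoothStep (C δ : ℝ) (F f : ℝ → ℝ) : Prop where
  contDiff : ContDiff ℝ 1 F
  hasDerivAt : ∀ z, HasDerivAt F (f z) z
  mono : Monotone F
  zero : ∀ z ≤ 0, F z = 0
  one : ∀ z ≥ δ, F z = 1
  deriv_zero : ∀ z, z ∉ Icc 0 δ → f z = 0
  slope_error : ∀ h > 0, ∫⁻ z, ‖f z - (F (z + h) - F z) / h‖ₑ ≤ ENNReal.ofReal (C * h / δ)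
  second_diff : ∀ h > 0,
    ∫⁻ z, ‖2 * F z - F (z - h) - F (z + h)‖ₑ ≤ ENNReal.ofReal (C * h ^ 2 / δ)

lemma lintegral_enorm_le_of_support {g : ℝ → ℝ} {a b M : ℝ} (hM : 0 ≤ M)
    (h1 : ∀ z, |g z| ≤ M) (h0 : ∀ z, z ∉ Icc a b → g z = 0) :
    ∫⁻ z, ‖g z‖ₑ ≤ ENNReal.ofReal (M * (b - a)) := by
  calc ∫⁻ z, ‖g z‖ₑ ≤ ∫⁻ z, (Icc a b).indicator (fun _ => ENNReal.ofReal M) z := by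
        refine lintegral_mono fun z => ?_
        by_cases hz : z ∈ Icc a b
        · rw [indicator_of_mem hz, Real.enorm_eq_ofReal_abs]
          exact ENNReal.ofReal_le_ofReal (h1 z)
        · simp [h0 z hz]
    _ = _ := by
        rw [lintegral_indicator measurableSet_Icc, setLIntegral_const, Real.volume_Icc,
          ENNReal.ofReal_mul hM]

theorem exists_isSmoothStep : ∃ C > 0, ∀ δ > 0, ∃ F f : ℝ → ℝ, IsSmoothStep C δ F f := by
  set s := Real.smoothTransition with hs
  have hcd : ContDiff ℝ 2 s := Real.smoothTransition.contDiff (n := 2)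
  have hdc : ContDiff ℝ 1 (deriv s) := by
    have := (contDiff_succ_iff_deriv (n := 1) (f := s)).1 (by exact_mod_cast hcd)
    exact this.2.2
  have hdd : ∀ z, HasDerivAt s (deriv s z) z := fun z =>
    (hcd.differentiable (by norm_num) z).hasDerivAt
  have hd0 : ∀ z, z ∉ Icc (0 : ℝ) 1 → deriv s z = 0 := fun z hz => by
    rw [mem_Icc, not_and_or, not_le, not_le] at hz
    rcases hz with hz | hz
    · have : s =ᶠ[𝓝 z] fun _ => 0 :=
        (eventually_lt_nhds hz).mono fun y hy => Real.smoothTransition.zero_of_nonpos hy.le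
      rw [this.deriv_eq, deriv_const]
    · have : s =ᶠ[𝓝 z] fun _ => 1 :=
        (eventually_gt_nhds hz).mono fun y hy => Real.smoothTransition.one_of_one_le hy.le
      rw [this.deriv_eq, deriv_const]
  have hsupp : HasCompactSupport (deriv s) := HasCompactSupport.intro isCompact_Icc hd0
  obtain ⟨C2, hC2⟩ := hdc.lipschitzWith_of_hasCompactSupport hsupp (by norm_num)
  have hlip : ∀ x y, |deriv s x - deriv s y| ≤ C2 * |x - y| := fun x y => by
    have := hC2.dist_le_mul x y
    rwa [Real.dist_eq, Real.dist_eq] at this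
  obtain ⟨C1, hC1⟩ := hdc.continuous.bounded_above_of_compact_support hsupp
  have hC1' : ∀ z, |deriv s z| ≤ C1 := hC1
  have hC1n : 0 ≤ C1 := (abs_nonneg _).trans (hC1' 0)
  have hC2n : (0 : ℝ) ≤ C2 := C2.2
  refine ⟨6 * C2 + 2 * C1 + 3, by positivity, fun δ hδ => ⟨fun z => s (z / δ),
    fun z => deriv s (z / δ) / δ, ?_⟩⟩
  have hmono : Monotone fun z => s (z / δ) := fun x y hxy =>
    Real.smoothTransition.monotone (by gcongr)
  have hder : ∀ z, HasDerivAt (fun z => s (z / δ)) (deriv s (z / δ) / δ) z := fun z => by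
    have := (hdd (z / δ)).comp z ((hasDerivAt_id z).div_const δ)
    rw [mul_one_div] at this
    exact this
  have hone : ∀ z ≥ δ, s (z / δ) = 1 := fun z hz =>
    Real.smoothTransition.one_of_one_le ((one_le_div hδ).2 hz)
  have hzero : ∀ z ≤ 0, s (z / δ) = 0 := fun z hz =>
    Real.smoothTransition.zero_of_nonpos (div_nonpos_of_nonpos_of_nonneg hz hδ.le)
  have hf0 : ∀ z, z ∉ Icc 0 δ → deriv s (z / δ) / δ = 0 := fun z hz => by
    rw [hd0 _ fun hm => hz ⟨?_, ?_⟩, zero_div]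
    · have := (div_nonneg_iff.1 hm.1); rcases this with h | h
      · exact h.1
      · linarith
    · exact (div_le_one hδ).1 hm.2
  have hmvt : ∀ z, ∀ h > 0, ∃ ξ ∈ Ioo z (z + h), s ((z + h) / δ) - s (z / δ)
      = h * (deriv s (ξ / δ) / δ) := fun z h hh => by
    obtain ⟨ξ, hξ, he⟩ := exists_hasDerivAt_eq_slope (fun z => s (z / δ))
      (fun z => deriv s (z / δ) / δ) (by linarith : z < z + h)
      (fun y _ => (hder y).continuousAt.continuousWithinAt) (fun y _ => hder y)
    refine ⟨ξ, hξ, ?_⟩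
    rw [he, add_sub_cancel_left]; field_simp
  have hflip : ∀ x y, |deriv s (x / δ) / δ - deriv s (y / δ) / δ| ≤ C2 / δ ^ 2 * |x - y| :=
    fun x y => by
      rw [← sub_div, abs_div, abs_of_pos hδ]
      have := hlip (x / δ) (y / δ)
      rw [← sub_div, abs_div, abs_of_pos hδ] at this
      rw [div_le_iff₀ hδ]
      refine this.trans (le_of_eq ?_)
      field_simp
  have hrange : ∀ z, 0 ≤ s z ∧ s z ≤ 1 := fun z =>
    ⟨Real.smoothTransition.nonneg z, Real.smoothTransition.le_one z⟩
  refine ⟨?_, hder, hmono, hzero, hone, hf0, fun h hh => ?_, fun h hh => ?_⟩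
  · exact (hcd.of_le (by norm_num)).comp (contDiff_id.div_const δ)
  · have hsup : ∀ z, z ∉ Icc (-h) δ →
        deriv s (z / δ) / δ - (s ((z + h) / δ) - s (z / δ)) / h = 0 := fun z hz => by
      rw [mem_Icc, not_and_or, not_le, not_le] at hz
      rcases hz with hz | hz
      · rw [hf0 z (fun hm => by linarith [hm.1]), hzero z (by linarith), hzero (z + h) (by linarith)]
        simp
      · rw [hf0 z (fun hm => by linarith [hm.2]), hone z (by linarith), hone (z + h) (by linarith)]
        simp
    rcases le_total h δ with hhd | hhd
    · refine (lintegral_enorm_le_of_support (M := C2 / δ ^ 2 * h) (by positivity)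
        (fun z => ?_) hsup).trans (ENNReal.ofReal_le_ofReal ?_)
      · obtain ⟨ξ, hξ, he⟩ := hmvt z h hh
        rw [he, mul_div_cancel_left₀ _ hh.ne']
        refine (hflip z ξ).trans ?_
        gcongr
        rw [abs_of_neg (by linarith [hξ.1])]; linarith [hξ.2]
      · calc C2 / δ ^ 2 * h * (δ - -h) ≤ C2 / δ ^ 2 * h * (2 * δ) := by gcongr; linarith
          _ = 2 * C2 * h / δ := by field_simp
          _ ≤ _ := by gcongr; linarith
    · refine (lintegral_enorm_le_of_support (M := C1 / δ + 1 / h) (by positivity)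
        (fun z => ?_) hsup).trans (ENNReal.ofReal_le_ofReal ?_)
      · have e1 : |deriv s (z / δ) / δ| ≤ C1 / δ := by
          rw [abs_div, abs_of_pos hδ]; gcongr; exact hC1' _
        have e2 : |(s ((z + h) / δ) - s (z / δ)) / h| ≤ 1 / h := by
          rw [abs_div, abs_of_pos hh]; gcongr
          rw [abs_le]
          constructor <;> linarith [hrange ((z + h) / δ), hrange (z / δ)]
        exact (abs_sub _ _).trans (add_le_add e1 e2)
      · calc (C1 / δ + 1 / h) * (δ - -h) ≤ (C1 / δ + 1 / h) * (2 * h) := by gcongr; linarith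
          _ = 2 * C1 * h / δ + 2 * 1 := by field_simp
          _ ≤ 2 * C1 * h / δ + 2 * (h / δ) := by gcongr; exact (one_le_div hδ).2 hhd
          _ = (2 * C1 + 2) * h / δ := by ring
          _ ≤ _ := by gcongr <;> linarith
  · have hsup : ∀ z, z ∉ Icc (-h) (δ + h) →
        2 * s (z / δ) - s ((z - h) / δ) - s ((z + h) / δ) = 0 := fun z hz => by
      rw [mem_Icc, not_and_or, not_le, not_le] at hz
      rcases hz with hz | hz
      · rw [hzero z (by linarith), hzero (z + h) (by linarith), hzero (z - h) (by linarith)]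
        simp
      · rw [hone z (by linarith), hone (z + h) (by linarith), hone (z - h) (by linarith)]
        norm_num
    rcases le_total h δ with hhd | hhd
    · refine (lintegral_enorm_le_of_support (M := h * (C2 / δ ^ 2 * (2 * h))) (by positivity)
        (fun z => ?_) hsup).trans (ENNReal.ofReal_le_ofReal ?_)
      · obtain ⟨ξ, hξ, he⟩ := hmvt z h hh
        obtain ⟨ξ', hξ', he'⟩ := hmvt (z - h) h hh
        rw [sub_add_cancel] at he' hξ'
        have e : 2 * s (z / δ) - s ((z - h) / δ) - s ((z + h) / δ)
            = h * (deriv s (ξ' / δ) / δ - deriv s (ξ / δ) / δ) := by linarith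
        rw [e, abs_mul, abs_of_pos hh]
        gcongr
        refine (hflip ξ' ξ).trans ?_
        gcongr
        rw [abs_of_neg (by linarith [hξ.1, hξ'.2])]; linarith [hξ.2, hξ'.1]
      · calc h * (C2 / δ ^ 2 * (2 * h)) * (δ + h - -h)
            ≤ h * (C2 / δ ^ 2 * (2 * h)) * (3 * δ) := by gcongr; linarith
          _ = 6 * C2 * h ^ 2 / δ := by field_simp; ring
          _ ≤ _ := by gcongr; linarith
    · refine (lintegral_enorm_le_of_support (M := 1) (by positivity)
        (fun z => ?_) hsup).trans (ENNReal.ofReal_le_ofReal ?_)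
      · have m1 : s ((z - h) / δ) ≤ s (z / δ) := hmono (by linarith)
        have m2 : s (z / δ) ≤ s ((z + h) / δ) := hmono (by linarith)
        rw [abs_le]
        constructor <;> linarith [hrange ((z + h) / δ), hrange (z / δ), hrange ((z - h) / δ)]
      · calc 1 * (δ + h - -h) ≤ 3 * (h * 1) := by linarith
          _ ≤ 3 * (h * (h / δ)) := by gcongr; exact (one_le_div hδ).2 hhd
          _ = 3 * h ^ 2 / δ := by ring
          _ ≤ _ := by gcongr; linarith


/-! ### Pointwise comparison of a discrete entropy solution with a constant -/

lemma sum_int_shift {S : Finset ℤ} {p : ℤ → ℝ} (h0 : ∀ j ∉ S, p j = 0)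
    (h1 : ∀ j ∉ S, p (j + 1) = 0) : ∑ j ∈ S, p (j + 1) = ∑ j ∈ S, p j := by
  have e0 : ∑' j, p j = ∑ j ∈ S, p j := tsum_eq_sum fun j hj => h0 j hj
  have e1 : ∑' j, p (j + 1) = ∑ j ∈ S, p (j + 1) := tsum_eq_sum fun j hj => h1 j hj
  rw [← e0, ← e1]
  exact (Equiv.addRight (1 : ℤ)).tsum_eq p

/-- The mollified indicator function of the cell `j`. -/
noncomputable def cellKernel (F : ℝ → ℝ) (h : ℝ) (j : ℤ) (x : ℝ) : ℝ :=
  F (x - ((j : ℝ) - 1 / 2) * h) - F (x - ((j : ℝ) + 1 / 2) * h)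

/-- Error of the difference quotient. -/
noncomputable def slopeError (F f : ℝ → ℝ) (h z : ℝ) : ℝ := f z - (F (z + h) - F z) / h

/-- Second difference. -/
def secondDiff (F : ℝ → ℝ) (h z : ℝ) : ℝ := 2 * F z - F (z - h) - F (z + h)

/-- The residual of the discrete entropy inequality after summation by parts. -/
noncomputable def schemeResidual (M : ℝ) (F f : ℝ → ℝ) (h : ℝ) (S : Finset ℤ) (w e : ℤ → ℝ)
    (x : ℝ) : ℝ :=
  ∑ j ∈ S, (M * |w j - w (j - 1)| * |slopeError F f h (x - ((j : ℝ) - 1 / 2) * h)|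
    + e j * (|secondDiff F h (x - ((j : ℝ) - 1 / 2) * h)| / h))

/-- The cells with indices outside `[-J, J]` do not interact with the point `x`. -/
def IsCovering (δ h : ℝ) (J : ℕ) (x : ℝ) : Prop :=
  ∀ j : ℤ, ((J : ℤ) < j → x - ((j : ℝ) - 1 / 2) * h < -(2 * h)) ∧
    (j < -(J : ℤ) → δ + 2 * h < x - ((j : ℝ) - 1 / 2) * h)

lemma IsCovering.far {δ h : ℝ} {J : ℕ} {x : ℝ} (hx : IsCovering δ h J x) {j : ℤ}
    (hj : j ∉ Finset.Icc (-J : ℤ) J) :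
    x - ((j : ℝ) - 1 / 2) * h < -(2 * h) ∨ δ + 2 * h < x - ((j : ℝ) - 1 / 2) * h := by
  rw [Finset.mem_Icc, not_and_or, not_le, not_le] at hj
  rcases hj with hj | hj
  · exact Or.inr ((hx j).2 hj)
  · exact Or.inl ((hx j).1 hj)

lemma isCovering_of_abs_le {δ h R : ℝ} (hh : 0 < h) {J : ℕ} (hJ : R + δ + 3 * h ≤ J * h) {x : ℝ}
    (hδ : 0 ≤ δ) (hx : |x| ≤ R) : IsCovering δ h J x := by
  rw [abs_le] at hx
  intro j
  constructor <;> intro hj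
  · have : (J : ℝ) + 1 ≤ j := by exact_mod_cast hj
    nlinarith
  · have : (j : ℝ) + 1 ≤ -J := by exact_mod_cast hj
    nlinarith

namespace IsSmoothStep

variable {C δ : ℝ} {F f : ℝ → ℝ}

lemma continuous_deriv (hF : IsSmoothStep C δ F f) : Continuous f := by
  have h : f = deriv F := funext fun z => ((hF.hasDerivAt z).deriv).symm
  rw [h]; exact hF.contDiff.continuous_deriv le_rfl

lemma width_pos (hF : IsSmoothStep C δ F f) : 0 < δ := by
  by_contra! h
  have h1 := hF.zero 0 le_rfl
  rw [hF.one 0 h] at h1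
  exact one_ne_zero h1

lemma cellKernel_nonneg (hF : IsSmoothStep C δ F f) {h : ℝ} (hh : 0 < h) (j : ℤ) (x : ℝ) :
    0 ≤ cellKernel F h j x := sub_nonneg.2 (hF.mono (by nlinarith))

lemma const_of_far (hF : IsSmoothStep C δ F f) {z : ℝ} {h : ℝ}
    (hz : z < -(2 * h) ∨ δ + 2 * h < z) {z₁ z₂ : ℝ} (h1 : |z₁ - z| ≤ 2 * h) (h2 : |z₂ - z| ≤ 2 * h) :
    F z₁ = F z₂ ∧ f z₁ = 0 := by
  have hd := hF.width_pos
  rw [abs_le] at h1 h2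
  rcases hz with hz | hz
  · exact ⟨by rw [hF.zero _ (by linarith), hF.zero _ (by linarith)],
      hF.deriv_zero _ fun hm => by linarith [hm.1]⟩
  · exact ⟨by rw [hF.one _ (by linarith), hF.one _ (by linarith)],
      hF.deriv_zero _ fun hm => by linarith [hm.2]⟩

lemma sum_cellKernel (hF : IsSmoothStep C δ F f) {h : ℝ} (hh : 0 < h) {J : ℕ} {x : ℝ}
    (hx : IsCovering δ h J x) :
    ∑ j ∈ Finset.Icc (-J : ℤ) J, cellKernel F h j x = 1 := by
  have hd := hF.width_pos
  have key : ∀ n : ℕ, ∑ j ∈ Finset.Icc (-J : ℤ) (-J + n), cellKernel F h j x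
      = F (x - ((-J : ℝ) - 1 / 2) * h) - F (x - ((-J : ℝ) + n + 1 / 2) * h) := fun n => by
    induction n with
    | zero => simp [cellKernel]
    | succ n ih =>
      have : Finset.Icc (-J : ℤ) (-J + (n + 1 : ℕ))
          = insert ((-J : ℤ) + (n + 1 : ℕ)) (Finset.Icc (-J : ℤ) (-J + n)) := by
        ext k; simp only [Finset.mem_Icc, Finset.mem_insert]; omega
      rw [this, Finset.sum_insert (by simp), ih, cellKernel]
      push_cast
      have e : x - (-(J : ℝ) + (n + 1) - 1 / 2) * h = x - (-(J : ℝ) + n + 1 / 2) * h := by ring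
      rw [e]; ring
  have h1 := key (2 * J)
  rw [show (-J : ℤ) + ((2 * J : ℕ) : ℤ) = J by push_cast; ring] at h1
  rw [h1]
  have a1 := (hx (-J - 1)).2 (by simp)
  have a2 := (hx (J + 1)).1 (by simp)
  push_cast at a1 a2 ⊢
  rw [hF.one _ (by linarith), hF.zero _ (by linarith), sub_zero]

end IsSmoothStep

section Pointwise

variable {V : ℝ → ℝ} {A L lam h C δ : ℝ} {B : ℝ≥0∞} {u : ℕ → ℤ → ℝ} {Q : ℕ → ℤ → ℝ → ℝ}
  {E : ℕ → ℤ → ℝ} {F f : ℝ → ℝ}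

/-- The discrete entropy inequality, tested with the mollified cells. -/
lemma IsDiscreteEntropySolution.sum_cellKernel_le (H : IsDiscreteEntropySolution V lam B u Q E)
    (hV : IsVelocity V A L) (hF : IsSmoothStep C δ F f) (hl : 0 < lam) (hh : 0 < h) {J : ℕ} {x : ℝ}
    (hx : IsCovering δ h J x) (n : ℕ) (c : ℝ) :
    ∑ j ∈ Finset.Icc (-J : ℤ) J, (|u (n + 1) j - c| - |u n j - c|) / (lam * h) * cellKernel F h j x
      + ∑ j ∈ Finset.Icc (-J : ℤ) J, kruzkovFlux V c (u n j) * cellKernel f h j x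
      ≤ schemeResidual (A + L) F f h (Finset.Icc (-J : ℤ) J) (u n) (E n) x := by
  set S := Finset.Icc (-J : ℤ) J with hS
  set z : ℤ → ℝ := fun j => x - ((j : ℝ) - 1 / 2) * h with hz
  have hz1 : ∀ j : ℤ, x - ((j : ℝ) + 1 / 2) * h = z j - h := fun j => by simp only [hz]; ring
  have hzs : ∀ j : ℤ, z (j + 1) = z j - h := fun j => by simp only [hz]; push_cast; ring
  have hzp : ∀ j : ℤ, z (j - 1) = z j + h := fun j => by simp only [hz]; push_cast; ring
  have hK : ∀ j, cellKernel F h j x = F (z j) - F (z j - h) := fun j => by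
    rw [cellKernel, hz1]
  have hk : ∀ j, cellKernel f h j x = f (z j) - f (z j - h) := fun j => by
    rw [cellKernel, hz1]
  have hfar : ∀ j ∉ S, ∀ {z₁ z₂ : ℝ}, |z₁ - z j| ≤ 2 * h → |z₂ - z j| ≤ 2 * h →
      F z₁ = F z₂ ∧ f z₁ = 0 := fun j hj _ _ h1 h2 => hF.const_of_far (hx.far hj) h1 h2
  have n0 : ∀ a : ℝ, |a - a| ≤ 2 * h := fun a => by simp; linarith
  have n1 : ∀ a : ℝ, |a + h - a| ≤ 2 * h := fun a => by
    rw [add_sub_cancel_left, abs_of_pos hh]; linarith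
  have n2 : ∀ a : ℝ, |a - h - a| ≤ 2 * h := fun a => by
    rw [sub_sub_cancel_left, abs_neg, abs_of_pos hh]; linarith
  have step1 : ∑ j ∈ S, (|u (n + 1) j - c| - |u n j - c|) / (lam * h) * cellKernel F h j x
      ≤ ∑ j ∈ S, Q n j c * (secondDiff F h (z j) / h) := by
    have hle : ∑ j ∈ S, (|u (n + 1) j - c| - |u n j - c|) / (lam * h) * cellKernel F h j x
        ≤ ∑ j ∈ S, ((Q n j c * (cellKernel F h j x / h))
          - Q n (j + 1) c * (cellKernel F h (j + 1 - 1) x / h)) := by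
      refine Finset.sum_le_sum fun j _ => ?_
      have h1 := H.entropy n j c
      have h2 : (|u (n + 1) j - c| - |u n j - c|) / (lam * h) ≤ (Q n j c - Q n (j + 1) c) / h := by
        rw [div_le_div_iff₀ (by positivity) hh]
        nlinarith
      have h3 := mul_le_mul_of_nonneg_right h2 (hF.cellKernel_nonneg hh j x)
      rw [add_sub_cancel_right]
      refine h3.trans (le_of_eq ?_)
      ring
    refine hle.trans (le_of_eq ?_)
    rw [Finset.sum_sub_distrib,
      sum_int_shift (p := fun j => Q n j c * (cellKernel F h (j - 1) x / h)), ← Finset.sum_sub_distrib]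
    · refine Finset.sum_congr rfl fun j _ => ?_
      rw [hK, hK, hzp, add_sub_cancel_right, secondDiff]; ring
    · intro j hj
      rw [hK, hzp, add_sub_cancel_right, (hfar j hj (n1 _) (n0 _)).1]; simp
    · intro j hj
      rw [hK, add_sub_cancel_right, (hfar j hj (n0 _) (n2 _)).1]; simp
  have step2 : ∑ j ∈ S, kruzkovFlux V c (u n j)
        * (cellKernel f h j x + secondDiff F h (z j) / h)
      = ∑ j ∈ S, (kruzkovFlux V c (u n j) - kruzkovFlux V c (u n (j - 1)))
        * slopeError F f h (z j) := by
    have e : ∀ j, kruzkovFlux V c (u n j) * (cellKernel f h j x + secondDiff F h (z j) / h)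
        = kruzkovFlux V c (u n j) * slopeError F f h (z j)
          - kruzkovFlux V c (u n (j + 1 - 1)) * slopeError F f h (z (j + 1)) := fun j => by
      rw [hk, hzs, add_sub_cancel_right, slopeError, slopeError, secondDiff, sub_add_cancel]; ring
    rw [Finset.sum_congr rfl fun j _ => e j, Finset.sum_sub_distrib,
      sum_int_shift (p := fun j => kruzkovFlux V c (u n (j - 1)) * slopeError F f h (z j)),
      ← Finset.sum_sub_distrib]
    · exact Finset.sum_congr rfl fun j _ => by ring
    · intro j hj
      rw [slopeError, (hfar j hj (n0 _) (n0 _)).2, (hfar j hj (n1 _) (n0 _)).1]; simp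
    · intro j hj
      rw [slopeError, hzs, sub_add_cancel, (hfar j hj (n2 _) (n0 _)).2,
        (hfar j hj (n2 _) (n0 _)).1]; simp
  calc _ ≤ ∑ j ∈ S, Q n j c * (secondDiff F h (z j) / h)
        + ∑ j ∈ S, kruzkovFlux V c (u n j) * cellKernel f h j x := by gcongr
    _ = ∑ j ∈ S, (Q n j c - kruzkovFlux V c (u n j)) * (secondDiff F h (z j) / h)
        + ∑ j ∈ S, kruzkovFlux V c (u n j) * (cellKernel f h j x + secondDiff F h (z j) / h) := by
        rw [← Finset.sum_add_distrib, ← Finset.sum_add_distrib]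
        exact Finset.sum_congr rfl fun j _ => by ring
    _ = ∑ j ∈ S, ((kruzkovFlux V c (u n j) - kruzkovFlux V c (u n (j - 1)))
          * slopeError F f h (z j)
        + (Q n j c - kruzkovFlux V c (u n j)) * (secondDiff F h (z j) / h)) := by
        rw [step2, add_comm, ← Finset.sum_add_distrib]
    _ ≤ _ := by
        refine Finset.sum_le_sum fun j _ => add_le_add ?_ ?_
        · refine (le_abs_self _).trans ?_
          rw [abs_mul]
          exact mul_le_mul_of_nonneg_right (hV.abs_kruzkovFlux_sub_le (H.mem _ _) (H.mem _ _))
            (abs_nonneg _)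
        · refine (le_abs_self _).trans ?_
          rw [abs_mul, abs_div, abs_of_pos hh]
          exact mul_le_mul_of_nonneg_right (H.flux n j c) (by positivity)

/-- Derivative of a Poisson weight in time. -/
noncomputable def poissonDeriv (n : ℕ) (x : ℝ) : ℝ :=
  (if n = 0 then 0 else poissonWeight (n - 1) x) - poissonWeight n x

lemma hasDerivAt_poissonWeight (n : ℕ) (x : ℝ) :
    HasDerivAt (poissonWeight n) (poissonDeriv n x) x := by
  cases n with
  | zero => simpa [poissonDeriv] using hasDerivAt_poissonWeight_zero x
  | succ n => simpa [poissonDeriv] using hasDerivAt_poissonWeight_succ n x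

lemma sum_mul_poissonDeriv (a : ℕ → ℝ) (x : ℝ) (N : ℕ) :
    ∑ n ∈ Finset.range (N + 1), a n * poissonDeriv n x
      = ∑ n ∈ Finset.range N, (a (n + 1) - a n) * poissonWeight n x - a N * poissonWeight N x := by
  induction N with
  | zero => simp [poissonDeriv]
  | succ N ih =>
    rw [Finset.sum_range_succ, ih, Finset.sum_range_succ _ N]
    simp only [poissonDeriv, Nat.succ_ne_zero, if_false, Nat.add_sub_cancel]
    ring

/-- The full set of discrete entropy inequalities, tested with the mollified cells in space and the
Poisson weights in time. -/
lemma IsDiscreteEntropySolution.sum_poisson_le (H : IsDiscreteEntropySolution V lam B u Q E)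
    (hV : IsVelocity V A L) (hF : IsSmoothStep C δ F f) (hl : 0 < lam) (hh : 0 < h) {J : ℕ} {x : ℝ}
    (hx : IsCovering δ h J x) (N : ℕ) {c s : ℝ} (hc : c ∈ Icc (0 : ℝ) 1) (hs : 0 ≤ s) :
    ∑ n ∈ Finset.range (N + 1), ∑ j ∈ Finset.Icc (-J : ℤ) J,
        (|u n j - c| * (poissonDeriv n s / (lam * h) * cellKernel F h j x)
          + kruzkovFlux V c (u n j) * (poissonWeight n s * cellKernel f h j x))
      ≤ ∑ n ∈ Finset.range N, poissonWeight n s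
          * schemeResidual (A + L) F f h (Finset.Icc (-J : ℤ) J) (u n) (E n) x
        + poissonWeight N s * ∑ j ∈ Finset.Icc (-J : ℤ) J, (A + L) * |cellKernel f h j x| := by
  set S := Finset.Icc (-J : ℤ) J with hS
  have hM : 0 ≤ A + L := add_nonneg hV.bound_nonneg hV.lip_nonneg
  set a : ℕ → ℝ := fun n => ∑ j ∈ S, |u n j - c| * (cellKernel F h j x / (lam * h)) with ha
  set b : ℕ → ℝ := fun n => ∑ j ∈ S, kruzkovFlux V c (u n j) * cellKernel f h j x with hb
  have e1 : ∑ n ∈ Finset.range (N + 1), ∑ j ∈ S,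
        (|u n j - c| * (poissonDeriv n s / (lam * h) * cellKernel F h j x)
          + kruzkovFlux V c (u n j) * (poissonWeight n s * cellKernel f h j x))
      = ∑ n ∈ Finset.range (N + 1), a n * poissonDeriv n s
        + ∑ n ∈ Finset.range (N + 1), b n * poissonWeight n s := by
    rw [← Finset.sum_add_distrib]
    refine Finset.sum_congr rfl fun n _ => ?_
    rw [ha, hb]
    simp only
    rw [Finset.sum_add_distrib, Finset.sum_mul, Finset.sum_mul]
    congr 1 <;> exact Finset.sum_congr rfl fun j _ => by ring
  rw [e1, sum_mul_poissonDeriv, Finset.sum_range_succ _ N]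
  have h0 : 0 ≤ a N * poissonWeight N s := by
    refine mul_nonneg (Finset.sum_nonneg fun j _ => ?_) (poissonWeight_nonneg N hs)
    have := hF.cellKernel_nonneg hh j x
    positivity
  have h1 : b N * poissonWeight N s
      ≤ poissonWeight N s * ∑ j ∈ S, (A + L) * |cellKernel f h j x| := by
    rw [mul_comm]
    refine mul_le_mul_of_nonneg_left (Finset.sum_le_sum fun j _ => ?_) (poissonWeight_nonneg N hs)
    refine (le_abs_self _).trans ?_
    rw [abs_mul]
    refine mul_le_mul_of_nonneg_right ?_ (abs_nonneg _)
    refine (hV.abs_kruzkovFlux_le (H.mem N j)).trans (mul_le_of_le_one_right hM ?_)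
    rw [abs_le]
    constructor <;> linarith [(H.mem N j).1, (H.mem N j).2, hc.1, hc.2]
  have h2 : ∑ n ∈ Finset.range N, (a (n + 1) - a n) * poissonWeight n s
        + ∑ n ∈ Finset.range N, b n * poissonWeight n s
      ≤ ∑ n ∈ Finset.range N, poissonWeight n s * schemeResidual (A + L) F f h S (u n) (E n) x := by
    rw [← Finset.sum_add_distrib]
    refine Finset.sum_le_sum fun n _ => ?_
    rw [← add_mul, mul_comm]
    refine mul_le_mul_of_nonneg_left ?_ (poissonWeight_nonneg n hs)
    refine le_trans (le_of_eq ?_) (H.sum_cellKernel_le hV hF hl hh hx n c)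
    rw [ha, hb]
    simp only
    rw [← Finset.sum_sub_distrib]
    congr 1
    exact Finset.sum_congr rfl fun j _ => by ring
  linarith

end Pointwise


/-! ### The doubling estimate in integrated form -/

/-- Cutoff functions `Ψ` on space-time, supported in `[0,T] × [-R,R]` for nonnegative times, that
decrease along the cone of slope `M`, with a rate of decrease at least `p`, `p (t, x) ≤ π t`. -/
structure IsCutoff (M R T : ℝ) (Ψ p : ℝ × ℝ → ℝ) (π : ℝ → ℝ) : Prop where
  contDiff : ContDiff ℝ 1 Ψ
  compact : HasCompactSupport Ψ
  nonneg : ∀ t ≥ 0, ∀ x, 0 ≤ Ψ (t, x)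
  le_one : ∀ t ≥ 0, ∀ x, Ψ (t, x) ≤ 1
  support : ∀ t ≥ 0, ∀ x, ¬(t ≤ T ∧ |x| ≤ R) → Ψ (t, x) = 0
  slope : ∀ t > 0, ∀ x,
    fderiv ℝ Ψ (t, x) (1, 0) + M * |fderiv ℝ Ψ (t, x) (0, 1)| ≤ -p (t, x)
  rate_continuous : Continuous p
  rate_compact : HasCompactSupport p
  rate_nonneg : ∀ t ≥ 0, ∀ x, 0 ≤ p (t, x)
  rate_le : ∀ t ≥ 0, ∀ x, p (t, x) ≤ π t
  rate_support : ∀ t ≥ 0, ∀ x, ¬(t ≤ T ∧ |x| ≤ R) → p (t, x) = 0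
  density_measurable : Measurable π
  density_mass : ∫⁻ t in Ioi 0, ENNReal.ofReal (π t) ≤ 1

/-- Lebesgue measure on the half plane of positive times. -/
noncomputable def halfPlane : Measure (ℝ × ℝ) := volume.restrict (Ioi (0 : ℝ) ×ˢ (univ : Set ℝ))

lemma halfPlane_eq_prod : halfPlane = (volume.restrict (Ioi (0 : ℝ))).prod (volume : Measure ℝ) := by
  have h := Measure.prod_restrict (μ := (volume : Measure ℝ)) (ν := (volume : Measure ℝ))
    (Ioi (0 : ℝ)) univ
  rw [Measure.restrict_univ] at h
  rw [h]; rfl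

lemma ae_halfPlane_pos : ∀ᵐ z ∂halfPlane, 0 < z.1 := by
  filter_upwards [ae_restrict_mem (measurableSet_Ioi.prod MeasurableSet.univ)] with z hz
  exact hz.1

lemma fderiv_apply_fst {φ : ℝ × ℝ → ℝ} {t x d : ℝ} (hφ : DifferentiableAt ℝ φ (t, x))
    (hd : HasDerivAt (fun s => φ (s, x)) d t) : fderiv ℝ φ (t, x) (1, 0) = d := by
  have h1 : HasDerivAt (fun s : ℝ => (s, x)) ((1 : ℝ), (0 : ℝ)) t :=
    (hasDerivAt_id t).prodMk (hasDerivAt_const t x)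
  exact (hφ.hasFDerivAt.comp_hasDerivAt t h1).unique hd

lemma fderiv_apply_snd {φ : ℝ × ℝ → ℝ} {t x d : ℝ} (hφ : DifferentiableAt ℝ φ (t, x))
    (hd : HasDerivAt (fun y => φ (t, y)) d x) : fderiv ℝ φ (t, x) (0, 1) = d := by
  have h1 : HasDerivAt (fun y : ℝ => (t, y)) ((0 : ℝ), (1 : ℝ)) x :=
    (hasDerivAt_const x t).prodMk (hasDerivAt_id x)
  exact (hφ.hasFDerivAt.comp_hasDerivAt x h1).unique hd

lemma hasDerivAt_fst {φ : ℝ × ℝ → ℝ} {t x : ℝ} (hφ : DifferentiableAt ℝ φ (t, x)) :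
    HasDerivAt (fun s => φ (s, x)) (fderiv ℝ φ (t, x) (1, 0)) t :=
  hφ.hasFDerivAt.comp_hasDerivAt t ((hasDerivAt_id t).prodMk (hasDerivAt_const t x))

lemma hasDerivAt_snd {φ : ℝ × ℝ → ℝ} {t x : ℝ} (hφ : DifferentiableAt ℝ φ (t, x)) :
    HasDerivAt (fun y => φ (t, y)) (fderiv ℝ φ (t, x) (0, 1)) x :=
  hφ.hasFDerivAt.comp_hasDerivAt x ((hasDerivAt_const x t).prodMk (hasDerivAt_id x))

lemma hasCompactSupport_slice {φ : ℝ × ℝ → ℝ} (hφ : HasCompactSupport φ) (t : ℝ) :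
    HasCompactSupport fun x => φ (t, x) := by
  refine HasCompactSupport.intro (IsCompact.image hφ continuous_snd) fun x hx => ?_
  exact image_eq_zero_of_notMem_tsupport fun hm => hx ⟨(t, x), hm, rfl⟩

lemma integrable_bounded_mul {X : Type*} [TopologicalSpace X] [MeasurableSpace X]
    [OpensMeasurableSpace X] {μ : Measure X} [IsFiniteMeasureOnCompacts μ] {b g : X → ℝ} {K : ℝ}
    (hb : AEStronglyMeasurable b μ) (hK : ∀ᵐ z ∂μ, |b z| ≤ K) (hg : Continuous g)
    (hgs : HasCompactSupport g) : Integrable (fun z => b z * g z) μ :=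
  (hg.integrable_of_hasCompactSupport hgs).bdd_mul hb (by simpa using hK)

instance : IsFiniteMeasureOnCompacts halfPlane := by unfold halfPlane; infer_instance

/-- The test functions of the doubling argument. -/
noncomputable def doublingTest (Ψ : ℝ × ℝ → ℝ) (F : ℝ → ℝ) (lam h : ℝ) (n : ℕ) (j : ℤ)
    (z : ℝ × ℝ) : ℝ :=
  Ψ z * (poissonWeight n (z.1 / (lam * h)) * cellKernel F h j z.2)

section Integrated

variable {V ρ₀ : ℝ → ℝ} {v : ℝ → ℝ → ℝ} {A L lam h C δ R T : ℝ} {B : ℝ≥0∞} {u : ℕ → ℤ → ℝ}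
  {Q : ℕ → ℤ → ℝ → ℝ} {E : ℕ → ℤ → ℝ} {F f : ℝ → ℝ} {Ψ p : ℝ × ℝ → ℝ} {π : ℝ → ℝ}

lemma IsSmoothStep.contDiff_cellKernel (hF : IsSmoothStep C δ F f) (h : ℝ) (j : ℤ) :
    ContDiff ℝ 1 (cellKernel F h j) := by
  unfold cellKernel
  exact (hF.contDiff.comp (contDiff_id.sub contDiff_const)).sub
    (hF.contDiff.comp (contDiff_id.sub contDiff_const))

lemma IsSmoothStep.hasDerivAt_cellKernel (hF : IsSmoothStep C δ F f) (h : ℝ) (j : ℤ) (x : ℝ) :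
    HasDerivAt (cellKernel F h j) (cellKernel f h j x) x := by
  unfold cellKernel
  have h1 := (hF.hasDerivAt (x - ((j : ℝ) - 1 / 2) * h)).comp x ((hasDerivAt_id x).sub_const _)
  have h2 := (hF.hasDerivAt (x - ((j : ℝ) + 1 / 2) * h)).comp x ((hasDerivAt_id x).sub_const _)
  rw [mul_one] at h1 h2
  exact h1.sub h2

lemma IsSmoothStep.contDiff_doublingTest (hF : IsSmoothStep C δ F f) (hΨ : ContDiff ℝ 1 Ψ)
    (n : ℕ) (j : ℤ) : ContDiff ℝ 1 (doublingTest Ψ F lam h n j) := by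
  unfold doublingTest
  exact hΨ.mul (((contDiff_poissonWeight n).comp (contDiff_fst.div_const _)).mul
    ((hF.contDiff_cellKernel h j).comp contDiff_snd))

lemma IsSmoothStep.fderiv_doublingTest_fst (hF : IsSmoothStep C δ F f) (hΨ : ContDiff ℝ 1 Ψ)
    (n : ℕ) (j : ℤ) (t x : ℝ) :
    fderiv ℝ (doublingTest Ψ F lam h n j) (t, x) (1, 0)
      = fderiv ℝ Ψ (t, x) (1, 0) * (poissonWeight n (t / (lam * h)) * cellKernel F h j x)
        + Ψ (t, x) * (poissonDeriv n (t / (lam * h)) / (lam * h) * cellKernel F h j x) := by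
  refine fderiv_apply_fst ((hF.contDiff_doublingTest hΨ n j).differentiable one_ne_zero _) ?_
  have h1 := hasDerivAt_fst (hΨ.differentiable one_ne_zero (t, x))
  have h2 := ((hasDerivAt_poissonWeight n (t / (lam * h))).comp t
    ((hasDerivAt_id t).div_const (lam * h))).mul_const (cellKernel F h j x)
  rw [mul_one_div] at h2
  exact h1.mul h2

lemma IsSmoothStep.fderiv_doublingTest_snd (hF : IsSmoothStep C δ F f) (hΨ : ContDiff ℝ 1 Ψ)
    (n : ℕ) (j : ℤ) (t x : ℝ) :
    fderiv ℝ (doublingTest Ψ F lam h n j) (t, x) (0, 1)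
      = fderiv ℝ Ψ (t, x) (0, 1) * (poissonWeight n (t / (lam * h)) * cellKernel F h j x)
        + Ψ (t, x) * (poissonWeight n (t / (lam * h)) * cellKernel f h j x) := by
  refine fderiv_apply_snd ((hF.contDiff_doublingTest hΨ n j).differentiable one_ne_zero _) ?_
  have h1 := hasDerivAt_snd (hΨ.differentiable one_ne_zero (t, x))
  have h2 := (hF.hasDerivAt_cellKernel h j x).const_mul (poissonWeight n (t / (lam * h)))
  exact h1.mul h2

lemma IsSmoothStep.continuous_schemeResidual (hF : IsSmoothStep C δ F f) (M h : ℝ) (S : Finset ℤ)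
    (w e : ℤ → ℝ) : Continuous (schemeResidual M F f h S w e) := by
  have h1 := hF.contDiff.continuous
  have h2 := hF.continuous_deriv
  unfold schemeResidual slopeError secondDiff
  fun_prop

theorem IsDiscreteEntropySolution.doubling_integral_le (H : IsDiscreteEntropySolution V lam B u Q E)
    (hv : IsEntropySolution V ρ₀ v) (hρ : AEMeasurable ρ₀) (hρm : ∀ᵐ x : ℝ, ρ₀ x ∈ Icc (0 : ℝ) 1)
    (hV : IsVelocity V A L) (hF : IsSmoothStep C δ F f) (hl : 0 < lam) (hh : 0 < h)
    (hΨ : IsCutoff (A + L) R T Ψ p π) {J : ℕ} (hJ : R + δ + 3 * h ≤ J * h) (N : ℕ) :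
    ∫⁻ z, ENNReal.ofReal (p z * ∑ n ∈ Finset.range (N + 1), ∑ j ∈ Finset.Icc (-J : ℤ) J,
        poissonWeight n (z.1 / (lam * h)) * cellKernel F h j z.2 * |v z.1 z.2 - u n j|)
        ∂halfPlane
      ≤ ∫⁻ z, ‖Ψ z * (∑ n ∈ Finset.range N, poissonWeight n (z.1 / (lam * h))
          * schemeResidual (A + L) F f h (Finset.Icc (-J : ℤ) J) (u n) (E n) z.2
        + poissonWeight N (z.1 / (lam * h))
          * ∑ j ∈ Finset.Icc (-J : ℤ) J, (A + L) * |cellKernel f h j z.2|)‖ₑ ∂halfPlane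
        + ∫⁻ x, ‖Ψ (0, x) * ∑ j ∈ Finset.Icc (-J : ℤ) J, cellKernel F h j x * |ρ₀ x - u 0 j|‖ₑ := by
  set S := Finset.Icc (-J : ℤ) J with hS
  have hτ : 0 < lam * h := mul_pos hl hh
  have hM : 0 ≤ A + L := add_nonneg hV.bound_nonneg hV.lip_nonneg
  have hmeas : AEStronglyMeasurable (fun z : ℝ × ℝ => v z.1 z.2) halfPlane :=
    hv.aestronglyMeasurable
  have hmem : ∀ᵐ z ∂halfPlane, v z.1 z.2 ∈ Icc (0 : ℝ) 1 := hv.mem_Icc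
  have hFc := hF.contDiff.continuous
  have hfc := hF.continuous_deriv
  have hpc : ∀ n, Continuous (poissonWeight n) := fun n => (contDiff_poissonWeight n).continuous
  have hkc : ∀ j, Continuous (cellKernel F h j) := fun j => (hF.contDiff_cellKernel h j).continuous
  have hkc' : ∀ j, Continuous (cellKernel f h j) := fun j => by unfold cellKernel; fun_prop
  have hdiff : ∀ c ∈ Icc (0 : ℝ) 1, ∀ a ∈ Icc (0 : ℝ) 1, |a - c| ≤ 1 := fun c hc a ha => by
    rw [abs_le]; constructor <;> linarith [ha.1, ha.2, hc.1, hc.2]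
  set φ := doublingTest Ψ F lam h with hφ
  have hφcd : ∀ n j, ContDiff ℝ 1 (φ n j) := fun n j => hF.contDiff_doublingTest hΨ.contDiff n j
  have hφcs : ∀ n j, HasCompactSupport (φ n j) := fun n j => hΨ.compact.mul_right
  set I : ℕ → ℤ → ℝ × ℝ → ℝ := fun n j z => |v z.1 z.2 - u n j| * fderiv ℝ (φ n j) z (1, 0)
    + kruzkovFlux V (u n j) (v z.1 z.2) * fderiv ℝ (φ n j) z (0, 1) with hI
  set b : ℕ → ℤ → ℝ → ℝ := fun n j x => |ρ₀ x - u n j| * φ n j (0, x) with hb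
  have hent : ∀ n j, 0 ≤ ∫ z, I n j z ∂halfPlane + ∫ x, b n j x := fun n j =>
    hv.entropy (u n j) (H.mem n j) (φ n j) (hφcd n j) (hφcs n j) fun t ht x =>
      mul_nonneg (hΨ.nonneg t ht x) (mul_nonneg (poissonWeight_nonneg n (by positivity))
        (hF.cellKernel_nonneg hh j x))
  have habsm : ∀ c, AEStronglyMeasurable (fun z : ℝ × ℝ => |v z.1 z.2 - c|) halfPlane := fun c =>
    (continuous_abs.comp (continuous_sub_right c)).comp_aestronglyMeasurable hmeas
  have habsb : ∀ n j, ∀ᵐ z ∂halfPlane, |(|v z.1 z.2 - u n j|)| ≤ 1 := fun n j =>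
    hmem.mono fun z hz => by rw [abs_abs]; exact hdiff _ (H.mem n j) _ hz
  have hIint : ∀ n j, Integrable (I n j) halfPlane := fun n j => by
    refine Integrable.add ?_ ?_
    · exact integrable_bounded_mul (habsm _) (habsb n j)
        ((hφcd n j).continuous_fderiv_apply one_ne_zero |>.comp
          (continuous_id.prodMk continuous_const)) ((hφcs n j).fderiv_apply ℝ _)
    · refine integrable_bounded_mul (K := A + L) ?_ ?_
        ((hφcd n j).continuous_fderiv_apply one_ne_zero |>.comp
          (continuous_id.prodMk continuous_const)) ((hφcs n j).fderiv_apply ℝ _)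
      · exact (hV.continuous_kruzkovFlux.comp
          (continuous_const.prodMk continuous_id)).comp_aestronglyMeasurable hmeas
      · filter_upwards [hmem] with z hz
        exact (hV.abs_kruzkovFlux_le hz).trans
          (mul_le_of_le_one_right hM (hdiff _ (H.mem n j) _ hz))
  have hbint : ∀ n j, Integrable (b n j) := fun n j => by
    refine integrable_bounded_mul (K := 1) ?_ ?_ ((hφcd n j).continuous.comp
      (continuous_const.prodMk continuous_id)) ?_
    · exact (continuous_abs.comp (continuous_sub_right (u n j))).comp_aestronglyMeasurable
        hρ.aestronglyMeasurable
    · exact hρm.mono fun x hx => by rw [abs_abs]; exact hdiff _ (H.mem n j) _ hx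
    · exact hasCompactSupport_slice (hφcs n j) 0
  have hsum : 0 ≤ ∫ z, ∑ n ∈ Finset.range (N + 1), ∑ j ∈ S, I n j z ∂halfPlane
      + ∫ x, ∑ n ∈ Finset.range (N + 1), ∑ j ∈ S, b n j x := by
    rw [integral_finsetSum _ fun n _ => integrable_finsetSum _ fun j _ => hIint n j,
      integral_finsetSum _ fun n _ => integrable_finsetSum _ fun j _ => hbint n j,
      ← Finset.sum_add_distrib]
    refine Finset.sum_nonneg fun n _ => ?_
    rw [integral_finsetSum _ fun j _ => hIint n j, integral_finsetSum _ fun j _ => hbint n j,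
      ← Finset.sum_add_distrib]
    exact Finset.sum_nonneg fun j _ => hent n j
  have hbeq : ∀ x, ∑ n ∈ Finset.range (N + 1), ∑ j ∈ S, b n j x
      = Ψ (0, x) * ∑ j ∈ S, cellKernel F h j x * |ρ₀ x - u 0 j| := fun x => by
    rw [Finset.sum_eq_single 0]
    · rw [Finset.mul_sum]
      refine Finset.sum_congr rfl fun j _ => ?_
      simp only [hb, hφ, doublingTest, zero_div, poissonWeight_zero_right, if_true]; ring
    · intro n _ hn
      refine Finset.sum_eq_zero fun j _ => ?_
      simp only [hb, hφ, doublingTest, zero_div, poissonWeight_zero_right, if_neg hn]; ring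
    · simp
  simp_rw [hbeq] at hsum
  set P : ℝ × ℝ → ℝ := fun z => p z * ∑ n ∈ Finset.range (N + 1), ∑ j ∈ S,
    poissonWeight n (z.1 / (lam * h)) * cellKernel F h j z.2 * |v z.1 z.2 - u n j| with hP
  set U : ℝ × ℝ → ℝ := fun z => Ψ z * (∑ n ∈ Finset.range N, poissonWeight n (z.1 / (lam * h))
      * schemeResidual (A + L) F f h S (u n) (E n) z.2
    + poissonWeight N (z.1 / (lam * h)) * ∑ j ∈ S, (A + L) * |cellKernel f h j z.2|) with hU
  have hPint : Integrable P halfPlane := by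
    have : P = fun z => ∑ n ∈ Finset.range (N + 1), ∑ j ∈ S, |v z.1 z.2 - u n j|
        * (p z * (poissonWeight n (z.1 / (lam * h)) * cellKernel F h j z.2)) := by
      ext z
      simp only [hP, Finset.mul_sum]
      exact Finset.sum_congr rfl fun n _ => Finset.sum_congr rfl fun j _ => by ring
    rw [this]
    refine integrable_finsetSum _ fun n _ => integrable_finsetSum _ fun j _ => ?_
    refine integrable_bounded_mul (habsm _) (habsb n j) ?_ hΨ.rate_compact.mul_right
    exact hΨ.rate_continuous.mul (((hpc n).comp (by fun_prop)).mul ((hkc j).comp continuous_snd))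
  have hUint : Integrable U halfPlane := by
    refine Continuous.integrable_of_hasCompactSupport ?_ hΨ.compact.mul_right
    refine hΨ.contDiff.continuous.mul (Continuous.add ?_ ?_)
    · refine continuous_finsetSum _ fun n _ => ((hpc n).comp (by fun_prop)).mul ?_
      exact (hF.continuous_schemeResidual _ _ _ _ _).comp continuous_snd
    · refine ((hpc N).comp (by fun_prop)).mul (continuous_finsetSum _ fun j _ => ?_)
      exact continuous_const.mul (((hkc' j).comp continuous_snd).abs)
  have hpt : ∀ᵐ z ∂halfPlane, ∑ n ∈ Finset.range (N + 1), ∑ j ∈ S, I n j z ≤ U z - P z := by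
    filter_upwards [hmem, ae_halfPlane_pos] with z hz hz0
    obtain ⟨t, x⟩ := z
    simp only at hz hz0
    set c := v t x with hc
    set s := t / (lam * h) with hs
    have hs0 : 0 ≤ s := by positivity
    set Ψt := fderiv ℝ Ψ (t, x) (1, 0)
    set Ψx := fderiv ℝ Ψ (t, x) (0, 1)
    have hsl : Ψt + (A + L) * |Ψx| ≤ -p (t, x) := hΨ.slope t hz0 x
    have e1 : ∀ n j, I n j (t, x) ≤
        -p (t, x) * (poissonWeight n s * cellKernel F h j x * |c - u n j|)
        + Ψ (t, x) * (|u n j - c| * (poissonDeriv n s / (lam * h) * cellKernel F h j x)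
          + kruzkovFlux V c (u n j) * (poissonWeight n s * cellKernel f h j x)) := fun n j => by
      have hw : 0 ≤ poissonWeight n s * cellKernel F h j x :=
        mul_nonneg (poissonWeight_nonneg n hs0) (hF.cellKernel_nonneg hh j x)
      simp only [hI, hφ, hF.fderiv_doublingTest_fst hΨ.contDiff,
        hF.fderiv_doublingTest_snd hΨ.contDiff]
      rw [kruzkovFlux_symm V (u n j) (v t x), abs_sub_comm (u n j) c]
      have hq : kruzkovFlux V c (u n j) * Ψx ≤ (A + L) * |c - u n j| * |Ψx| := by
        refine (le_abs_self _).trans ?_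
        rw [abs_mul, abs_sub_comm c]
        exact mul_le_mul_of_nonneg_right (hV.abs_kruzkovFlux_le (H.mem n j)) (abs_nonneg _)
      have hq2 : |c - u n j| * Ψt + kruzkovFlux V c (u n j) * Ψx ≤ -p (t, x) * |c - u n j| := by
        have := mul_le_mul_of_nonneg_left hsl (abs_nonneg (c - u n j))
        nlinarith
      have hq3 := mul_le_mul_of_nonneg_right hq2 hw
      nlinarith
    have e2 : ∑ n ∈ Finset.range (N + 1), ∑ j ∈ S, I n j (t, x)
        ≤ -P (t, x) + Ψ (t, x) * ∑ n ∈ Finset.range (N + 1), ∑ j ∈ S,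
          (|u n j - c| * (poissonDeriv n s / (lam * h) * cellKernel F h j x)
          + kruzkovFlux V c (u n j) * (poissonWeight n s * cellKernel f h j x)) := by
      refine (Finset.sum_le_sum fun n _ => Finset.sum_le_sum fun j _ => e1 n j).trans
        (le_of_eq ?_)
      simp only [Finset.sum_add_distrib, ← Finset.mul_sum, hP]
      ring
    refine e2.trans ?_
    rw [neg_add_eq_sub]
    refine sub_le_sub_right ?_ _
    by_cases hin : t ≤ T ∧ |x| ≤ R
    · exact mul_le_mul_of_nonneg_left (H.sum_poisson_le hV hF hl hh
        (isCovering_of_abs_le hh hJ hF.width_pos.le hin.2) N hz hs0) (hΨ.nonneg t hz0.le x)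
    · simp only [hU, hΨ.support t hz0.le x hin, zero_mul, le_refl]
  have hmono := integral_mono_ae (integrable_finsetSum _ fun n _ =>
    integrable_finsetSum _ fun j _ => hIint n j) (hUint.sub hPint) hpt
  have hsub : ∫ z, (U - P) z ∂halfPlane = ∫ z, U z ∂halfPlane - ∫ z, P z ∂halfPlane :=
    integral_sub hUint hPint
  have hle : ∫ z, P z ∂halfPlane ≤ ∫ z, U z ∂halfPlane
      + ∫ x, Ψ (0, x) * ∑ j ∈ S, cellKernel F h j x * |ρ₀ x - u 0 j| := by linarith
  have hP0 : 0 ≤ᵐ[halfPlane] P := by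
    filter_upwards [ae_halfPlane_pos] with z hz
    refine mul_nonneg (hΨ.rate_nonneg z.1 hz.le z.2) (Finset.sum_nonneg fun n _ =>
      Finset.sum_nonneg fun j _ => mul_nonneg (mul_nonneg (poissonWeight_nonneg n (by positivity))
        (hF.cellKernel_nonneg hh j _)) (abs_nonneg _))
  rw [← ofReal_integral_eq_lintegral_ofReal hPint hP0]
  refine (ENNReal.ofReal_le_ofReal hle).trans (ENNReal.ofReal_add_le.trans ?_)
  exact add_le_add ((Real.ofReal_le_enorm _).trans (enorm_integral_le_lintegral_enorm _))
    ((Real.ofReal_le_enorm _).trans (enorm_integral_le_lintegral_enorm _))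

end Integrated


/-! ### Error terms of the doubling estimate -/

lemma lintegral_halfPlane_le (G : ℝ × ℝ → ℝ≥0∞) :
    ∫⁻ z, G z ∂halfPlane ≤ ∫⁻ t in Ioi 0, ∫⁻ x, G (t, x) := by
  rw [halfPlane_eq_prod]; exact lintegral_prod_le G

lemma enorm_sub_le_sum_range_back (w : ℤ → ℝ) (i : ℤ) {k m : ℕ} (hkm : k ≤ m) :
    ‖w i - w (i - k)‖ₑ ≤ ∑ l ∈ Finset.range m, ‖w (i - l - 1 + 1) - w (i - l - 1)‖ₑ := by
  have h := enorm_sub_le_sum_range w (i - k) k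
  rw [sub_add_cancel, ← Finset.sum_range_reflect] at h
  refine h.trans (le_trans (le_of_eq (Finset.sum_congr rfl fun l hl => ?_))
    (Finset.sum_le_sum_of_subset (Finset.range_mono hkm)))
  have hl' : l < k := Finset.mem_range.1 hl
  have e : i - (k : ℤ) + ((k - 1 - l : ℕ) : ℤ) = i - l - 1 := by omega
  rw [e]

section Errors

variable {V ρ₀ : ℝ → ℝ} {v : ℝ → ℝ → ℝ} {A L lam h C δ R T : ℝ} {B : ℝ≥0∞} {u : ℕ → ℤ → ℝ}
  {Q : ℕ → ℤ → ℝ → ℝ} {E : ℕ → ℤ → ℝ} {F f : ℝ → ℝ} {Ψ p : ℝ × ℝ → ℝ} {π : ℝ → ℝ}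

/-- Oscillation of a sequence over the cells seen by the mollified cells. -/
noncomputable def windowVar (δ h : ℝ) (w : ℤ → ℝ) (i : ℤ) : ℝ≥0∞ :=
  ∑ l ∈ Finset.range ⌈δ / h⌉₊, ‖w (i - l - 1 + 1) - w (i - l - 1)‖ₑ

lemma tsum_windowVar_le (w : ℤ → ℝ) (hδ : 0 < δ) (hh : 0 < h) :
    ENNReal.ofReal h * ∑' i, windowVar δ h w i ≤ ENNReal.ofReal (δ + h) * seqVar w := by
  unfold windowVar
  rw [Summable.tsum_finsetSum fun _ _ => ENNReal.summable]
  have : ∀ l : ℕ, ∑' i : ℤ, ‖w (i - l - 1 + 1) - w (i - l - 1)‖ₑ = seqVar w := fun l => by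
    have := tsum_int_shift (fun j => ‖w (j + 1) - w j‖ₑ) (-l - 1)
    rw [seqVar, ← this]
    refine tsum_congr fun i => ?_
    rw [show i - (l : ℤ) - 1 = i + (-l - 1) by ring]
  simp_rw [this]
  rw [Finset.sum_const, Finset.card_range, nsmul_eq_mul, ← mul_assoc]
  gcongr
  rw [← ENNReal.ofReal_natCast, ← ENNReal.ofReal_mul hh.le]
  refine ENNReal.ofReal_le_ofReal ?_
  have h1 := Nat.ceil_lt_add_one (div_nonneg hδ.le hh.le)
  have h2 := mul_lt_mul_of_pos_left h1 hh
  have e : h * (δ / h + 1) = δ + h := by field_simp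
  linarith

lemma IsSmoothStep.sum_cellKernel_mul_le (hF : IsSmoothStep C δ F f) (hh : 0 < h) {J : ℕ} {x : ℝ}
    (hx : IsCovering δ h J x) (w : ℤ → ℝ) :
    ∑ j ∈ Finset.Icc (-J : ℤ) J, ENNReal.ofReal (cellKernel F h j x) * ‖w (cellIndex h x) - w j‖ₑ
      ≤ windowVar δ h w (cellIndex h x) := by
  set i := cellIndex h x with hi
  have hδ := hF.width_pos
  have hxi := cellIndex_mem hh x
  rw [← hi] at hxi
  have hpt : ∀ j ∈ Finset.Icc (-J : ℤ) J,
      ENNReal.ofReal (cellKernel F h j x) * ‖w i - w j‖ₑ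
        ≤ ENNReal.ofReal (cellKernel F h j x) * windowVar δ h w i := fun j _ => by
    by_cases hz : cellKernel F h j x = 0
    · simp [hz]
    gcongr
    have h1 : 0 < x - ((j : ℝ) - 1 / 2) * h := by
      by_contra! hc
      refine hz ?_
      rw [cellKernel, hF.zero _ hc, hF.zero _ (by nlinarith), sub_zero]
    have h2 : x - ((j : ℝ) + 1 / 2) * h < δ := by
      by_contra! hc
      refine hz ?_
      rw [cellKernel, hF.one _ hc, hF.one _ (by nlinarith), sub_self]
    have h3 : j ≤ i := by
      have : (j : ℝ) < i + 1 := by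
        have : ((j : ℝ) - 1 / 2) * h < ((i : ℝ) + 1 / 2) * h := by linarith [hxi.2]
        have := lt_of_mul_lt_mul_right this hh.le
        linarith
      exact Int.lt_add_one_iff.1 (by exact_mod_cast this)
    have h4 : i - j ≤ ⌈δ / h⌉₊ := by
      have h5 : ((i : ℝ) - j - 1) * h < δ := by nlinarith [hxi.1]
      have h6 : (i : ℝ) - j - 1 < δ / h := (lt_div_iff₀ hh).2 h5
      have h7 : ((i - j : ℤ) : ℝ) < (⌈δ / h⌉₊ : ℝ) + 1 := by
        push_cast; linarith [Nat.le_ceil (δ / h)]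
      exact Int.lt_add_one_iff.1 (by exact_mod_cast h7)
    have h8 := enorm_sub_le_sum_range_back w i (k := (i - j).toNat) (m := ⌈δ / h⌉₊) (by omega)
    rwa [show i - ((i - j).toNat : ℤ) = j by omega] at h8
  refine (Finset.sum_le_sum hpt).trans ?_
  rw [← Finset.sum_mul, ← ENNReal.ofReal_sum_of_nonneg fun j _ => hF.cellKernel_nonneg hh j x,
    hF.sum_cellKernel hh hx]
  simp

lemma IsDiscreteEntropySolution.lintegral_osc_le (H : IsDiscreteEntropySolution V lam B u Q E)
    (hδ : 0 < δ) (hl : 0 < lam) (hh : 0 < h) {t : ℝ} (ht : 0 ≤ t) (N : ℕ) :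
    ∫⁻ x, ∑ n ∈ Finset.range N, ENNReal.ofReal (poissonWeight n (t / (lam * h)))
        * (‖gridFun u lam h t x - u n (cellIndex h x)‖ₑ + windowVar δ h (u n) (cellIndex h x))
      ≤ ENNReal.ofReal (h * (√(t / (lam * h)) + 1) + (δ + h)) * B := by
  set s := t / (lam * h) with hs
  have hs0 : 0 ≤ s := by positivity
  set m := ⌊s⌋₊ with hm
  have hms : |s - m| ≤ 1 := by
    have a1 := Nat.floor_le hs0
    have a2 := Nat.lt_floor_add_one s
    rw [abs_le]; constructor <;> linarith
  have hk : ∀ n, 0 ≤ poissonWeight n s := fun n => poissonWeight_nonneg n hs0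
  have h1 := lintegral_comp_cellIndex hh fun i => ∑ n ∈ Finset.range N,
    ENNReal.ofReal (poissonWeight n s) * (‖u m i - u n i‖ₑ + windowVar δ h (u n) i)
  have h2 : ∀ n : ℕ, ENNReal.ofReal h * ∑' i, (‖u m i - u n i‖ₑ + windowVar δ h (u n) i)
      ≤ ENNReal.ofReal h * (ENNReal.ofReal |(n : ℝ) - s| + 1) * B
        + ENNReal.ofReal (δ + h) * B := fun n => by
    rw [ENNReal.tsum_add, mul_add]
    refine add_le_add ?_ ((tsum_windowVar_le (u n) hδ hh).trans (by gcongr; exact H.var n))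
    rw [mul_assoc]
    gcongr
    refine (H.tsum_enorm_time_sub_le m n).trans ?_
    gcongr
    rw [← ENNReal.ofReal_one, ← ENNReal.ofReal_add (abs_nonneg _) zero_le_one]
    refine ENNReal.ofReal_le_ofReal ?_
    have := abs_sub_le (n : ℝ) s m
    rw [abs_sub_comm]; linarith
  have hone : ∑' n, ENNReal.ofReal (poissonWeight n s) = 1 := by
    rw [← ENNReal.ofReal_tsum_of_nonneg hk (hasSum_poissonWeight s).summable,
      (hasSum_poissonWeight s).tsum_eq, ENNReal.ofReal_one]
  calc _ = ENNReal.ofReal h * ∑' i, ∑ n ∈ Finset.range N,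
        ENNReal.ofReal (poissonWeight n s) * (‖u m i - u n i‖ₑ + windowVar δ h (u n) i) := h1
    _ = ∑ n ∈ Finset.range N, ENNReal.ofReal (poissonWeight n s)
          * (ENNReal.ofReal h * ∑' i, (‖u m i - u n i‖ₑ + windowVar δ h (u n) i)) := by
        rw [Summable.tsum_finsetSum fun _ _ => ENNReal.summable, Finset.mul_sum]
        refine Finset.sum_congr rfl fun n _ => ?_
        rw [ENNReal.tsum_mul_left]; ring
    _ ≤ ∑' n : ℕ, ENNReal.ofReal (poissonWeight n s)
          * (ENNReal.ofReal h * (ENNReal.ofReal |(n : ℝ) - s| + 1) * B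
            + ENNReal.ofReal (δ + h) * B) :=
        (Finset.sum_le_sum fun n _ => mul_le_mul_right (h2 n) _).trans (ENNReal.sum_le_tsum _)
    _ = ENNReal.ofReal h * B * ∑' n : ℕ, ENNReal.ofReal (poissonWeight n s)
          * ENNReal.ofReal |(n : ℝ) - s|
        + (ENNReal.ofReal h * B + ENNReal.ofReal (δ + h) * B)
          * ∑' n, ENNReal.ofReal (poissonWeight n s) := by
        rw [← ENNReal.tsum_mul_left, ← ENNReal.tsum_mul_left, ← ENNReal.tsum_add]
        exact tsum_congr fun n => by ring
    _ ≤ ENNReal.ofReal h * B * ENNReal.ofReal √s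
        + (ENNReal.ofReal h * B + ENNReal.ofReal (δ + h) * B) * 1 := by
        rw [hone]
        gcongr
        exact tsum_abs_sub_mul_poissonWeight_le hs0
    _ = _ := by
        have e : ENNReal.ofReal (h * (√s + 1) + (δ + h))
            = ENNReal.ofReal h * (ENNReal.ofReal √s + 1) + ENNReal.ofReal (δ + h) := by
          rw [ENNReal.ofReal_add (by positivity) (by positivity), ENNReal.ofReal_mul hh.le,
            ENNReal.ofReal_add (q := 1) (by positivity) (by positivity), ENNReal.ofReal_one]
        rw [e]
        ring

lemma lintegral_comp_sub (g : ℝ → ℝ≥0∞) (a : ℝ) : ∫⁻ x, g (x - a) = ∫⁻ x, g x :=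
  lintegral_sub_right_eq_self g a

lemma IsDiscreteEntropySolution.lintegral_schemeResidual_le
    (H : IsDiscreteEntropySolution V lam B u Q E) (hF : IsSmoothStep C δ F f) {M : ℝ} (hM : 0 ≤ M)
    (hh : 0 < h) (hC : 0 < C) (S : Finset ℤ) (n : ℕ) :
    ∫⁻ x, ‖schemeResidual M F f h S (u n) (E n) x‖ₑ
      ≤ ENNReal.ofReal (M * (C * h / δ)) * B
        + ENNReal.ofReal (C * h / δ) * ∑ j ∈ S, ENNReal.ofReal (E n j) := by
  have hδ := hF.width_pos
  have hFc := hF.contDiff.continuous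
  have hfc := hF.continuous_deriv
  have hm1 : Measurable fun z => ‖slopeError F f h z‖ₑ := by
    unfold slopeError; exact (by fun_prop : Continuous _).measurable.enorm
  have hm2 : Measurable fun z => ‖secondDiff F h z‖ₑ := by
    unfold secondDiff; exact (by fun_prop : Continuous _).measurable.enorm
  have hm1' : ∀ a, Measurable fun x => ‖slopeError F f h (x - a)‖ₑ := fun a =>
    hm1.comp (measurable_id.sub_const a)
  have hm2' : ∀ a, Measurable fun x => ‖secondDiff F h (x - a)‖ₑ := fun a =>
    hm2.comp (measurable_id.sub_const a)
  have hE0 : ∀ j, 0 ≤ E n j := fun j => (abs_nonneg _).trans (H.flux n j 0)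
  have hpt : ∀ x, ‖schemeResidual M F f h S (u n) (E n) x‖ₑ
      ≤ ∑ j ∈ S, (ENNReal.ofReal M * ‖u n j - u n (j - 1)‖ₑ
          * ‖slopeError F f h (x - ((j : ℝ) - 1 / 2) * h)‖ₑ
        + ENNReal.ofReal (E n j) * ENNReal.ofReal (1 / h)
          * ‖secondDiff F h (x - ((j : ℝ) - 1 / 2) * h)‖ₑ) := fun x => by
    refine (enorm_sum_le _ _).trans (Finset.sum_le_sum fun j _ => (enorm_add_le _ _).trans ?_)
    refine add_le_add (le_of_eq ?_) (le_of_eq ?_)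
    · rw [enorm_mul, enorm_mul, Real.enorm_of_nonneg hM, Real.enorm_abs, Real.enorm_abs]
    · rw [div_eq_mul_one_div, enorm_mul, enorm_mul, Real.enorm_of_nonneg (hE0 j), Real.enorm_abs,
        Real.enorm_of_nonneg (by positivity : 0 ≤ 1 / h)]
      ring
  refine (lintegral_mono hpt).trans ?_
  rw [lintegral_finsetSum]
  swap
  · exact fun j _ => ((hm1' _).const_mul _).add ((hm2' _).const_mul _)
  have hj : ∀ j ∈ S, ∫⁻ x, (ENNReal.ofReal M * ‖u n j - u n (j - 1)‖ₑ
          * ‖slopeError F f h (x - ((j : ℝ) - 1 / 2) * h)‖ₑ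
        + ENNReal.ofReal (E n j) * ENNReal.ofReal (1 / h)
          * ‖secondDiff F h (x - ((j : ℝ) - 1 / 2) * h)‖ₑ)
      ≤ ENNReal.ofReal (M * (C * h / δ)) * ‖u n (j - 1 + 1) - u n (j - 1)‖ₑ
        + ENNReal.ofReal (C * h / δ) * ENNReal.ofReal (E n j) := fun j _ => by
    rw [lintegral_add_left ((hm1' _).const_mul _), lintegral_const_mul _ (hm1' _),
      lintegral_const_mul _ (hm2' _),
      lintegral_comp_sub (fun z => ‖slopeError F f h z‖ₑ),
      lintegral_comp_sub (fun z => ‖secondDiff F h z‖ₑ), sub_add_cancel]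
    refine add_le_add ?_ ?_
    · calc _ ≤ ENNReal.ofReal M * ‖u n j - u n (j - 1)‖ₑ * ENNReal.ofReal (C * h / δ) := by
            gcongr; exact hF.slope_error h hh
        _ = _ := by rw [ENNReal.ofReal_mul hM]; ring
    · calc _ ≤ ENNReal.ofReal (E n j) * ENNReal.ofReal (1 / h)
            * ENNReal.ofReal (C * h ^ 2 / δ) := by gcongr; exact hF.second_diff h hh
        _ = _ := by
            rw [mul_assoc, ← ENNReal.ofReal_mul (by positivity), mul_comm]
            congr 2; field_simp
  refine (Finset.sum_le_sum hj).trans ?_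
  rw [Finset.sum_add_distrib, ← Finset.mul_sum, ← Finset.mul_sum]
  gcongr
  refine (ENNReal.sum_le_tsum _).trans ?_
  refine le_trans (le_of_eq ?_) (H.var n)
  exact tsum_int_shift (fun j => ‖u n (j + 1) - u n j‖ₑ) (-1)

end Errors


/-! ### The Kuznetsov estimate -/

section Kuznetsov

variable {V ρ₀ : ℝ → ℝ} {v : ℝ → ℝ → ℝ} {A L lam h C δ R T : ℝ} {B : ℝ≥0∞} {u : ℕ → ℤ → ℝ}
  {Q : ℕ → ℤ → ℝ → ℝ} {E : ℕ → ℤ → ℝ} {F f : ℝ → ℝ} {Ψ p : ℝ × ℝ → ℝ} {π : ℝ → ℝ}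

/-- Dominating function of the oscillation error. -/
noncomputable def oscBound (u : ℕ → ℤ → ℝ) (π : ℝ → ℝ) (lam h δ T : ℝ) (N : ℕ) (z : ℝ × ℝ) : ℝ≥0∞ :=
  (Iic T).indicator (fun t => ENNReal.ofReal (π t)) z.1
    * ∑ n ∈ Finset.range N, ENNReal.ofReal (poissonWeight n (z.1 / (lam * h)))
      * (‖gridFun u lam h z.1 z.2 - u n (cellIndex h z.2)‖ₑ + windowVar δ h (u n) (cellIndex h z.2))

lemma measurable_oscBound (hπ : Measurable π) (N : ℕ) :
    Measurable (oscBound u π lam h δ T N) := by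
  have hc : Measurable fun z : ℝ × ℝ => cellIndex h z.2 :=
    (measurable_cellIndex h).comp measurable_snd
  have hg : Measurable fun z : ℝ × ℝ => gridFun u lam h z.1 z.2 := measurable_gridFun u lam h
  refine Measurable.mul ?_ (Finset.measurable_fun_sum _ fun n _ => Measurable.mul ?_ ?_)
  · exact (hπ.ennreal_ofReal.indicator measurableSet_Iic).comp measurable_fst
  · exact (((contDiff_poissonWeight n).continuous.measurable).comp (by fun_prop)).ennreal_ofReal
  · have h1 : Measurable fun z : ℝ × ℝ => ‖gridFun u lam h z.1 z.2 - u n (cellIndex h z.2)‖ₑ :=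
      (hg.sub ((measurable_of_countable (u n)).comp hc)).enorm
    have h2 : Measurable fun z : ℝ × ℝ => windowVar δ h (u n) (cellIndex h z.2) :=
      (measurable_of_countable (windowVar δ h (u n))).comp hc
    exact h1.add h2

lemma sum_ofReal_poissonWeight_le (N : ℕ) {s : ℝ} (hs : 0 ≤ s) :
    ∑ n ∈ Finset.range N, ENNReal.ofReal (poissonWeight n s) ≤ 1 := by
  refine (ENNReal.sum_le_tsum _).trans (le_of_eq ?_)
  rw [← ENNReal.ofReal_tsum_of_nonneg (fun n => poissonWeight_nonneg n hs)
    (hasSum_poissonWeight s).summable, (hasSum_poissonWeight s).tsum_eq, ENNReal.ofReal_one]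

lemma IsDiscreteEntropySolution.lintegral_oscBound_le (H : IsDiscreteEntropySolution V lam B u Q E)
    {M : ℝ} (hΨ : IsCutoff M R T Ψ p π) (hδ : 0 < δ) (hl : 0 < lam) (hh : 0 < h) (N : ℕ) :
    ∫⁻ z, oscBound u π lam h δ T N z ∂halfPlane
      ≤ ENNReal.ofReal (h * (√(T / (lam * h)) + 1) + (δ + h)) * B := by
  refine (lintegral_halfPlane_le _).trans ?_
  set K := ENNReal.ofReal (h * (√(T / (lam * h)) + 1) + (δ + h)) * B with hK
  have hτ : 0 < lam * h := mul_pos hl hh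
  have hc := measurable_cellIndex h
  calc _ ≤ ∫⁻ t in Ioi 0, ENNReal.ofReal (π t) * K := by
        refine setLIntegral_mono (by have := hΨ.density_measurable; fun_prop) fun t ht => ?_
        unfold oscBound
        simp only
        by_cases htT : t ≤ T
        · rw [indicator_of_mem (mem_Iic.2 htT), lintegral_const_mul]
          · gcongr
            refine (H.lintegral_osc_le hδ hl hh (le_of_lt ht) N).trans ?_
            rw [hK]
            gcongr
          · refine Finset.measurable_fun_sum _ fun n _ => Measurable.const_mul ?_ _
            have h1 : Measurable fun x => ‖gridFun u lam h t x - u n (cellIndex h x)‖ₑ :=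
              ((measurable_gridFun_apply u lam h t).sub
                ((measurable_of_countable (u n)).comp hc)).enorm
            have h2 : Measurable fun x => windowVar δ h (u n) (cellIndex h x) :=
              (measurable_of_countable (windowVar δ h (u n))).comp hc
            exact h1.add h2
        · rw [indicator_of_notMem (by simpa using htT)]
          simp
    _ = (∫⁻ t in Ioi 0, ENNReal.ofReal (π t)) * K :=
        lintegral_mul_const _ hΨ.density_measurable.ennreal_ofReal
    _ ≤ 1 * K := by gcongr; exact hΨ.density_mass
    _ = K := one_mul _

/-- Comparison of a discrete entropy solution with an exact entropy solution. -/
theorem IsDiscreteEntropySolution.kuznetsov (H : IsDiscreteEntropySolution V lam B u Q E)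
    (hv : IsEntropySolution V ρ₀ v) (hρ : AEMeasurable ρ₀) (hρm : ∀ᵐ x : ℝ, ρ₀ x ∈ Icc (0 : ℝ) 1)
    (hV : IsVelocity V A L) (hF : IsSmoothStep C δ F f) (hC : 0 < C) (hl : 0 < lam) (hh : 0 < h)
    (hΨ : IsCutoff (A + L) R T Ψ p π) {J : ℕ} (hJ : R + δ + 3 * h ≤ J * h) {e : ℝ≥0∞}
    (he : ∀ n, ∑ j ∈ Finset.Icc (-J : ℤ) J, ENNReal.ofReal (E n j) ≤ e) :
    ∫⁻ z, ENNReal.ofReal (p z) * ‖v z.1 z.2 - gridFun u lam h z.1 z.2‖ₑ ∂halfPlane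
      ≤ ENNReal.ofReal T * (ENNReal.ofReal ((A + L) * (C * h / δ)) * B
          + ENNReal.ofReal (C * h / δ) * e)
        + ((∫⁻ x in Icc (-R) R, ‖ρ₀ x - u 0 (cellIndex h x)‖ₑ) + ENNReal.ofReal (δ + h) * B)
        + ENNReal.ofReal (h * (√(T / (lam * h)) + 1) + (δ + h)) * B := by
  set S := Finset.Icc (-J : ℤ) J with hS
  have hδ := hF.width_pos
  have hτ : 0 < lam * h := mul_pos hl hh
  have hM : 0 ≤ A + L := add_nonneg hV.bound_nonneg hV.lip_nonneg
  have hcov : ∀ x, |x| ≤ R → IsCovering δ h J x := fun x hx =>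
    isCovering_of_abs_le hh hJ hδ.le hx
  have hFc := hF.contDiff.continuous
  have hfc := hF.continuous_deriv
  have hA0 : ∀ j x, 0 ≤ cellKernel F h j x := fun j x => hF.cellKernel_nonneg hh j x
  have hpm : ∀ n, Measurable fun z : ℝ × ℝ => poissonWeight n (z.1 / (lam * h)) := fun n =>
    ((contDiff_poissonWeight n).continuous.measurable).comp (by fun_prop)
  have hAsum : ∀ x, |x| ≤ R → ∑ j ∈ S, ENNReal.ofReal (cellKernel F h j x) = 1 := fun x hx => by
    rw [← ENNReal.ofReal_sum_of_nonneg fun j _ => hA0 j x, hF.sum_cellKernel hh (hcov x hx),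
      ENNReal.ofReal_one]
  set Rb := ENNReal.ofReal ((A + L) * (C * h / δ)) * B + ENNReal.ofReal (C * h / δ) * e with hRb
  set I₀ := (∫⁻ x in Icc (-R) R, ‖ρ₀ x - u 0 (cellIndex h x)‖ₑ) + ENNReal.ofReal (δ + h) * B with hI₀
  set Ob := ENNReal.ofReal (h * (√(T / (lam * h)) + 1) + (δ + h)) * B with hOb
  set LO : ℝ → ℝ := fun x => ∑ j ∈ S, (A + L) * |cellKernel f h j x| with hLO
  have hLOc : Continuous LO := by simp only [hLO]; unfold cellKernel; fun_prop
  set tail : ℕ → ℝ × ℝ → ℝ≥0∞ := fun N z =>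
    ENNReal.ofReal (poissonWeight N (z.1 / (lam * h))) * ‖Ψ z * LO z.2‖ₑ with htail
  have htailm : ∀ N, Measurable (tail N) := fun N => by
    refine (hpm N).ennreal_ofReal.mul ?_
    exact (hΨ.contDiff.continuous.mul (hLOc.comp continuous_snd)).measurable.enorm
  set g : ℝ × ℝ → ℝ≥0∞ := fun z => ENNReal.ofReal (p z) * ‖v z.1 z.2 - gridFun u lam h z.1 z.2‖ₑ
    with hg
  have hgm : AEMeasurable g halfPlane := by
    refine hΨ.rate_continuous.measurable.ennreal_ofReal.aemeasurable.mul ?_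
    have h1 : AEMeasurable (fun z : ℝ × ℝ => v z.1 z.2) halfPlane :=
      hv.aestronglyMeasurable.aemeasurable
    have h2 : Measurable fun z : ℝ × ℝ => gridFun u lam h z.1 z.2 := measurable_gridFun u lam h
    exact (h1.sub h2.aemeasurable).enorm
  -- the residual terms
  have hres : ∀ N, ∫⁻ z, ‖Ψ z * (∑ n ∈ Finset.range N, poissonWeight n (z.1 / (lam * h))
          * schemeResidual (A + L) F f h S (u n) (E n) z.2
        + poissonWeight N (z.1 / (lam * h)) * LO z.2)‖ₑ ∂halfPlane
      ≤ ENNReal.ofReal T * Rb + ∫⁻ z, tail N z ∂halfPlane := fun N => by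
    have hpt : ∀ᵐ z ∂halfPlane, ‖Ψ z * (∑ n ∈ Finset.range N, poissonWeight n (z.1 / (lam * h))
          * schemeResidual (A + L) F f h S (u n) (E n) z.2
        + poissonWeight N (z.1 / (lam * h)) * LO z.2)‖ₑ
        ≤ (Iic T).indicator 1 z.1 * ∑ n ∈ Finset.range N,
          ENNReal.ofReal (poissonWeight n (z.1 / (lam * h)))
          * ‖schemeResidual (A + L) F f h S (u n) (E n) z.2‖ₑ + tail N z := by
      filter_upwards [ae_halfPlane_pos] with z hz
      obtain ⟨t, x⟩ := z
      simp only at hz ⊢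
      rw [mul_add]
      refine (enorm_add_le _ _).trans (add_le_add ?_ (le_of_eq ?_))
      · rw [enorm_mul]
        refine mul_le_mul' ?_ ?_
        · by_cases htT : t ≤ T
          · rw [indicator_of_mem (mem_Iic.2 htT), Real.enorm_of_nonneg (hΨ.nonneg t hz.le x)]
            exact ENNReal.ofReal_le_one.2 (hΨ.le_one t hz.le x)
          · rw [hΨ.support t hz.le x (fun hc => htT hc.1)]; simp
        · refine (enorm_sum_le _ _).trans (Finset.sum_le_sum fun n _ => le_of_eq ?_)
          rw [enorm_mul, Real.enorm_of_nonneg (poissonWeight_nonneg n (by positivity))]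
      · simp only [htail]
        rw [enorm_mul, enorm_mul, enorm_mul,
          Real.enorm_of_nonneg (poissonWeight_nonneg N (by positivity))]
        ring
    refine (lintegral_mono_ae hpt).trans ?_
    rw [lintegral_add_right _ (htailm N)]
    refine add_le_add ((lintegral_halfPlane_le _).trans ?_) le_rfl
    calc _ ≤ ∫⁻ t in Ioi 0, (Iic T).indicator (fun _ => Rb) t := by
          refine setLIntegral_mono (measurable_const.indicator measurableSet_Iic) fun t ht => ?_
          by_cases htT : t ≤ T
          · simp only [indicator_of_mem (mem_Iic.2 htT), Pi.one_apply, one_mul]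
            have hs : 0 ≤ t / (lam * h) := div_nonneg (le_of_lt ht) hτ.le
            rw [lintegral_finsetSum]
            swap
            · exact fun n _ => ((hF.continuous_schemeResidual _ _ _ _ _).measurable.enorm).const_mul _
            calc _ ≤ ∑ n ∈ Finset.range N, ENNReal.ofReal (poissonWeight n (t / (lam * h))) * Rb := by
                  refine Finset.sum_le_sum fun n _ => ?_
                  rw [lintegral_const_mul _
                    (hF.continuous_schemeResidual _ _ _ _ _).measurable.enorm]
                  gcongr
                  refine (H.lintegral_schemeResidual_le hF hM hh hC S n).trans ?_
                  rw [hRb]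
                  gcongr
                  exact he n
              _ ≤ 1 * Rb := by
                  rw [← Finset.sum_mul]; gcongr; exact sum_ofReal_poissonWeight_le N hs
              _ = Rb := one_mul _
          · simp [htT]
      _ = ENNReal.ofReal T * Rb := by
          rw [setLIntegral_indicator measurableSet_Iic, setLIntegral_const, mul_comm]
          congr 1
          rw [inter_comm, Ioi_inter_Iic, Real.volume_Ioc, sub_zero]
  -- the initial term
  have hinit : ∫⁻ x, ‖Ψ (0, x) * ∑ j ∈ S, cellKernel F h j x * |ρ₀ x - u 0 j|‖ₑ ≤ I₀ := by
    have hpt : ∀ x, ‖Ψ (0, x) * ∑ j ∈ S, cellKernel F h j x * |ρ₀ x - u 0 j|‖ₑ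
        ≤ (Icc (-R) R).indicator (fun x => ‖ρ₀ x - u 0 (cellIndex h x)‖ₑ) x
          + windowVar δ h (u 0) (cellIndex h x) := fun x => by
      by_cases hin : (0 : ℝ) ≤ T ∧ |x| ≤ R
      · rw [indicator_of_mem (show x ∈ Icc (-R) R from abs_le.1 hin.2), enorm_mul,
          Real.enorm_of_nonneg (hΨ.nonneg 0 le_rfl x)]
        calc _ ≤ 1 * ∑ j ∈ S, ENNReal.ofReal (cellKernel F h j x)
              * (‖ρ₀ x - u 0 (cellIndex h x)‖ₑ + ‖u 0 (cellIndex h x) - u 0 j‖ₑ) := by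
              gcongr
              · exact ENNReal.ofReal_le_one.2 (hΨ.le_one 0 le_rfl x)
              · refine (enorm_sum_le _ _).trans (Finset.sum_le_sum fun j _ => ?_)
                rw [enorm_mul, Real.enorm_of_nonneg (hA0 j x), Real.enorm_abs]
                gcongr
                rw [← sub_add_sub_cancel _ (u 0 (cellIndex h x)) _]
                exact enorm_add_le _ _
          _ = (∑ j ∈ S, ENNReal.ofReal (cellKernel F h j x)) * ‖ρ₀ x - u 0 (cellIndex h x)‖ₑ
              + ∑ j ∈ S, ENNReal.ofReal (cellKernel F h j x) * ‖u 0 (cellIndex h x) - u 0 j‖ₑ := by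
              rw [one_mul, Finset.sum_mul, ← Finset.sum_add_distrib]
              exact Finset.sum_congr rfl fun j _ => mul_add _ _ _
          _ ≤ _ := by
              rw [hAsum x hin.2, one_mul]
              gcongr
              exact hF.sum_cellKernel_mul_le hh (hcov x hin.2) (u 0)
      · rw [hΨ.support 0 le_rfl x hin]; simp
    refine (lintegral_mono hpt).trans ?_
    have hwm : Measurable fun x => windowVar δ h (u 0) (cellIndex h x) :=
      (measurable_of_countable (windowVar δ h (u 0))).comp (measurable_cellIndex h)
    rw [lintegral_add_right _ hwm,
      lintegral_indicator measurableSet_Icc, lintegral_comp_cellIndex hh]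
    rw [hI₀]
    refine add_le_add le_rfl ?_
    refine (tsum_windowVar_le (u 0) hδ hh).trans ?_
    gcongr
    exact H.var 0
  -- the main inequality for finitely many time steps
  have hmain : ∀ N, ∫⁻ z, g z * ∑ n ∈ Finset.range (N + 1),
        ENNReal.ofReal (poissonWeight n (z.1 / (lam * h))) ∂halfPlane
      ≤ ENNReal.ofReal T * Rb + I₀ + Ob + ∫⁻ z, tail N z ∂halfPlane := fun N => by
    have hpt : ∀ᵐ z ∂halfPlane, g z * ∑ n ∈ Finset.range (N + 1),
          ENNReal.ofReal (poissonWeight n (z.1 / (lam * h)))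
        ≤ ENNReal.ofReal (p z * ∑ n ∈ Finset.range (N + 1), ∑ j ∈ S,
          poissonWeight n (z.1 / (lam * h)) * cellKernel F h j z.2 * |v z.1 z.2 - u n j|)
          + oscBound u π lam h δ T (N + 1) z := by
      filter_upwards [ae_halfPlane_pos] with z hz
      obtain ⟨t, x⟩ := z
      simp only at hz ⊢
      by_cases hin : t ≤ T ∧ |x| ≤ R
      · have hs : 0 ≤ t / (lam * h) := by positivity
        have hk : ∀ n, 0 ≤ poissonWeight n (t / (lam * h)) := fun n => poissonWeight_nonneg n hs
        have hp0 := hΨ.rate_nonneg t hz.le x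
        set w := gridFun u lam h t x with hw
        set i := cellIndex h x with hi
        have e1 : ENNReal.ofReal (p (t, x) * ∑ n ∈ Finset.range (N + 1), ∑ j ∈ S,
            poissonWeight n (t / (lam * h)) * cellKernel F h j x * |v t x - u n j|)
            = ENNReal.ofReal (p (t, x)) * ∑ n ∈ Finset.range (N + 1),
              ENNReal.ofReal (poissonWeight n (t / (lam * h)))
              * ∑ j ∈ S, ENNReal.ofReal (cellKernel F h j x) * ‖v t x - u n j‖ₑ := by
          rw [ENNReal.ofReal_mul hp0, ENNReal.ofReal_sum_of_nonneg fun n _ => Finset.sum_nonneg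
            fun j _ => mul_nonneg (mul_nonneg (hk n) (hA0 j x)) (abs_nonneg _)]
          congr 1
          refine Finset.sum_congr rfl fun n _ => ?_
          rw [ENNReal.ofReal_sum_of_nonneg
            fun j _ => mul_nonneg (mul_nonneg (hk n) (hA0 j x)) (abs_nonneg _), Finset.mul_sum]
          refine Finset.sum_congr rfl fun j _ => ?_
          rw [ENNReal.ofReal_mul (mul_nonneg (hk n) (hA0 j x)), ENNReal.ofReal_mul (hk n),
            Real.enorm_eq_ofReal_abs, mul_assoc]
        have e2 : ENNReal.ofReal (p (t, x)) * ∑ n ∈ Finset.range (N + 1),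
              ENNReal.ofReal (poissonWeight n (t / (lam * h)))
              * (‖w - u n i‖ₑ + windowVar δ h (u n) i) ≤ oscBound u π lam h δ T (N + 1) (t, x) := by
          unfold oscBound
          rw [indicator_of_mem (mem_Iic.2 hin.1)]
          gcongr
          exact hΨ.rate_le t hz.le x
        rw [e1]
        refine le_trans ?_ (add_le_add_right e2 _)
        simp only [hg]
        rw [mul_assoc, ← mul_add, ← Finset.sum_add_distrib, Finset.mul_sum]
        refine mul_le_mul_right (Finset.sum_le_sum fun n _ => ?_) _
        rw [← mul_add, mul_comm]
        refine mul_le_mul_right ?_ _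
        calc ‖v t x - w‖ₑ = ∑ j ∈ S, ENNReal.ofReal (cellKernel F h j x) * ‖v t x - w‖ₑ := by
              rw [← Finset.sum_mul, hAsum x hin.2, one_mul]
          _ ≤ ∑ j ∈ S, ENNReal.ofReal (cellKernel F h j x)
              * (‖v t x - u n j‖ₑ + (‖w - u n i‖ₑ + ‖u n i - u n j‖ₑ)) := by
              refine Finset.sum_le_sum fun j _ => mul_le_mul_right ?_ _
              have : v t x - w = (v t x - u n j) - ((w - u n i) + (u n i - u n j)) := by ring
              rw [this]
              exact (enorm_sub_le).trans (add_le_add le_rfl (enorm_add_le _ _))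
          _ = ∑ j ∈ S, ENNReal.ofReal (cellKernel F h j x) * ‖v t x - u n j‖ₑ
              + ((∑ j ∈ S, ENNReal.ofReal (cellKernel F h j x)) * ‖w - u n i‖ₑ
                + ∑ j ∈ S, ENNReal.ofReal (cellKernel F h j x) * ‖u n i - u n j‖ₑ) := by
              rw [Finset.sum_mul, ← Finset.sum_add_distrib, ← Finset.sum_add_distrib]
              exact Finset.sum_congr rfl fun j _ => by ring
          _ ≤ _ := by
              rw [hAsum x hin.2, one_mul]
              gcongr
              exact hF.sum_cellKernel_mul_le hh (hcov x hin.2) (u n)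
      · simp only [hg]
        rw [hΨ.rate_support t hz.le x hin]; simp
    refine (lintegral_mono_ae hpt).trans ?_
    rw [lintegral_add_right _ (measurable_oscBound hΨ.density_measurable _)]
    calc _ ≤ (ENNReal.ofReal T * Rb + ∫⁻ z, tail N z ∂halfPlane + I₀) + Ob := by
          refine add_le_add ?_ (H.lintegral_oscBound_le hΨ hδ hl hh _)
          exact (H.doubling_integral_le hv hρ hρm hV hF hl hh hΨ hJ N).trans
            (add_le_add (hres N) hinit)
      _ = _ := by ring
  -- passage to the limit
  have hlim1 : Tendsto (fun N => ∫⁻ z, g z * ∑ n ∈ Finset.range (N + 1),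
        ENNReal.ofReal (poissonWeight n (z.1 / (lam * h))) ∂halfPlane) atTop
      (𝓝 (∫⁻ z, g z ∂halfPlane)) := by
    refine lintegral_tendsto_of_tendsto_of_monotone (fun N => ?_) (ae_of_all _ fun z N N' hNN => ?_)
      ?_
    · exact hgm.mul (Finset.measurable_fun_sum _ fun n _ => (hpm n).ennreal_ofReal).aemeasurable
    · exact mul_le_mul_right (Finset.sum_le_sum_of_subset (Finset.range_mono (by omega))) _
    · filter_upwards [ae_halfPlane_pos] with z hz
      have hs : 0 ≤ z.1 / (lam * h) := by positivity
      have h1 : Tendsto (fun N => ∑ n ∈ Finset.range N,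
          ENNReal.ofReal (poissonWeight n (z.1 / (lam * h)))) atTop (𝓝 1) := by
        have := (ENNReal.summable (f := fun n =>
          ENNReal.ofReal (poissonWeight n (z.1 / (lam * h))))).hasSum.tendsto_sum_nat
        rwa [← ENNReal.ofReal_tsum_of_nonneg (fun n => poissonWeight_nonneg n hs)
          (hasSum_poissonWeight _).summable, (hasSum_poissonWeight _).tsum_eq,
          ENNReal.ofReal_one] at this
      have h2 := ENNReal.Tendsto.const_mul (a := g z) (h1.comp (tendsto_add_atTop_nat 1))
        (Or.inl one_ne_zero)
      simpa using h2
  have hlim2 : Tendsto (fun N => ∫⁻ z, tail N z ∂halfPlane) atTop (𝓝 0) := by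
    have hint : Integrable (fun z : ℝ × ℝ => Ψ z * LO z.2) halfPlane :=
      (hΨ.contDiff.continuous.mul (hLOc.comp continuous_snd)).integrable_of_hasCompactSupport
        hΨ.compact.mul_right
    have := tendsto_lintegral_of_dominated_convergence (μ := halfPlane) (F := tail)
      (f := fun _ => 0) (fun z => ‖Ψ z * LO z.2‖ₑ) htailm ?_ hint.2.ne ?_
    · simpa using this
    · intro N
      filter_upwards [ae_halfPlane_pos] with z hz
      have hs : 0 ≤ z.1 / (lam * h) := by positivity
      simp only [htail]
      refine mul_le_of_le_one_left' (ENNReal.ofReal_le_one.2 ?_)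
      exact le_hasSum (hasSum_poissonWeight _) N fun n _ => poissonWeight_nonneg n hs
    · refine ae_of_all _ fun z => ?_
      have h1 : Tendsto (fun N => ENNReal.ofReal (poissonWeight N (z.1 / (lam * h)))) atTop (𝓝 0) := by
        rw [← ENNReal.ofReal_zero]
        exact (ENNReal.continuous_ofReal.tendsto 0).comp
          (hasSum_poissonWeight (z.1 / (lam * h))).summable.tendsto_atTop_zero
      have h2 := ENNReal.Tendsto.mul_const (b := ‖Ψ z * LO z.2‖ₑ) h1 (Or.inr enorm_ne_top)
      simp only [zero_mul] at h2
      exact h2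
  have hfin := le_of_tendsto_of_tendsto' hlim1 (hlim2.const_add (ENNReal.ofReal T * Rb + I₀ + Ob))
    hmain
  rwa [add_zero] at hfin

end Kuznetsov


/-! ### Cutoff functions -/

/-- A smooth approximation of the indicator of the cone `|x| ≤ R - M t`, truncated at negative
times. -/
noncomputable def coneBump (M R : ℝ) (z : ℝ × ℝ) : ℝ :=
  Real.smoothTransition (z.1 + 1)
    * (Real.smoothTransition (R - z.2 - M * z.1) * Real.smoothTransition (R + z.2 - M * z.1))

section Cutoff

variable {M R T : ℝ}

lemma contDiff_coneBump (M R : ℝ) : ContDiff ℝ 1 (coneBump M R) := by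
  have hs : ContDiff ℝ 1 Real.smoothTransition := Real.smoothTransition.contDiff (n := 1)
  unfold coneBump
  exact (hs.comp (contDiff_fst.add contDiff_const)).mul
    ((hs.comp ((contDiff_const.sub contDiff_snd).sub (contDiff_const.mul contDiff_fst))).mul
      (hs.comp ((contDiff_const.add contDiff_snd).sub (contDiff_const.mul contDiff_fst))))

lemma coneBump_nonneg (z : ℝ × ℝ) : 0 ≤ coneBump M R z :=
  mul_nonneg (Real.smoothTransition.nonneg _)
    (mul_nonneg (Real.smoothTransition.nonneg _) (Real.smoothTransition.nonneg _))

lemma coneBump_le_one (z : ℝ × ℝ) : coneBump M R z ≤ 1 :=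
  mul_le_one₀ (Real.smoothTransition.le_one _)
    (mul_nonneg (Real.smoothTransition.nonneg _) (Real.smoothTransition.nonneg _))
    (mul_le_one₀ (Real.smoothTransition.le_one _) (Real.smoothTransition.nonneg _)
      (Real.smoothTransition.le_one _))

lemma coneBump_eq_zero {t x : ℝ} (hx : R - M * t < |x|) : coneBump M R (t, x) = 0 := by
  unfold coneBump
  rcases lt_abs.1 hx with h | h
  · rw [Real.smoothTransition.zero_of_nonpos (x := R - x - M * t) (by linarith)]; simp
  · rw [Real.smoothTransition.zero_of_nonpos (x := R + x - M * t) (by linarith)]; simp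

lemma coneBump_eq_one {t x : ℝ} (ht : 0 ≤ t) (hx : |x| ≤ R - 1 - M * t) :
    coneBump M R (t, x) = 1 := by
  have := abs_le.1 hx
  unfold coneBump
  rw [Real.smoothTransition.one_of_one_le (x := t + 1) (by linarith),
    Real.smoothTransition.one_of_one_le (x := R - x - M * t) (by linarith),
    Real.smoothTransition.one_of_one_le (x := R + x - M * t) (by linarith)]
  norm_num

lemma hasCompactSupport_mul_coneBump (hM : 0 ≤ M) {g : ℝ → ℝ} (hg : ∀ t ≥ T, g t = 0) :
    HasCompactSupport fun z : ℝ × ℝ => g z.1 * coneBump M R z := by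
  refine HasCompactSupport.intro
    (isCompact_Icc.prod isCompact_Icc : IsCompact (Icc (-1) T ×ˢ Icc (-(R + M)) (R + M)))
    fun z hz => ?_
  obtain ⟨t, x⟩ := z
  rw [mem_prod, not_and_or] at hz
  simp only at hz ⊢
  by_cases h1 : T ≤ t
  · rw [hg t h1, zero_mul]
  by_cases h2 : t ≤ -1
  · unfold coneBump
    rw [Real.smoothTransition.zero_of_nonpos (x := t + 1) (by linarith)]; simp
  push Not at h1 h2
  have hx : R + M < |x| := by
    rcases hz with hz | hz
    · exact absurd ⟨h2.le, h1.le⟩ hz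
    · by_contra hc
      exact hz (abs_le.1 (not_lt.1 hc))
  rw [coneBump_eq_zero (lt_of_le_of_lt (by nlinarith) hx), mul_zero]

lemma isCutoff_of_profile {ψ π : ℝ → ℝ} (hM : 0 ≤ M) (hT : 0 ≤ T) (hψ : ContDiff ℝ 1 ψ)
    (hd : ∀ t, HasDerivAt ψ (-π t) t) (hπ : Continuous π) (hπ0 : ∀ t, 0 ≤ π t)
    (hψ0 : ∀ t, 0 ≤ ψ t) (hψ1 : ∀ t ≥ 0, ψ t ≤ 1) (hψT : ∀ t ≥ T, ψ t = 0)
    (hπT : ∀ t ≥ T, π t = 0) :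
    IsCutoff M R T (fun z => ψ z.1 * coneBump M R z) (fun z => π z.1 * coneBump M R z) π := by
  have hb := contDiff_coneBump M R
  have hsupp : ∀ t ≥ 0, ∀ x, ¬(t ≤ T ∧ |x| ≤ R) → t ≥ T ∨ coneBump M R (t, x) = 0 :=
    fun t ht x hn => by
      by_cases h1 : t ≤ T
      · refine Or.inr (coneBump_eq_zero ?_)
        have : R < |x| := by
          by_contra hc; exact hn ⟨h1, not_lt.1 hc⟩
        nlinarith [mul_nonneg hM ht]
      · exact Or.inl (not_le.1 h1).le
  have hcd : ContDiff ℝ 1 fun z : ℝ × ℝ => ψ z.1 * coneBump M R z := (hψ.comp contDiff_fst).mul hb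
  refine ⟨hcd, hasCompactSupport_mul_coneBump hM hψT,
    fun t _ x => mul_nonneg (hψ0 t) (coneBump_nonneg _),
    fun t ht x => mul_le_one₀ (hψ1 t ht) (coneBump_nonneg _) (coneBump_le_one _),
    fun t ht x hn => ?_, fun t ht x => ?_, (hπ.comp continuous_fst).mul hb.continuous,
    hasCompactSupport_mul_coneBump hM hπT, fun t _ x => mul_nonneg (hπ0 t) (coneBump_nonneg _),
    fun t _ x => mul_le_of_le_one_right (hπ0 t) (coneBump_le_one _), fun t ht x hn => ?_,
    hπ.measurable, ?_⟩
  · rcases hsupp t ht x hn with h | h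
    · simp [hψT t h]
    · simp [h]
  · set s := Real.smoothTransition with hs
    have hsd : ∀ y, HasDerivAt s (deriv s y) y := fun y =>
      ((Real.smoothTransition.contDiff (n := 1)).differentiable (by norm_num) y).hasDerivAt
    have hs' : ∀ y, 0 ≤ deriv s y := fun y => Real.smoothTransition.monotone.deriv_nonneg
    have hs0 : ∀ y, 0 ≤ s y := Real.smoothTransition.nonneg
    have hone : s (t + 1) = 1 := Real.smoothTransition.one_of_one_le (by linarith)
    set a := R - x - M * t with ha
    set b := R + x - M * t with hb'
    have ht' : HasDerivAt (fun y => ψ y * coneBump M R (y, x))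
        (-π t * coneBump M R (t, x) + ψ t * (0 * (s a * s b)
          + s (t + 1) * ((deriv s a * (-M)) * s b + s a * (deriv s b * (-M))))) t := by
      have d0 : HasDerivAt (fun y => s (y + 1)) 0 t := by
        have : (fun y => s (y + 1)) =ᶠ[𝓝 t] fun _ => 1 :=
          (eventually_gt_nhds ht).mono fun y hy =>
            Real.smoothTransition.one_of_one_le (by linarith)
        exact (hasDerivAt_const t (1 : ℝ)).congr_of_eventuallyEq this
      have hl : ∀ q, HasDerivAt (fun y => q - M * y) (-M) t := fun q => by
        simpa using ((hasDerivAt_id t).const_mul M).const_sub q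
      have d1 : HasDerivAt (fun y => s (R - x - M * y)) (deriv s a * (-M)) t :=
        HasDerivAt.comp (h₂ := s) t (hsd a) (hl (R - x))
      have d2 : HasDerivAt (fun y => s (R + x - M * y)) (deriv s b * (-M)) t :=
        HasDerivAt.comp (h₂ := s) t (hsd b) (hl (R + x))
      exact (hd t).mul (d0.mul (d1.mul d2))
    have hx' : HasDerivAt (fun y => ψ t * coneBump M R (t, y))
        (ψ t * (s (t + 1) * ((deriv s a * (-1)) * s b + s a * (deriv s b * 1)))) x := by
      have d1 : HasDerivAt (fun y => s (R - y - M * t)) (deriv s a * (-1)) x :=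
        HasDerivAt.comp (h₂ := s) x (hsd a) (((hasDerivAt_id x).const_sub R).sub_const (M * t))
      have d2 : HasDerivAt (fun y => s (R + y - M * t)) (deriv s b * 1) x :=
        HasDerivAt.comp (h₂ := s) x (hsd b) (((hasDerivAt_id x).const_add R).sub_const (M * t))
      exact ((d1.mul d2).const_mul (s (t + 1))).const_mul (ψ t)
    rw [fderiv_apply_fst (hcd.differentiable one_ne_zero _) ht',
      fderiv_apply_snd (hcd.differentiable one_ne_zero _) hx', hone]
    have h1 : 0 ≤ deriv s a * s b := mul_nonneg (hs' a) (hs0 b)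
    have h2 : 0 ≤ s a * deriv s b := mul_nonneg (hs0 a) (hs' b)
    have h3 : |ψ t * (1 * ((deriv s a * (-1)) * s b + s a * (deriv s b * 1)))|
        ≤ ψ t * (deriv s a * s b + s a * deriv s b) := by
      rw [abs_mul, abs_of_nonneg (hψ0 t)]
      refine mul_le_mul_of_nonneg_left ?_ (hψ0 t)
      rw [abs_le]; constructor <;> linarith
    have h4 := mul_le_mul_of_nonneg_left h3 hM
    linarith
  · rcases hsupp t ht x hn with h | h
    · simp [hπT t h]
    · simp [h]
  · have h1 : ∫⁻ t in Ioi 0, ENNReal.ofReal (π t) = ∫⁻ t in Ioc 0 T, ENNReal.ofReal (π t) := by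
      rw [← Ioc_union_Ioi_eq_Ioi hT, lintegral_union measurableSet_Ioi
        (Ioc_disjoint_Ioi le_rfl)]
      rw [setLIntegral_congr_fun (g := fun _ => 0) measurableSet_Ioi
        (fun t ht => by simp [hπT t (le_of_lt ht)])]
      simp
    have h2 : ∫ t in (0 : ℝ)..T, -π t = ψ T - ψ 0 :=
      intervalIntegral.integral_eq_sub_of_hasDerivAt (fun t _ => hd t)
        (hπ.neg.intervalIntegrable _ _)
    rw [intervalIntegral.integral_neg, hψT T le_rfl, intervalIntegral.integral_of_le hT] at h2
    rw [h1, ← ofReal_integral_eq_lintegral_ofReal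
      ((hπ.integrableOn_Icc).mono_set Ioc_subset_Icc_self) (ae_of_all _ hπ0)]
    refine ENNReal.ofReal_le_one.2 ?_
    linarith [hψ1 0 le_rfl]

/-- Cutoff functions whose rate of decrease is positive on the interior of a cone. -/
lemma exists_isCutoff_quadratic (hM : 0 ≤ M) (hT : 0 < T) :
    ∃ Ψ p π, IsCutoff M R T Ψ p π ∧
      ∀ t ∈ Ioo 0 T, ∀ x, |x| ≤ R - 1 - M * t → 0 < p (t, x) := by
  set ψ : ℝ → ℝ := fun t => (max 0 (T - t) / T) ^ 2 with hψ
  set π : ℝ → ℝ := fun t => 2 * max 0 (T - t) / T ^ 2 with hπ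
  have hπc : Continuous π := by simp only [hπ]; fun_prop
  have hd : ∀ t, HasDerivAt ψ (-π t) t := fun t => by
    have h0 : HasDerivAt (fun y : ℝ => (max 0 y) ^ 2) (2 * max 0 (T - t)) (T - t) := by
      rcases lt_trichotomy (T - t) 0 with h | h | h
      · rw [max_eq_left h.le, mul_zero]
        refine (hasDerivAt_const _ (0 : ℝ)).congr_of_eventuallyEq ?_
        filter_upwards [eventually_lt_nhds h] with y hy
        rw [max_eq_left (le_of_lt hy)]; norm_num
      · rw [h, max_self, mul_zero]
        rw [hasDerivAt_iff_isLittleO_nhds_zero]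
        simp only [zero_add, max_self]
        have : (fun y : ℝ => y ^ 2) =o[𝓝 0] fun y : ℝ => y := by
          simpa using (Asymptotics.isLittleO_pow_id (𝕜 := ℝ) (n := 2) (by norm_num))
        refine Asymptotics.IsBigO.trans_isLittleO (Asymptotics.IsBigO.of_bound 1 ?_) this
        refine Eventually.of_forall fun y => ?_
        simp only [ne_eq, OfNat.ofNat_ne_zero, not_false_eq_true, zero_pow, sub_zero, smul_zero,
          norm_pow, one_mul, Real.norm_eq_abs, sq_abs]
        rcases le_total 0 y with hy | hy
        · rw [max_eq_right hy]
        · rw [max_eq_left hy]; norm_num; positivity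
      · rw [max_eq_right h.le]
        have := hasDerivAt_pow 2 (T - t)
        refine (this.congr_deriv (by norm_num)).congr_of_eventuallyEq ?_
        filter_upwards [eventually_gt_nhds h] with y hy
        rw [max_eq_right (le_of_lt hy)]
    have h1 := (h0.comp t ((hasDerivAt_id t).const_sub T)).div_const (T ^ 2)
    have e1 : ψ = fun y => (max 0 (T - y)) ^ 2 / T ^ 2 := by ext y; simp only [hψ, div_pow]
    rw [e1]
    refine h1.congr_deriv ?_
    simp only [hπ]; ring
  have hcd : ContDiff ℝ 1 ψ := by
    rw [contDiff_one_iff_deriv]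
    refine ⟨fun t => (hd t).differentiableAt, ?_⟩
    rw [show deriv ψ = fun t => -π t from funext fun t => (hd t).deriv]
    exact hπc.neg
  refine ⟨_, _, π, isCutoff_of_profile (R := R) hM hT.le hcd hd hπc (fun t => by positivity)
    (fun t => by positivity) (fun t ht => ?_) (fun t ht => ?_) (fun t ht => ?_), fun t ht x hx => ?_⟩
  · refine pow_le_one₀ (by positivity) ((div_le_one hT).2 (max_le hT.le (by linarith)))
  · simp only [hψ]; rw [max_eq_left (by linarith)]; simp
  · simp only [hπ]; rw [max_eq_left (by linarith)]; simp
  · simp only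
    rw [coneBump_eq_one ht.1.le hx, mul_one]
    have : 0 < max 0 (T - t) := lt_max_of_lt_right (by linarith [ht.2])
    simp only [hπ]; positivity

/-- Cutoff functions whose rate of decrease has mass one on a short time interval. -/
lemma exists_isCutoff_concentrated (hM : 0 ≤ M) (hT : 0 ≤ T) {κ : ℝ} (hκ : 0 < κ) :
    ∃ Ψ p π, IsCutoff M R (T + κ) Ψ p π ∧
      (∀ t ∈ Ioc T (T + κ), ∀ x, |x| ≤ R - 1 - M * (T + κ) → p (t, x) = π t) ∧
      ∫⁻ t in Ioc T (T + κ), ENNReal.ofReal (π t) = 1 := by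
  set s := Real.smoothTransition with hs
  have hcs : ContDiff ℝ 1 s := Real.smoothTransition.contDiff (n := 1)
  have hsd : ∀ y, HasDerivAt s (deriv s y) y := fun y =>
    (hcs.differentiable one_ne_zero y).hasDerivAt
  set ψ : ℝ → ℝ := fun t => s ((T + κ - t) / κ) with hψ
  set π : ℝ → ℝ := fun t => deriv s ((T + κ - t) / κ) / κ with hπ
  have hdc : Continuous (deriv s) := hcs.continuous_deriv le_rfl
  have hπc : Continuous π := by simp only [hπ]; fun_prop
  have hd : ∀ t, HasDerivAt ψ (-π t) t := fun t => by
    have h1 := (hsd ((T + κ - t) / κ)).comp t (((hasDerivAt_id t).const_sub (T + κ)).div_const κ)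
    refine h1.congr_deriv ?_
    simp only [hπ]; ring
  have hcd : ContDiff ℝ 1 ψ := hcs.comp ((contDiff_const.sub contDiff_id).div_const κ)
  have hπ0 : ∀ t, 0 ≤ π t := fun t =>
    div_nonneg (Real.smoothTransition.monotone.deriv_nonneg) hκ.le
  have hψT : ∀ t ≥ T + κ, ψ t = 0 := fun t ht =>
    Real.smoothTransition.zero_of_nonpos (div_nonpos_of_nonpos_of_nonneg (by linarith) hκ.le)
  have hπT : ∀ t ≥ T + κ, π t = 0 := fun t ht => by
    have hmin : IsLocalMin s ((T + κ - t) / κ) := Eventually.of_forall fun y => by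
      rw [hs, Real.smoothTransition.zero_of_nonpos
        (div_nonpos_of_nonpos_of_nonneg (by linarith : T + κ - t ≤ 0) hκ.le)]
      exact Real.smoothTransition.nonneg y
    simp only [hπ]
    rw [hmin.deriv_eq_zero, zero_div]
  refine ⟨_, _, π, isCutoff_of_profile (R := R) hM (by linarith) hcd hd hπc hπ0
    (fun t => Real.smoothTransition.nonneg _) (fun t _ => Real.smoothTransition.le_one _) hψT hπT,
    fun t ht x hx => ?_, ?_⟩
  · simp only
    rw [coneBump_eq_one (by linarith [ht.1]) (hx.trans ?_), mul_one]
    have := mul_le_mul_of_nonneg_left ht.2 hM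
    linarith
  · have h2 : ∫ t in T..(T + κ), -π t = ψ (T + κ) - ψ T :=
      intervalIntegral.integral_eq_sub_of_hasDerivAt (fun t _ => hd t)
        (hπc.neg.intervalIntegrable _ _)
    have h3 : ψ T = 1 := Real.smoothTransition.one_of_one_le (by
      rw [add_sub_cancel_left, div_self hκ.ne'])
    rw [intervalIntegral.integral_neg, hψT _ le_rfl, h3,
      intervalIntegral.integral_of_le (by linarith)] at h2
    rw [← ofReal_integral_eq_lintegral_ofReal
      ((hπc.integrableOn_Icc).mono_set Ioc_subset_Icc_self) (ae_of_all _ hπ0)]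
    rw [show ∫ t in Ioc T (T + κ), π t = 1 by linarith, ENNReal.ofReal_one]

end Cutoff

/-! ### Comparison of the scheme with an entropy solution -/

section Spread

variable {w : ℕ → ℝ} {r : ℤ → ℝ} {h : ℝ} {B s : ℝ≥0∞}

lemma abs_sub_le_one_of_mem {a b : ℝ} (ha : a ∈ Icc (0 : ℝ) 1) (hb : b ∈ Icc (0 : ℝ) 1) :
    |a - b| ≤ 1 := by
  rw [abs_le]; constructor <;> linarith [ha.1, ha.2, hb.1, hb.2]

lemma IsWeight.summable_spread (hw : IsWeight w) (hr : ∀ j, r j ∈ Icc (0 : ℝ) 1) (j : ℤ) :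
    Summable fun k : ℕ => w k * |r (j + k) - r j| :=
  hw.summable_mul (C := 1) fun k => by
    rw [abs_abs]; exact abs_sub_le_one_of_mem (hr _) (hr _)

lemma IsWeight.ofReal_spread (hw : IsWeight w) (hr : ∀ j, r j ∈ Icc (0 : ℝ) 1) (j : ℤ) :
    ENNReal.ofReal (spread w r j) = ∑' k : ℕ, ENNReal.ofReal (w k) * ‖r (j + k) - r j‖ₑ := by
  unfold spread
  rw [ENNReal.ofReal_tsum_of_nonneg (fun k => mul_nonneg (hw.nonneg k) (abs_nonneg _))
    (hw.summable_spread hr j)]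
  refine tsum_congr fun k => ?_
  rw [ENNReal.ofReal_mul (hw.nonneg k), Real.enorm_eq_ofReal_abs]

lemma IsWeight.abs_impact_sub_le (hw : IsWeight w) (hr : ∀ j, r j ∈ Icc (0 : ℝ) 1) (j : ℤ) :
    |nonlocalImpact w r j - r j| ≤ spread w r j := by
  have h1 : Summable fun k : ℕ => w k * r (j + k) := hw.summable_mul (C := 1) fun k => by
    rw [abs_of_nonneg (hr _).1]; exact (hr _).2
  have h2 : Summable fun k : ℕ => w k * r j := hw.hasSum.summable.mul_right _
  have h3 : nonlocalImpact w r j - r j = ∑' k : ℕ, w k * (r (j + k) - r j) := by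
    simp_rw [mul_sub]
    rw [h1.tsum_sub h2, tsum_mul_right, hw.hasSum.tsum_eq, one_mul]; rfl
  rw [h3]
  have h4 : ∀ k : ℕ, ‖w k * (r (j + k) - r j)‖ = w k * |r (j + k) - r j| := fun k => by
    rw [Real.norm_eq_abs, abs_mul, abs_of_nonneg (hw.nonneg k)]
  have h5 := norm_tsum_le_tsum_norm (f := fun k : ℕ => w k * (r (j + k) - r j))
    (by simp_rw [h4]; exact hw.summable_spread hr j)
  simp_rw [h4] at h5
  exact h5

/-- `h` times the sum of the spread over a window of cells is at most `s`, for sequences of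
variation at most `B`. -/
def SpreadBound (w : ℕ → ℝ) (B : ℝ≥0∞) (h : ℝ) (J : ℕ) (s : ℝ≥0∞) : Prop :=
  ∀ r : ℤ → ℝ, (∀ j, r j ∈ Icc (0 : ℝ) 1) → seqVar r ≤ B →
    ENNReal.ofReal h * ∑ j ∈ Finset.Icc (-J : ℤ) J, ENNReal.ofReal (spread w r j) ≤ s

lemma IsWeight.spreadBound_of_moment (hw : IsWeight w) {m : ℝ} (hh : 0 < h)
    (hs : Summable fun k : ℕ => (k : ℝ) * w k) (hm : ∑' k : ℕ, (k : ℝ) * w k ≤ m / h) (B : ℝ≥0∞)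
    (J : ℕ) : SpreadBound w B h J (ENNReal.ofReal m * B) := by
  intro r hr hB
  calc ENNReal.ofReal h * ∑ j ∈ Finset.Icc (-J : ℤ) J, ENNReal.ofReal (spread w r j)
      ≤ ENNReal.ofReal h * ∑' j : ℤ, ∑' k : ℕ, ENNReal.ofReal (w k) * ‖r (j + k) - r j‖ₑ := by
        gcongr
        simp_rw [hw.ofReal_spread hr]
        exact ENNReal.sum_le_tsum _
    _ ≤ ENNReal.ofReal h * ∑' k : ℕ, ENNReal.ofReal (w k) * (k * B) := by
        gcongr
        rw [ENNReal.tsum_comm]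
        refine ENNReal.tsum_le_tsum fun k => ?_
        rw [ENNReal.tsum_mul_left]
        gcongr
        exact (tsum_enorm_shift_sub_le r k).trans (by gcongr)
    _ = ENNReal.ofReal (h * ∑' k : ℕ, (k : ℝ) * w k) * B := by
        rw [ENNReal.ofReal_mul hh.le, ENNReal.ofReal_tsum_of_nonneg
          (fun k => mul_nonneg k.cast_nonneg (hw.nonneg k)) hs, mul_assoc, ← ENNReal.tsum_mul_right]
        congr 1
        refine tsum_congr fun k => ?_
        rw [ENNReal.ofReal_mul k.cast_nonneg, ENNReal.ofReal_natCast]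
        ring
    _ ≤ ENNReal.ofReal m * B := by
        gcongr
        calc h * ∑' k : ℕ, (k : ℝ) * w k ≤ h * (m / h) := by gcongr
          _ = m := by field_simp

lemma IsWeight.spreadBound_of_tail (hw : IsWeight w) (κ : ℝ) (hh : 0 < h) (B : ℝ≥0∞)
    (J : ℕ) : SpreadBound w B h J (ENNReal.ofReal (h * κ) * B + ENNReal.ofReal ((2 * J + 1) * h)
      * ∑' k : ℕ, if κ ≤ k then ENNReal.ofReal (w k) else 0) := by
  intro r hr hB
  set tail := ∑' k : ℕ, if κ ≤ k then ENNReal.ofReal (w k) else 0 with htail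
  have hone : ∑' k : ℕ, ENNReal.ofReal (w k) = 1 := by
    rw [← ENNReal.ofReal_tsum_of_nonneg hw.nonneg hw.hasSum.summable, hw.hasSum.tsum_eq,
      ENNReal.ofReal_one]
  have hsplit : ∀ j, ENNReal.ofReal (spread w r j)
      ≤ (∑' k : ℕ, if κ ≤ k then 0 else ENNReal.ofReal (w k) * ‖r (j + k) - r j‖ₑ) + tail :=
    fun j => by
      rw [hw.ofReal_spread hr, htail, ← ENNReal.tsum_add]
      refine ENNReal.tsum_le_tsum fun k => ?_
      split_ifs
      · rw [zero_add]
        refine mul_le_of_le_one_right' ?_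
        rw [Real.enorm_eq_ofReal_abs]
        exact ENNReal.ofReal_le_one.2 (abs_sub_le_one_of_mem (hr _) (hr _))
      · rw [add_zero]
  have hcard : ((Finset.Icc (-J : ℤ) J).card : ℝ≥0∞) = ENNReal.ofReal (2 * J + 1) := by
    rw [Int.card_Icc, show ((J : ℤ) + 1 - -J).toNat = 2 * J + 1 by omega,
      ← ENNReal.ofReal_natCast]
    push_cast; rfl
  calc ENNReal.ofReal h * ∑ j ∈ Finset.Icc (-J : ℤ) J, ENNReal.ofReal (spread w r j)
      ≤ ENNReal.ofReal h * (∑' j : ℤ, (∑' k : ℕ,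
          if κ ≤ k then 0 else ENNReal.ofReal (w k) * ‖r (j + k) - r j‖ₑ)
          + ENNReal.ofReal (2 * J + 1) * tail) := by
        gcongr
        refine (Finset.sum_le_sum fun j _ => hsplit j).trans ?_
        rw [Finset.sum_add_distrib, Finset.sum_const, nsmul_eq_mul, hcard]
        gcongr
        exact ENNReal.sum_le_tsum _
    _ ≤ ENNReal.ofReal h * (ENNReal.ofReal κ * B + ENNReal.ofReal (2 * J + 1) * tail) := by
        gcongr
        rw [ENNReal.tsum_comm]
        calc _ ≤ ∑' k : ℕ, ENNReal.ofReal (w k) * (ENNReal.ofReal κ * B) := by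
              refine ENNReal.tsum_le_tsum fun k => ?_
              split_ifs with hk
              · simp
              · rw [ENNReal.tsum_mul_left]
                gcongr
                refine (tsum_enorm_shift_sub_le r k).trans ?_
                rw [← ENNReal.ofReal_natCast]
                gcongr
                exact (not_le.1 hk).le
          _ = _ := by rw [ENNReal.tsum_mul_right, hone, one_mul]
    _ = _ := by
        rw [mul_add, ENNReal.ofReal_mul hh.le, ENNReal.ofReal_mul (p := 2 * (J : ℝ) + 1)
          (by positivity)]
        ring

end Spread

/-- Bound for the distance of the scheme from an entropy solution. -/
noncomputable def comparisonBound (C A L lam h δ T : ℝ) (B s : ℝ≥0∞) : ℝ≥0∞ :=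
  ENNReal.ofReal (T * C * (3 * A + L) * (h / δ) + 4 * h + 2 * δ + √(T * h / lam)) * B
    + (ENNReal.ofReal (T * C * L / δ) + 1) * s

section Comparison

variable {V ρ₀ : ℝ → ℝ} {v : ℝ → ℝ → ℝ} {A L lam h C δ R T : ℝ} {s : ℝ≥0∞} {w : ℕ → ℝ}
  {F f : ℝ → ℝ} {Ψ p : ℝ × ℝ → ℝ} {π : ℝ → ℝ} {J : ℕ}

lemma cellIndex_mem_Icc (hh : 0 < h) (hJ : R + h ≤ J * h) {x : ℝ} (hx : |x| ≤ R) :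
    cellIndex h x ∈ Finset.Icc (-J : ℤ) J := by
  have h1 := cellIndex_mem hh x
  have h2 := abs_le.1 hx
  rw [Finset.mem_Icc]
  have e1 : ((cellIndex h x : ℝ) - 1) * h ≤ J * h := by nlinarith [h1.1]
  have e2 : -(J : ℝ) * h ≤ ((cellIndex h x : ℝ)) * h := by nlinarith [h1.2]
  have e3 := le_of_mul_le_mul_right e2 hh
  have e4 : (cellIndex h x : ℝ) * h ≤ J * h := by nlinarith [h1.1]
  have e5 := le_of_mul_le_mul_right e4 hh
  exact ⟨by exact_mod_cast e3, by exact_mod_cast e5⟩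

lemma SchemeData.lintegral_datum_sub_le (H : SchemeData V A L ρ₀ w lam h) (hJ : R + h ≤ J * h)
    (hs : SpreadBound w (totalVariation ρ₀) h J s) :
    ∫⁻ x in Icc (-R) R, ‖ρ₀ x - schemeImpact V ρ₀ w lam h 0 (cellIndex h x)‖ₑ
      ≤ ENNReal.ofReal h * totalVariation ρ₀ + s := by
  have hh := H.h_pos
  have hr : ∀ j, cellAverage ρ₀ h j ∈ Icc (0 : ℝ) 1 := H.density_mem 0
  set S := Finset.Icc (-J : ℤ) J with hS
  set G : ℤ → ℝ≥0∞ := fun j => if j ∈ S then ENNReal.ofReal (spread w (cellAverage ρ₀ h) j) else 0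
    with hG
  have hGm : Measurable fun x => G (cellIndex h x) :=
    (measurable_of_countable G).comp (measurable_cellIndex h)
  have hpt : ∀ x ∈ Icc (-R) R, ‖ρ₀ x - schemeImpact V ρ₀ w lam h 0 (cellIndex h x)‖ₑ
      ≤ ‖cellAverage ρ₀ h (cellIndex h x) - ρ₀ x‖ₑ + G (cellIndex h x) := fun x hx => by
    have hm : cellIndex h x ∈ S := cellIndex_mem_Icc hh hJ (abs_le.2 hx)
    simp only [hG, if_pos hm]
    set j := cellIndex h x
    have e : ρ₀ x - schemeImpact V ρ₀ w lam h 0 j = -((cellAverage ρ₀ h j - ρ₀ x)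
        + (nonlocalImpact w (cellAverage ρ₀ h) j - cellAverage ρ₀ h j)) := by
      have : schemeImpact V ρ₀ w lam h 0 j = nonlocalImpact w (cellAverage ρ₀ h) j := rfl
      rw [this]; ring
    rw [e, enorm_neg]
    refine (enorm_add_le _ _).trans (add_le_add le_rfl ?_)
    rw [Real.enorm_eq_ofReal_abs]
    exact ENNReal.ofReal_le_ofReal (H.weight.abs_impact_sub_le hr j)
  calc _ ≤ ∫⁻ x in Icc (-R) R,
        (‖cellAverage ρ₀ h (cellIndex h x) - ρ₀ x‖ₑ + G (cellIndex h x)) :=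
        setLIntegral_mono' measurableSet_Icc hpt
    _ ≤ ∫⁻ x, (‖cellAverage ρ₀ h (cellIndex h x) - ρ₀ x‖ₑ + G (cellIndex h x)) :=
        setLIntegral_le_lintegral _ _
    _ = (∫⁻ x, ‖cellAverage ρ₀ h (cellIndex h x) - ρ₀ x‖ₑ) + ENNReal.ofReal h * ∑' j, G j := by
        rw [lintegral_add_right _ hGm, lintegral_comp_cellIndex hh]
    _ ≤ _ := by
        refine add_le_add (H.datum.lintegral_cellAverage_sub_le hh) ?_
        rw [tsum_eq_sum (s := S) (fun j hj => by simp only [hG, if_neg hj])]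
        refine le_trans (le_of_eq ?_) (hs _ hr (H.datum.seqVar_le hh))
        congr 1
        exact Finset.sum_congr rfl fun j hj => by simp only [hG, hS, if_pos hj]

lemma tsum_ofReal_mul_abs_sub {a : ℝ} (ha : 0 ≤ a) (u : ℤ → ℝ) :
    ∑' j, ENNReal.ofReal (a * |u j - u (j - 1)|) = ENNReal.ofReal a * seqVar u := by
  simp_rw [ENNReal.ofReal_mul ha, ← Real.enorm_eq_ofReal_abs]
  rw [ENNReal.tsum_mul_left, seqVar, ← tsum_int_shift (fun j => ‖u (j + 1) - u j‖ₑ) (-1)]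
  congr 1
  exact tsum_congr fun j => by rw [show j + -1 + 1 = j by ring, show j + -1 = j - 1 by ring]

lemma SchemeData.sum_fluxError_le (H : SchemeData V A L ρ₀ w lam h)
    (hs : SpreadBound w (totalVariation ρ₀) h J s) (n : ℕ) :
    ENNReal.ofReal h * ∑ j ∈ Finset.Icc (-J : ℤ) J,
        ENNReal.ofReal (fluxError A L w (schemeImpact V ρ₀ w lam h n) j)
      ≤ ENNReal.ofReal (2 * A * h) * totalVariation ρ₀ + ENNReal.ofReal L * s := by
  have hA := H.vel.bound_nonneg
  have hL := H.vel.lip_nonneg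
  have hh := H.h_pos
  set u := schemeImpact V ρ₀ w lam h n with hu
  have hm : ∀ j, u j ∈ Icc (0 : ℝ) 1 := H.weight.impact_mem (H.density_mem n)
  have hv := H.seqVar_le n
  have e1 : ∑ j ∈ Finset.Icc (-J : ℤ) J, ENNReal.ofReal (2 * A * |u j - u (j - 1)|)
      ≤ ENNReal.ofReal (2 * A) * totalVariation ρ₀ := by
    refine (ENNReal.sum_le_tsum _).trans ?_
    rw [tsum_ofReal_mul_abs_sub (by positivity)]
    gcongr
  calc _ ≤ ENNReal.ofReal h * ∑ j ∈ Finset.Icc (-J : ℤ) J,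
        (ENNReal.ofReal (2 * A * |u j - u (j - 1)|) + ENNReal.ofReal L
          * ENNReal.ofReal (spread w u j)) := by
        gcongr with j _
        unfold fluxError
        rw [← ENNReal.ofReal_mul hL]
        exact ENNReal.ofReal_add_le
    _ = ENNReal.ofReal h * ∑ j ∈ Finset.Icc (-J : ℤ) J, ENNReal.ofReal (2 * A * |u j - u (j - 1)|)
        + ENNReal.ofReal L * (ENNReal.ofReal h * ∑ j ∈ Finset.Icc (-J : ℤ) J,
          ENNReal.ofReal (spread w u j)) := by
        rw [Finset.sum_add_distrib, ← Finset.mul_sum]; ring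
    _ ≤ ENNReal.ofReal h * (ENNReal.ofReal (2 * A) * totalVariation ρ₀) + ENNReal.ofReal L * s := by
        gcongr
        exact hs u hm hv
    _ = _ := by rw [ENNReal.ofReal_mul (p := 2 * A) (by positivity)]; ring

theorem SchemeData.kuznetsov (H : SchemeData V A L ρ₀ w lam h) (hv : IsEntropySolution V ρ₀ v)
    (hF : IsSmoothStep C δ F f) (hC : 0 < C) (hT : 0 ≤ T) (hΨ : IsCutoff (A + L) R T Ψ p π)
    (hJ : R + δ + 3 * h ≤ J * h) (hs : SpreadBound w (totalVariation ρ₀) h J s) :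
    ∫⁻ z, ENNReal.ofReal (p z)
        * ‖v z.1 z.2 - gridFun (schemeImpact V ρ₀ w lam h) lam h z.1 z.2‖ₑ ∂halfPlane
      ≤ comparisonBound C A L lam h δ T (totalVariation ρ₀) s := by
  have hA := H.vel.bound_nonneg
  have hL := H.vel.lip_nonneg
  have hh := H.h_pos
  have hl := H.lam_pos
  have hδ := hF.width_pos
  set B := totalVariation ρ₀ with hB
  have hh0 : ENNReal.ofReal h ≠ 0 := by simpa using hh
  set e := (ENNReal.ofReal h)⁻¹ * (ENNReal.ofReal (2 * A * h) * B + ENNReal.ofReal L * s) with he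
  have heq : ENNReal.ofReal h * e = ENNReal.ofReal (2 * A * h) * B + ENNReal.ofReal L * s := by
    rw [he, ← mul_assoc, ENNReal.mul_inv_cancel hh0 ENNReal.ofReal_ne_top, one_mul]
  have hE : ∀ n, ∑ j ∈ Finset.Icc (-J : ℤ) J,
      ENNReal.ofReal (fluxError A L w (schemeImpact V ρ₀ w lam h n) j) ≤ e := fun n => by
    have := H.sum_fluxError_le hs n
    rw [← heq] at this
    exact (ENNReal.mul_le_mul_iff_right hh0 ENNReal.ofReal_ne_top).1 this
  refine (H.isDiscreteEntropySolution.kuznetsov hv H.datum.aemeasurable H.datum.mem_Icc H.vel hF hC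
    hl hh hΨ hJ hE).trans ?_
  have hinit := H.lintegral_datum_sub_le (R := R) (by linarith) hs
  have hsq : h * √(T / (lam * h)) = √(T * h / lam) := by
    rw [show T * h / lam = h ^ 2 * (T / (lam * h)) by field_simp, Real.sqrt_mul (by positivity),
      Real.sqrt_sq hh.le]
  have hce : ENNReal.ofReal (C * h / δ) * e
      = ENNReal.ofReal (C * (2 * A) * (h / δ)) * B + ENNReal.ofReal (C * L / δ) * s := by
    rw [show C * h / δ = C / δ * h by ring, ENNReal.ofReal_mul (by positivity), mul_assoc, heq,
      mul_add, ← mul_assoc, ← mul_assoc, ← ENNReal.ofReal_mul (by positivity),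
      ← ENNReal.ofReal_mul (by positivity),
      show C / δ * (2 * A * h) = C * (2 * A) * (h / δ) by ring,
      show C / δ * L = C * L / δ by ring]
  rw [hce]
  calc _ ≤ ENNReal.ofReal T * (ENNReal.ofReal ((A + L) * (C * h / δ)) * B
          + (ENNReal.ofReal (C * (2 * A) * (h / δ)) * B + ENNReal.ofReal (C * L / δ) * s))
        + ((ENNReal.ofReal h * B + s) + ENNReal.ofReal (δ + h) * B)
        + ENNReal.ofReal (h * (√(T / (lam * h)) + 1) + (δ + h)) * B := by gcongr
    _ = (ENNReal.ofReal T * (ENNReal.ofReal ((A + L) * (C * h / δ))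
          + ENNReal.ofReal (C * (2 * A) * (h / δ))) + ENNReal.ofReal h + ENNReal.ofReal (δ + h)
          + ENNReal.ofReal (h * (√(T / (lam * h)) + 1) + (δ + h))) * B
        + (ENNReal.ofReal T * ENNReal.ofReal (C * L / δ) + 1) * s := by ring
    _ = _ := by
        unfold comparisonBound
        rw [← ENNReal.ofReal_add (by positivity) (by positivity), ← ENNReal.ofReal_mul hT,
          ← ENNReal.ofReal_add (by positivity) (by positivity),
          ← ENNReal.ofReal_add (by positivity) (by positivity),
          ← ENNReal.ofReal_add (by positivity) (by positivity), ← ENNReal.ofReal_mul hT,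
          mul_add h, hsq]
        congr 3
        · ring
        · congr 1; ring

end Comparison

section TimeSlices

variable {V ρ₀ : ℝ → ℝ} {v : ℝ → ℝ → ℝ} {A L lam h C δ R T : ℝ} {s : ℝ≥0∞} {w : ℕ → ℝ}
  {F f : ℝ → ℝ} {J : ℕ}

lemma eventually_gridFun_eq (u : ℕ → ℤ → ℝ) (hl : 0 < lam) (hh : 0 < h) (hT : 0 ≤ T) :
    ∀ᶠ κ in 𝓝[>] (0 : ℝ), ∀ t ∈ Ioc T (T + κ), gridFun u lam h t = gridFun u lam h T := by
  have hτ : 0 < lam * h := mul_pos hl hh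
  set κ₀ := (⌊T / (lam * h)⌋₊ + 1) * (lam * h) - T with hκ₀
  have hpos : 0 < κ₀ := by
    have := (div_lt_iff₀ hτ).1 (Nat.lt_floor_add_one (T / (lam * h)))
    rw [hκ₀]; linarith
  filter_upwards [Ioo_mem_nhdsGT hpos] with κ hκ t ht
  ext x
  unfold gridFun
  congr 1
  have h0 : 0 ≤ t := by linarith [ht.1]
  rw [Nat.floor_eq_iff (by positivity), le_div_iff₀ hτ, div_lt_iff₀ hτ]
  have h1 := (le_div_iff₀ hτ).1 (Nat.floor_le (div_nonneg hT hτ.le))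
  constructor
  · linarith [ht.1]
  · have := ht.2; have := hκ.2; rw [hκ₀] at this; linarith

theorem SchemeData.lintegral_slice_sub_le (H : SchemeData V A L ρ₀ w lam h)
    (hv : IsEntropySolution V ρ₀ v) (hc : IsTimeContinuous v) (hF : IsSmoothStep C δ F f)
    (hC : 0 < C) (hT : 0 ≤ T) (hJ : R + 1 + (A + L) * (T + 1) + δ + 3 * h ≤ J * h)
    (hs : SpreadBound w (totalVariation ρ₀) h J s) :
    ∫⁻ x in Icc (-R) R, ‖v T x - gridFun (schemeImpact V ρ₀ w lam h) lam h T x‖ₑ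
      ≤ comparisonBound C A L lam h δ T (totalVariation ρ₀) s := by
  have hh := H.h_pos
  have hl := H.lam_pos
  have hM : 0 ≤ A + L := add_nonneg H.vel.bound_nonneg H.vel.lip_nonneg
  set B := totalVariation ρ₀ with hB
  have hBtop : B ≠ ⊤ := H.datum.totalVariation_lt_top.ne
  by_cases hst : s = ⊤
  · unfold comparisonBound
    rw [hst, ENNReal.mul_top (by simp), add_top]; exact le_top
  set g := gridFun (schemeImpact V ρ₀ w lam h) lam h with hg
  set D : ℝ → ℝ≥0∞ := fun t => ∫⁻ x in Icc (-R) R, ‖v t x - g t x‖ₑ with hD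
  refine ENNReal.le_of_forall_pos_le_add fun η hη _ => ?_
  have hvm : ∀ t ≥ 0, AEMeasurable (v t) := fun t ht =>
    (hc.locallyIntegrable t ht).aestronglyMeasurable.aemeasurable
  have hcont : ∀ᶠ κ in 𝓝[>] (0 : ℝ), ∀ t ∈ Ioc T (T + κ),
      ∫⁻ x in Icc (-R) R, ‖v t x - v T x‖ₑ ≤ η := by
    have h1 := hc.tendsto T hT (Icc (-R) R) isCompact_Icc
    have h2 := (ENNReal.tendsto_nhds_zero.1 h1) η (by simpa using hη)
    rw [eventually_nhdsWithin_iff, Metric.eventually_nhds_iff] at h2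
    obtain ⟨κ₀, hκ₀, h3⟩ := h2
    filter_upwards [Ioo_mem_nhdsGT hκ₀] with κ hκ t ht
    have := h3 (y := t) (by rw [Real.dist_eq, abs_of_pos (by linarith [ht.1])]; linarith [ht.2, hκ.2])
      (show (0 : ℝ) ≤ t by linarith [ht.1])
    rwa [eLpNorm_one_eq_lintegral_enorm] at this
  have hev : ∀ᶠ κ in 𝓝[>] (0 : ℝ), D T ≤ comparisonBound C A L lam h δ (T + κ) B s + η := by
    filter_upwards [hcont, eventually_gridFun_eq (schemeImpact V ρ₀ w lam h) hl hh hT,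
      Ioo_mem_nhdsGT (zero_lt_one' ℝ)] with κ hκ1 hκ2 hκ3
    obtain ⟨Ψ, p, π, hΨ, hp, hmass⟩ := exists_isCutoff_concentrated
      (R := R + 1 + (A + L) * (T + 1)) hM hT hκ3.1
    have hk := H.kuznetsov hv hF hC (by linarith [hκ3.1]) hΨ hJ hs
    have hDle : ∀ t ∈ Ioc T (T + κ), D T ≤ D t + η := fun t ht => by
      calc D T ≤ ∫⁻ x in Icc (-R) R, (‖v t x - g t x‖ₑ + ‖v t x - v T x‖ₑ) := by
            refine lintegral_mono fun x => ?_
            have e : v T x - g T x = (v t x - g t x) - (v t x - v T x) := by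
              rw [hg, hκ2 t ht]; ring
            rw [e]
            exact enorm_sub_le
        _ = D t + ∫⁻ x in Icc (-R) R, ‖v t x - v T x‖ₑ :=
            lintegral_add_right' _ (((hvm t (by linarith [ht.1])).sub
              (hvm T hT)).enorm.mono_measure Measure.restrict_le_self)
        _ ≤ D t + η := by gcongr; exact hκ1 t ht
    have hpm := hΨ.density_measurable
    have hfub : ∫⁻ t in Ioc T (T + κ), ENNReal.ofReal (π t) * D t
        ≤ comparisonBound C A L lam h δ (T + κ) B s := by
      refine le_trans ?_ hk
      have hmeas : AEMeasurable (fun z : ℝ × ℝ => ENNReal.ofReal (p z)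
          * ‖v z.1 z.2 - g z.1 z.2‖ₑ) halfPlane := by
        refine hΨ.rate_continuous.measurable.ennreal_ofReal.aemeasurable.mul ?_
        have h1 : AEMeasurable (fun z : ℝ × ℝ => v z.1 z.2) halfPlane :=
          hv.aestronglyMeasurable.aemeasurable
        have h2 : Measurable fun z : ℝ × ℝ => g z.1 z.2 := measurable_gridFun _ lam h
        exact (h1.sub h2.aemeasurable).enorm
      rw [halfPlane_eq_prod] at hmeas ⊢
      rw [lintegral_prod _ hmeas]
      calc _ ≤ ∫⁻ t in Ioc T (T + κ), ∫⁻ x, ENNReal.ofReal (p (t, x)) * ‖v t x - g t x‖ₑ := by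
            refine setLIntegral_mono' measurableSet_Ioc fun t ht => ?_
            simp only [hD]
            rw [← lintegral_const_mul' _ _ ENNReal.ofReal_ne_top]
            refine le_trans (le_of_eq ?_) (setLIntegral_le_lintegral (Icc (-R) R) _)
            refine setLIntegral_congr_fun measurableSet_Icc fun x hx => ?_
            rw [hp t ht x ((abs_le.2 hx).trans ?_)]
            have := mul_le_mul_of_nonneg_left hκ3.2.le hM
            nlinarith
        _ ≤ _ := lintegral_mono_set fun t ht => lt_of_le_of_lt hT ht.1
    calc D T = ∫⁻ t in Ioc T (T + κ), ENNReal.ofReal (π t) * D T := by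
          rw [lintegral_mul_const _ hpm.ennreal_ofReal, hmass, one_mul]
      _ ≤ ∫⁻ t in Ioc T (T + κ), (ENNReal.ofReal (π t) * D t + ENNReal.ofReal (π t) * η) := by
          refine setLIntegral_mono' measurableSet_Ioc fun t ht => ?_
          rw [← mul_add]
          gcongr
          exact hDle t ht
      _ = (∫⁻ t in Ioc T (T + κ), ENNReal.ofReal (π t) * D t) + η := by
          rw [lintegral_add_right _ (hpm.ennreal_ofReal.mul_const _),
            lintegral_mul_const _ hpm.ennreal_ofReal, hmass, one_mul]
      _ ≤ _ := by gcongr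
  have hlim : Tendsto (fun κ => comparisonBound C A L lam h δ (T + κ) B s + η) (𝓝[>] (0 : ℝ))
      (𝓝 (comparisonBound C A L lam h δ T B s + η)) := by
    refine Tendsto.add ?_ tendsto_const_nhds
    refine tendsto_nhdsWithin_of_tendsto_nhds ?_
    unfold comparisonBound
    refine Tendsto.add (ENNReal.Tendsto.mul_const (ENNReal.tendsto_ofReal ?_) (Or.inr hBtop))
      (ENNReal.Tendsto.mul_const (Tendsto.add (ENNReal.tendsto_ofReal ?_) tendsto_const_nhds)
        (Or.inr hst))
    · refine (Continuous.tendsto' (by fun_prop) _ _ (by rw [add_zero]))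
    · refine (Continuous.tendsto' (by fun_prop) _ _ (by rw [add_zero]))
  exact ge_of_tendsto hlim hev

end TimeSlices

/-! ### Uniqueness of entropy solutions -/

section Uniqueness

variable {V ρ₀ : ℝ → ℝ} {v v' : ℝ → ℝ → ℝ} {A L lam : ℝ}

/-- The weights of the local scheme. -/
noncomputable def pointWeight (k : ℕ) : ℝ := if k = 0 then 1 else 0

lemma isWeight_pointWeight : IsWeight pointWeight where
  nonneg k := by unfold pointWeight; split_ifs <;> norm_num
  mono k := by unfold pointWeight; split_ifs <;> norm_num at *
  hasSum := hasSum_ite_eq 0 1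
  convex k := by unfold pointWeight; split_ifs <;> norm_num at *

lemma spread_pointWeight (r : ℤ → ℝ) (j : ℤ) : spread pointWeight r j = 0 := by
  unfold spread
  refine (tsum_congr fun k => ?_).trans tsum_zero
  unfold pointWeight
  split_ifs with hk <;> simp [hk]

lemma spreadBound_pointWeight (B : ℝ≥0∞) (h : ℝ) (J : ℕ) : SpreadBound pointWeight B h J 0 :=
  fun r _ _ => by simp [spread_pointWeight]

theorem IsEntropySolution.ae_eq (hV : IsVelocity V A L) (hρ : IsAdmissibleDatum ρ₀) (hl : 0 < lam)
    (hcfl : lam * (A + L) ≤ 1) (hv : IsEntropySolution V ρ₀ v) (hv' : IsEntropySolution V ρ₀ v') :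
    ∀ᵐ z ∂halfPlane, v z.1 z.2 = v' z.1 z.2 := by
  obtain ⟨C, hC, hF⟩ := exists_isSmoothStep
  have hM : 0 ≤ A + L := add_nonneg hV.bound_nonneg hV.lip_nonneg
  have hBtop : totalVariation ρ₀ ≠ ⊤ := hρ.totalVariation_lt_top.ne
  have hvm : AEMeasurable (fun z : ℝ × ℝ => v z.1 z.2) halfPlane :=
    hv.aestronglyMeasurable.aemeasurable
  have hvm' : AEMeasurable (fun z : ℝ × ℝ => v' z.1 z.2) halfPlane :=
    hv'.aestronglyMeasurable.aemeasurable
  have key : ∀ N : ℕ, ∀ᵐ z ∂halfPlane, z.1 < (N : ℝ) + 1 → |z.2| ≤ (N : ℝ) + 1 → v z.1 z.2 = v' z.1 z.2 :=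
    fun N => by
      set T : ℝ := N + 1 with hT
      have hT0 : 0 < T := by positivity
      obtain ⟨Ψ, p, π, hΨ, hp⟩ := exists_isCutoff_quadratic (R := T + 1 + (A + L) * T) hM hT0
      have hpm := hΨ.rate_continuous.measurable.ennreal_ofReal.aemeasurable (μ := halfPlane)
      have hle : ∀ h > 0, ∫⁻ z, ENNReal.ofReal (p z) * ‖v z.1 z.2 - v' z.1 z.2‖ₑ ∂halfPlane
          ≤ 2 * comparisonBound C A L lam h (√h) T (totalVariation ρ₀) 0 := fun h hh => by
        obtain ⟨F, f, hFf⟩ := hF (√h) (by positivity)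
        have H : SchemeData V A L ρ₀ pointWeight lam h :=
          ⟨hV, hρ, isWeight_pointWeight, hl, hcfl, hh⟩
        obtain ⟨J, hJ⟩ := exists_nat_ge ((T + 1 + (A + L) * T + √h + 3 * h) / h)
        rw [div_le_iff₀ hh] at hJ
        have hs := spreadBound_pointWeight (totalVariation ρ₀) h J
        have h1 := H.kuznetsov hv hFf hC hT0.le hΨ hJ hs
        have h2 := H.kuznetsov hv' hFf hC hT0.le hΨ hJ hs
        set g := gridFun (schemeImpact V ρ₀ pointWeight lam h) lam h with hg
        have hgm : Measurable fun z : ℝ × ℝ => g z.1 z.2 := measurable_gridFun _ lam h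
        calc _ ≤ ∫⁻ z, (ENNReal.ofReal (p z) * ‖v z.1 z.2 - g z.1 z.2‖ₑ
              + ENNReal.ofReal (p z) * ‖v' z.1 z.2 - g z.1 z.2‖ₑ) ∂halfPlane := by
              refine lintegral_mono fun z => ?_
              rw [← mul_add]
              gcongr
              rw [← sub_sub_sub_cancel_right _ _ (g z.1 z.2)]
              exact enorm_sub_le
          _ ≤ comparisonBound C A L lam h (√h) T (totalVariation ρ₀) 0
              + comparisonBound C A L lam h (√h) T (totalVariation ρ₀) 0 := by
              have hm : AEMeasurable (fun z => ENNReal.ofReal (p z) * ‖v' z.1 z.2 - g z.1 z.2‖ₑ)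
                  halfPlane := hpm.mul (hvm'.sub hgm.aemeasurable).enorm
              rw [lintegral_add_right' _ hm]
              exact add_le_add h1 h2
          _ = _ := (two_mul _).symm
      have hlim : Tendsto (fun h => 2 * comparisonBound C A L lam h (√h) T (totalVariation ρ₀) 0)
          (𝓝[>] (0 : ℝ)) (𝓝 0) := by
        have h1 : Tendsto (fun h : ℝ => T * C * (3 * A + L) * (h / √h) + 4 * h + 2 * √h
            + √(T * h / lam)) (𝓝[>] (0 : ℝ)) (𝓝 0) := by
          simp_rw [Real.div_sqrt]
          refine tendsto_nhdsWithin_of_tendsto_nhds (Continuous.tendsto' (by fun_prop) _ _ ?_)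
          simp
        unfold comparisonBound
        simp only [mul_zero, add_zero]
        have h2 := ENNReal.Tendsto.const_mul (a := 2) (ENNReal.Tendsto.mul_const
          (b := totalVariation ρ₀) (ENNReal.tendsto_ofReal h1) (Or.inr hBtop))
          (Or.inr (by norm_num))
        simpa using h2
      have hzero : ∫⁻ z, ENNReal.ofReal (p z) * ‖v z.1 z.2 - v' z.1 z.2‖ₑ ∂halfPlane = 0 :=
        le_antisymm (ge_of_tendsto hlim (eventually_mem_nhdsWithin.mono hle)) zero_le
      have hm : AEMeasurable (fun z => ENNReal.ofReal (p z) * ‖v z.1 z.2 - v' z.1 z.2‖ₑ)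
          halfPlane := hpm.mul (hvm.sub hvm').enorm
      rw [lintegral_eq_zero_iff' hm] at hzero
      filter_upwards [hzero, ae_halfPlane_pos] with z hz hz0 hzT hzx
      have hpp : 0 < p z := hp z.1 ⟨hz0, hzT⟩ z.2 (hzx.trans (by
        have := mul_le_mul_of_nonneg_left hzT.le hM
        linarith))
      simp only [Pi.zero_apply, mul_eq_zero, ENNReal.ofReal_eq_zero, not_le.2 hpp, false_or,
        enorm_eq_zero] at hz
      linarith
  filter_upwards [ae_all_iff.2 key] with z hz
  obtain ⟨N, hN⟩ := exists_nat_gt (max z.1 |z.2|)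
  exact hz N (by linarith [le_max_left z.1 |z.2|]) (by linarith [le_max_right z.1 |z.2|])

end Uniqueness

/-! ### Consistency of the discrete entropy inequalities -/

section Consistency

variable {V : ℝ → ℝ} {A L lam h c R Λ ω θ : ℝ} {B : ℝ≥0∞} {u : ℕ → ℤ → ℝ}
  {Q : ℕ → ℤ → ℝ → ℝ} {E : ℕ → ℤ → ℝ} {φ : ℝ × ℝ → ℝ}

/-- Quantitative bounds for a test function supported in `[-R,R]²`: the space derivative is at most
`Λ` and oscillates by at most `ω` at distances below `θ`. -/
structure IsTestBound (φ : ℝ × ℝ → ℝ) (R Λ ω θ : ℝ) : Prop where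
  contDiff : ContDiff ℝ 1 φ
  compact : HasCompactSupport φ
  nonneg : ∀ t ≥ 0, ∀ x, 0 ≤ φ (t, x)
  support : ∀ t x, R < |t| ∨ R < |x| → φ (t, x) = 0
  bound : ∀ z, |fderiv ℝ φ z (0, 1)| ≤ Λ
  osc : ∀ z z', dist z z' < θ → |fderiv ℝ φ z (0, 1) - fderiv ℝ φ z' (0, 1)| ≤ ω

lemma IsTestBound.fderiv_eq_zero (hφ : IsTestBound φ R Λ ω θ) {t x : ℝ} (h : R < |t| ∨ R < |x|) :
    fderiv ℝ φ (t, x) = 0 := by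
  have : φ =ᶠ[𝓝 (t, x)] fun _ => 0 := by
    have ho : IsOpen {z : ℝ × ℝ | R < |z.1| ∨ R < |z.2|} :=
      IsOpen.union (s₁ := {z : ℝ × ℝ | R < |z.1|}) (s₂ := {z : ℝ × ℝ | R < |z.2|})
        (isOpen_lt continuous_const continuous_fst.abs)
        (isOpen_lt continuous_const continuous_snd.abs)
    filter_upwards [ho.mem_nhds h] with z hz
    exact hφ.support z.1 z.2 hz
  rw [this.fderiv_eq, fderiv_fun_const]; rfl

lemma continuous_fderiv_const (hφ : ContDiff ℝ 1 φ) (d : ℝ × ℝ) :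
    Continuous fun z => fderiv ℝ φ z d :=
  (hφ.continuous_fderiv one_ne_zero).clm_apply continuous_const

lemma hasCompactSupport_fderiv_const (hφ : HasCompactSupport φ) (d : ℝ × ℝ) :
    HasCompactSupport fun z => fderiv ℝ φ z d := hφ.fderiv_apply (𝕜 := ℝ) d

lemma IsTestBound.abs_sub_slope_le (hφ : IsTestBound φ R Λ ω θ) (hh : 0 < h) {s t : ℝ}
    (hθ : h < θ) (hst : |t - s| < θ) (x : ℝ) :
    |fderiv ℝ φ (t, x) (0, 1) - (φ (s, x) - φ (s, x - h)) / h| ≤ ω := by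
  obtain ⟨ξ, hξ, he⟩ := exists_hasDerivAt_eq_slope (fun y => φ (s, y))
    (fun y => fderiv ℝ φ (s, y) (0, 1)) (by linarith : x - h < x)
    (hφ.contDiff.continuous.comp (by fun_prop)).continuousOn
    (fun y _ => hasDerivAt_snd (hφ.contDiff.differentiable one_ne_zero (s, y)))
  rw [show x - (x - h) = h by ring] at he
  rw [← he]
  refine hφ.osc _ _ ?_
  rw [Prod.dist_eq, max_lt_iff, Real.dist_eq, Real.dist_eq]
  refine ⟨hst, ?_⟩
  rw [abs_of_pos (by linarith [hξ.2])]; linarith [hξ.1]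

lemma IsTestBound.abs_sub_le (hφ : IsTestBound φ R Λ ω θ) (hh : 0 < h) (s x : ℝ) :
    |φ (s, x) - φ (s, x - h)| ≤ Λ * h := by
  obtain ⟨ξ, hξ, he⟩ := exists_hasDerivAt_eq_slope (fun y => φ (s, y))
    (fun y => fderiv ℝ φ (s, y) (0, 1)) (by linarith : x - h < x)
    (hφ.contDiff.continuous.comp (by fun_prop)).continuousOn
    (fun y _ => hasDerivAt_snd (hφ.contDiff.differentiable one_ne_zero (s, y)))
  rw [show x - (x - h) = h by ring, eq_div_iff hh.ne'] at he
  rw [← he, abs_mul, abs_of_pos hh]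
  gcongr
  exact hφ.bound _

lemma IsDiscreteEntropySolution.slice_ge (H : IsDiscreteEntropySolution V lam B u Q E)
    (hV : IsVelocity V A L) (hl : 0 < lam) (hh : 0 < h) (hh1 : h ≤ 1)
    (hc : c ∈ Icc (0 : ℝ) 1) (hφ : IsTestBound φ R Λ ω θ) (hθ : h < θ) (hτθ : lam * h < θ)
    {N : ℕ} (hN : R < N * (lam * h)) (x : ℝ) :
    -(|u 0 (cellIndex h x) - c| * φ (0, x))
      + (∑ n ∈ Finset.range N, lam * (Q n (cellIndex h (x + h)) c * φ ((n + 1) * (lam * h), x)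
          - Q n (cellIndex h x) c * φ ((n + 1) * (lam * h), x - h))
        - ∑ n ∈ Finset.range N, ((Icc (-(R + 1)) (R + 1)).indicator
            (fun _ => (A + L) * ω * (lam * h)) x + lam * h * Λ * E n (cellIndex h x)))
      ≤ ∫ t in Ioi 0, (|gridFun u lam h t x - c| * fderiv ℝ φ (t, x) (1, 0)
          + kruzkovFlux V c (gridFun u lam h t x) * fderiv ℝ φ (t, x) (0, 1)) := by
  set τ := lam * h with hτdef
  have hτ : 0 < τ := mul_pos hl hh
  have hM : 0 ≤ A + L := add_nonneg hV.bound_nonneg hV.lip_nonneg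
  set j := cellIndex h x with hj
  have hj' : cellIndex h (x + h) = j + 1 := cellIndex_add_self hh x
  set f : ℝ → ℝ := fun t => |gridFun u lam h t x - c| * fderiv ℝ φ (t, x) (1, 0)
    + kruzkovFlux V c (gridFun u lam h t x) * fderiv ℝ φ (t, x) (0, 1) with hf
  set k : ℕ → ℝ → ℝ := fun n t => |u n j - c| * fderiv ℝ φ (t, x) (1, 0)
    + kruzkovFlux V c (u n j) * fderiv ℝ φ (t, x) (0, 1) with hk
  have hc1 : Continuous fun t => fderiv ℝ φ (t, x) (1, 0) :=
    (continuous_fderiv_const hφ.contDiff _).comp (by fun_prop)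
  have hc2 : Continuous fun t => fderiv ℝ φ (t, x) (0, 1) :=
    (continuous_fderiv_const hφ.contDiff _).comp (by fun_prop)
  have hkc : ∀ n, Continuous (k n) := fun n => by simp only [hk]; fun_prop
  have hle : ∀ n : ℕ, (n : ℝ) * τ ≤ (n + 1 : ℕ) * τ := fun n => by
    push_cast; nlinarith
  have hae : ∀ n : ℕ, ∀ᵐ t : ℝ, t ∈ uIoc ((n : ℝ) * τ) ((n + 1 : ℕ) * τ) → k n t = f t := fun n => by
    have h1 : ∀ᵐ t : ℝ, t ≠ (n + 1 : ℕ) * τ := by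
      simp [ae_iff, measure_singleton]
    filter_upwards [h1] with t ht hmem
    rw [uIoc_of_le (hle n)] at hmem
    have : ⌊t / τ⌋₊ = n := by
      have h0 : 0 ≤ t := le_trans (by positivity) hmem.1.le
      rw [Nat.floor_eq_iff (by positivity), le_div_iff₀ hτ, div_lt_iff₀ hτ]
      refine ⟨hmem.1.le, ?_⟩
      have := lt_of_le_of_ne hmem.2 ht
      push_cast at this; exact this
    simp only [hf, hk, gridFun, ← hτdef, this, ← hj]
  have hint : ∫ t in Ioi 0, f t = ∑ n ∈ Finset.range N, ∫ t in ((n : ℝ) * τ)..((n + 1 : ℕ) * τ), k n t := by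
    have h1 : ∫ t in Ioi 0, f t = ∫ t in Ioc 0 (N * τ), f t := by
      refine setIntegral_eq_of_subset_of_forall_sdiff_eq_zero measurableSet_Ioi
        (fun t ht => ht.1) fun t ht => ?_
      have : R < |t| := by
        by_contra hcon
        refine ht.2 ⟨ht.1, ?_⟩
        linarith [le_abs_self t]
      simp only [hf]
      rw [hφ.fderiv_eq_zero (Or.inl this)]; simp
    have h2 := intervalIntegral.sum_integral_adjacent_intervals (f := f) (μ := volume)
      (a := fun n : ℕ => (n : ℝ) * τ) (n := N) (fun n _ =>
        ((hkc n).intervalIntegrable _ _).congr_ae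
          ((ae_restrict_iff' measurableSet_uIoc).2 (hae n)))
    simp only [Nat.cast_zero, zero_mul] at h2
    rw [h1, ← intervalIntegral.integral_of_le (by positivity), ← h2]
    exact Finset.sum_congr rfl fun n _ => (intervalIntegral.integral_congr_ae (hae n)).symm
  have hstep : ∀ n : ℕ, |u n j - c| * (φ ((n + 1 : ℕ) * τ, x) - φ ((n : ℝ) * τ, x))
      + lam * Q n j c * (φ ((n + 1 : ℕ) * τ, x) - φ ((n + 1 : ℕ) * τ, x - h))
      - ((Icc (-(R + 1)) (R + 1)).indicator (fun _ => (A + L) * ω * τ) x + lam * h * Λ * E n j)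
      ≤ ∫ t in ((n : ℝ) * τ)..((n + 1 : ℕ) * τ), k n t := fun n => by
    set s := ((n + 1 : ℕ) : ℝ) * τ with hs
    have hlen : s - n * τ = τ := by rw [hs]; push_cast; ring
    have e1 : ∫ t in ((n : ℝ) * τ)..s, fderiv ℝ φ (t, x) (1, 0) = φ (s, x) - φ (n * τ, x) :=
      intervalIntegral.integral_eq_sub_of_hasDerivAt (f := fun t => φ (t, x))
        (fun t _ => hasDerivAt_fst (hφ.contDiff.differentiable one_ne_zero (t, x)))
        (hc1.intervalIntegrable _ _)
    have e2 : ∫ t in ((n : ℝ) * τ)..s, k n t = |u n j - c| * (φ (s, x) - φ (n * τ, x))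
        + kruzkovFlux V c (u n j) * ∫ t in ((n : ℝ) * τ)..s, fderiv ℝ φ (t, x) (0, 1) := by
      simp only [hk]
      rw [intervalIntegral.integral_add ((hc1.const_mul _).intervalIntegrable _ _)
        ((hc2.const_mul _).intervalIntegrable _ _), intervalIntegral.integral_const_mul,
        intervalIntegral.integral_const_mul, e1]
    set q := kruzkovFlux V c (u n j) with hq
    set D := φ (s, x) - φ (s, x - h) with hD
    have hqM : |q| ≤ A + L := by
      refine (hV.abs_kruzkovFlux_le (H.mem n j)).trans ?_
      exact mul_le_of_le_one_right hM (abs_sub_le_one_of_mem (H.mem n j) hc)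
    have e3 : |∫ t in ((n : ℝ) * τ)..s, (fderiv ℝ φ (t, x) (0, 1) - D / h)|
        ≤ (Icc (-(R + 1)) (R + 1)).indicator (fun _ => ω) x * τ := by
      have := intervalIntegral.norm_integral_le_of_norm_le_const (a := (n : ℝ) * τ) (b := s)
        (f := fun t => fderiv ℝ φ (t, x) (0, 1) - D / h)
        (C := (Icc (-(R + 1)) (R + 1)).indicator (fun _ => ω) x) fun t ht => ?_
      · rwa [hlen, abs_of_pos hτ] at this
      · rw [uIoc_of_le (by linarith)] at ht
        by_cases hx : x ∈ Icc (-(R + 1)) (R + 1)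
        · rw [indicator_of_mem hx]
          refine hφ.abs_sub_slope_le hh hθ ?_ x
          rw [abs_sub_comm, abs_of_nonneg (by linarith [ht.2])]
          linarith [ht.1]
        · rw [indicator_of_notMem hx]
          have hx1 : R + 1 < |x| := by
            by_contra hcon; exact hx (abs_le.1 (not_lt.1 hcon))
          have hx2 : R < |x - h| := by
            have := abs_sub_abs_le_abs_sub x h
            rw [abs_of_pos hh] at this; linarith
          rw [hD, hφ.fderiv_eq_zero (Or.inr (by linarith)), hφ.support s x (Or.inr (by linarith)),
            hφ.support s (x - h) (Or.inr hx2)]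
          simp
    rw [intervalIntegral.integral_sub (hc2.intervalIntegrable _ _) (by simp),
      intervalIntegral.integral_const, hlen, smul_eq_mul] at e3
    have e4 : τ * (D / h) = lam * D := by rw [hτdef]; field_simp
    rw [e4] at e3
    have e5 : |q * ((∫ t in ((n : ℝ) * τ)..s, fderiv ℝ φ (t, x) (0, 1)) - lam * D)|
        ≤ (Icc (-(R + 1)) (R + 1)).indicator (fun _ => (A + L) * ω * τ) x := by
      rw [abs_mul]
      calc _ ≤ (A + L) * ((Icc (-(R + 1)) (R + 1)).indicator (fun _ => ω) x * τ) := by gcongr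
        _ = _ := by
          by_cases hx : x ∈ Icc (-(R + 1)) (R + 1)
          · rw [indicator_of_mem hx, indicator_of_mem hx]; ring
          · rw [indicator_of_notMem hx, indicator_of_notMem hx]; ring
    have e6 : |lam * (Q n j c - q) * D| ≤ lam * h * Λ * E n j := by
      rw [abs_mul, abs_mul, abs_of_pos hl]
      calc lam * |Q n j c - q| * |D| ≤ lam * E n j * (Λ * h) := by
            have := H.flux n j c
            have hE : 0 ≤ E n j := (abs_nonneg _).trans this
            have := hφ.abs_sub_le hh s x
            gcongr
        _ = _ := by ring
    rw [e2]
    have := (abs_le.1 e5).1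
    have := (abs_le.1 e6).2
    nlinarith
  have habel : ∀ n : ℕ, -(|u 0 j - c| * φ (0, x))
      + ∑ m ∈ Finset.range n, lam * (Q m (j + 1) c - Q m j c) * φ ((m + 1 : ℕ) * τ, x)
      + |u n j - c| * φ (n * τ, x)
      ≤ ∑ m ∈ Finset.range n, |u m j - c| * (φ ((m + 1 : ℕ) * τ, x) - φ (m * τ, x)) := fun n => by
    induction n with
    | zero => simp
    | succ n ih =>
      rw [Finset.sum_range_succ, Finset.sum_range_succ]
      have h1 := mul_le_mul_of_nonneg_right (H.entropy n j c)
        (hφ.nonneg ((n + 1 : ℕ) * τ) (by positivity) x)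
      nlinarith
  have h1 := habel N
  have hN' : R < |(N : ℝ) * τ| := lt_of_lt_of_le hN (le_abs_self _)
  rw [hφ.support _ x (Or.inl hN'), mul_zero, add_zero] at h1
  rw [hint, hj']
  refine le_trans ?_ (Finset.sum_le_sum fun n _ => hstep n)
  have h2 : ∑ n ∈ Finset.range N, lam * (Q n (j + 1) c * φ (((n : ℝ) + 1) * τ, x)
        - Q n j c * φ (((n : ℝ) + 1) * τ, x - h))
      = ∑ n ∈ Finset.range N, lam * (Q n (j + 1) c - Q n j c) * φ ((n + 1 : ℕ) * τ, x)
        + ∑ n ∈ Finset.range N,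
          lam * Q n j c * (φ ((n + 1 : ℕ) * τ, x) - φ ((n + 1 : ℕ) * τ, x - h)) := by
    rw [← Finset.sum_add_distrib]
    refine Finset.sum_congr rfl fun n _ => ?_
    push_cast; ring
  rw [h2]
  simp only [Finset.sum_sub_distrib, Finset.sum_add_distrib]
  linarith

theorem IsDiscreteEntropySolution.entropy_integral_ge (H : IsDiscreteEntropySolution V lam B u Q E)
    (hV : IsVelocity V A L) (hl : 0 < lam) (hh : 0 < h) (hh1 : h ≤ 1)
    (hc : c ∈ Icc (0 : ℝ) 1) (hφ : IsTestBound φ R Λ ω θ) (hθ : h < θ) (hτθ : lam * h < θ)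
    (hR : 0 ≤ R) {N : ℕ} (hN : R < N * (lam * h)) {e : ℝ} (he0 : 0 ≤ e)
    (he : ∀ n, ∑' j, ENNReal.ofReal (E n j) ≤ ENNReal.ofReal e) :
    -(N * (lam * h) * ((A + L) * ω * (2 * (R + 1)) + Λ * (h * e)))
      ≤ (∫ z, (|gridFun u lam h z.1 z.2 - c| * fderiv ℝ φ z (1, 0)
          + kruzkovFlux V c (gridFun u lam h z.1 z.2) * fderiv ℝ φ z (0, 1)) ∂halfPlane)
        + ∫ x, |u 0 (cellIndex h x) - c| * φ (0, x) := by
  have hM : 0 ≤ A + L := add_nonneg hV.bound_nonneg hV.lip_nonneg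
  have hΛ : 0 ≤ Λ := (abs_nonneg _).trans (hφ.bound 0)
  have hgm : Measurable fun z : ℝ × ℝ => gridFun u lam h z.1 z.2 := measurable_gridFun u lam h
  have hcm := measurable_cellIndex h
  have hE0 : ∀ n j, 0 ≤ E n j := fun n j => (abs_nonneg _).trans (H.flux n j c)
  have hEe : ∀ n j, E n j ≤ e := fun n j =>
    (ENNReal.ofReal_le_ofReal_iff he0).1 ((ENNReal.le_tsum j).trans (he n))
  have hq : ∀ w ∈ Icc (0 : ℝ) 1, |kruzkovFlux V c w| ≤ A + L := fun w hw =>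
    (hV.abs_kruzkovFlux_le hw).trans
      (mul_le_of_le_one_right hM (abs_sub_le_one_of_mem hw hc))
  have hQ : ∀ n j, |Q n j c| ≤ A + L + e := fun n j => by
    have h1 := (H.flux n j c).trans (hEe n j)
    have h2 := hq _ (H.mem n j)
    have h3 := abs_sub_abs_le_abs_sub (Q n j c) (kruzkovFlux V c (u n j))
    linarith
  set f : ℝ × ℝ → ℝ := fun z => |gridFun u lam h z.1 z.2 - c| * fderiv ℝ φ z (1, 0)
    + kruzkovFlux V c (gridFun u lam h z.1 z.2) * fderiv ℝ φ z (0, 1) with hf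
  have hfi : Integrable f ((volume.restrict (Ioi (0 : ℝ))).prod (volume : Measure ℝ)) := by
    rw [← halfPlane_eq_prod]
    refine Integrable.add (integrable_bounded_mul (K := 1) ?_ (ae_of_all _ fun z => ?_)
      (continuous_fderiv_const hφ.contDiff _) (hasCompactSupport_fderiv_const hφ.compact _))
      (integrable_bounded_mul (K := A + L) ?_ (ae_of_all _ fun z => ?_)
      (continuous_fderiv_const hφ.contDiff _) (hasCompactSupport_fderiv_const hφ.compact _))
    · exact (hgm.sub_const c).abs.aestronglyMeasurable
    · rw [abs_abs]; exact abs_sub_le_one_of_mem (H.mem _ _) hc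
    · have : Continuous fun w => kruzkovFlux V c w :=
        hV.continuous_kruzkovFlux.comp (by fun_prop : Continuous fun w : ℝ => (c, w))
      exact (this.measurable.comp hgm).aestronglyMeasurable
    · exact hq _ (H.mem _ _)
  have hslice : ∀ (s d : ℝ), Continuous (fun x => φ (s, x - d)) ∧
      HasCompactSupport fun x => φ (s, x - d) := fun s d => by
    refine ⟨hφ.contDiff.continuous.comp (by fun_prop), ?_⟩
    exact (hasCompactSupport_slice hφ.compact s).comp_homeomorph (Homeomorph.subRight d)
  set a : ℝ → ℝ := fun x => |u 0 (cellIndex h x) - c| * φ (0, x) with ha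
  have hai : Integrable a := by
    refine integrable_bounded_mul (K := 1) ?_ (ae_of_all _ fun x => ?_)
      (by simpa using (hslice 0 0).1) (by simpa using (hslice 0 0).2)
    · exact (((measurable_of_countable (u 0)).comp hcm).sub_const c).abs.aestronglyMeasurable
    · rw [abs_abs]; exact abs_sub_le_one_of_mem (H.mem _ _) hc
  have hQm : ∀ n, Measurable fun x => Q n (cellIndex h x) c := fun n =>
    (measurable_of_countable fun j => Q n j c).comp hcm
  set b₁ : ℕ → ℝ → ℝ := fun n x => Q n (cellIndex h (x + h)) c * φ ((n + 1) * (lam * h), x)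
    with hb₁
  set b₂ : ℕ → ℝ → ℝ := fun n x => Q n (cellIndex h x) c * φ ((n + 1) * (lam * h), x - h)
    with hb₂
  have hb₂i : ∀ n, Integrable (b₂ n) := fun n =>
    integrable_bounded_mul (K := A + L + e) (hQm n).aestronglyMeasurable
      (ae_of_all _ fun x => hQ _ _) (hslice _ _).1 (hslice _ _).2
  have hb₁₂ : ∀ n, b₁ n = fun x => b₂ n (x + h) := fun n => by
    ext x; simp only [hb₁, hb₂, add_sub_cancel_right]
  have hb₁i : ∀ n, Integrable (b₁ n) := fun n => by
    rw [hb₁₂]; exact (hb₂i n).comp_add_right h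
  have hbint : ∀ n, ∫ x, lam * (b₁ n x - b₂ n x) = 0 := fun n => by
    rw [integral_const_mul, integral_sub (hb₁i n) (hb₂i n), hb₁₂,
      integral_add_right_eq_self (b₂ n) h, sub_self, mul_zero]
  set i : ℝ → ℝ := (Icc (-(R + 1)) (R + 1)).indicator (fun _ => (A + L) * ω * (lam * h)) with hi
  have hii : Integrable i := (integrable_indicator_iff measurableSet_Icc).2
    continuous_const.integrableOn_Icc
  have hiint : ∫ x, i x = (A + L) * ω * (lam * h) * (2 * (R + 1)) := by
    rw [hi, integral_indicator measurableSet_Icc, setIntegral_const, smul_eq_mul, measureReal_def,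
      Real.volume_Icc, ENNReal.toReal_ofReal (by linarith)]
    ring
  have hEm : ∀ n, Measurable fun x => E n (cellIndex h x) := fun n =>
    (measurable_of_countable (E n)).comp hcm
  have hElin : ∀ n, ∫⁻ x, ENNReal.ofReal (E n (cellIndex h x)) ≤ ENNReal.ofReal (h * e) :=
    fun n => by
      rw [lintegral_comp_cellIndex hh (fun j => ENNReal.ofReal (E n j)), ENNReal.ofReal_mul hh.le]
      gcongr
      exact he n
  have hEi : ∀ n, Integrable fun x => E n (cellIndex h x) := fun n => by
    refine ⟨(hEm n).aestronglyMeasurable, ?_⟩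
    rw [hasFiniteIntegral_iff_ofReal (ae_of_all _ fun x => hE0 _ _)]
    exact (hElin n).trans_lt ENNReal.ofReal_lt_top
  have hEint : ∀ n, ∫ x, E n (cellIndex h x) ≤ h * e := fun n => by
    rw [integral_eq_lintegral_of_nonneg_ae (ae_of_all _ fun x => hE0 _ _)
      (hEm n).aestronglyMeasurable]
    exact ENNReal.toReal_le_of_le_ofReal (by positivity) (hElin n)
  have hT1 : ∀ n, Integrable fun x => lam * (b₁ n x - b₂ n x) := fun n =>
    ((hb₁i n).sub (hb₂i n)).const_mul lam
  have hT2 : ∀ n, Integrable fun x => i x + lam * h * Λ * E n (cellIndex h x) := fun n =>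
    hii.add ((hEi n).const_mul _)
  have hS1 : Integrable fun x => ∑ n ∈ Finset.range N, lam * (b₁ n x - b₂ n x) :=
    integrable_finsetSum _ fun n _ => hT1 n
  have hS2 : Integrable fun x => ∑ n ∈ Finset.range N,
      (i x + lam * h * Λ * E n (cellIndex h x)) :=
    integrable_finsetSum _ fun n _ => hT2 n
  have hna : Integrable fun x => -a x := hai.neg
  have hd : Integrable fun x => ∑ n ∈ Finset.range N, lam * (b₁ n x - b₂ n x)
      - ∑ n ∈ Finset.range N, (i x + lam * h * Λ * E n (cellIndex h x)) := hS1.sub hS2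
  have hmono := integral_mono (μ := volume)
    (f := fun x => -a x + (∑ n ∈ Finset.range N, lam * (b₁ n x - b₂ n x)
      - ∑ n ∈ Finset.range N, (i x + lam * h * Λ * E n (cellIndex h x))))
    (g := fun x => ∫ t in Ioi 0, f (t, x)) (hna.add hd) hfi.integral_prod_right
    (fun x => H.slice_ge hV hl hh hh1 hc hφ hθ hτθ hN x)
  rw [integral_add hna hd, integral_sub hS1 hS2, integral_neg,
    integral_finsetSum _ (fun n _ => hT1 n),
    integral_finsetSum _ (fun n _ => hT2 n),
    Finset.sum_congr rfl (fun n _ => hbint n), Finset.sum_const_zero] at hmono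
  have hsum : ∑ n ∈ Finset.range N, ∫ x, (i x + lam * h * Λ * E n (cellIndex h x))
      ≤ N * (lam * h) * ((A + L) * ω * (2 * (R + 1)) + Λ * (h * e)) := by
    calc _ ≤ ∑ n ∈ Finset.range N,
          (lam * h) * ((A + L) * ω * (2 * (R + 1)) + Λ * (h * e)) := by
          refine Finset.sum_le_sum fun n _ => ?_
          rw [integral_add hii ((hEi n).const_mul _), integral_const_mul, hiint]
          have := mul_le_mul_of_nonneg_left (hEint n) (by positivity : 0 ≤ lam * h * Λ)
          linarith
      _ = _ := by rw [Finset.sum_const, Finset.card_range, nsmul_eq_mul]; ring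
  rw [halfPlane_eq_prod, integral_prod_symm f hfi]
  linarith

end Consistency

/-! ### Compactness -/

lemma exists_isTestBound {φ : ℝ × ℝ → ℝ} (hφ : ContDiff ℝ 1 φ) (hs : HasCompactSupport φ)
    (hnn : ∀ t ≥ 0, ∀ x, 0 ≤ φ (t, x)) :
    ∃ R ≥ 0, ∃ Λ ≥ 0, ∀ ω > 0, ∃ θ > 0, IsTestBound φ R Λ ω θ := by
  obtain ⟨R, hR0, hR⟩ := hs.isBounded.subset_closedBall_lt 0 (0 : ℝ × ℝ)
  have hc := continuous_fderiv_const hφ (0, 1)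
  have hcs := hasCompactSupport_fderiv_const hs (0, 1)
  obtain ⟨Λ, hΛ⟩ := hc.bounded_above_of_compact_support hcs
  refine ⟨R, hR0.le, Λ, (norm_nonneg _).trans (hΛ 0), fun ω hω => ?_⟩
  obtain ⟨θ, hθ, hosc⟩ := Metric.uniformContinuous_iff.1 (hcs.uniformContinuous_of_continuous hc) ω hω
  refine ⟨θ, hθ, hφ, hs, hnn, fun t x h => ?_, hΛ, fun z z' hz => (hosc hz).le⟩
  refine image_eq_zero_of_notMem_tsupport fun hm => ?_
  have := hR hm
  rw [mem_closedBall_zero_iff, Prod.norm_def, max_le_iff] at this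
  rcases h with h | h
  · exact absurd this.1 (not_le.2 h)
  · exact absurd this.2 (not_le.2 h)

/-- The entropy inequality for a fixed test function holds up to a small error on fine meshes. -/
lemma exists_mesh_entropy_ge {V : ℝ → ℝ} {A L lam c e η : ℝ} (hV : IsVelocity V A L) (hl : 0 < lam)
    (hc : c ∈ Icc (0 : ℝ) 1) {φ : ℝ × ℝ → ℝ} (hφ : ContDiff ℝ 1 φ) (hs : HasCompactSupport φ)
    (hnn : ∀ t ≥ 0, ∀ x, 0 ≤ φ (t, x)) (he : 0 ≤ e) (hη : 0 < η) :
    ∃ h₀ > 0, ∀ h, 0 < h → h < h₀ → ∀ (B : ℝ≥0∞) u Q E, IsDiscreteEntropySolution V lam B u Q E →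
      (∀ n, ∑' j, ENNReal.ofReal (E n j) ≤ ENNReal.ofReal e) →
      -η ≤ (∫ z, (|gridFun u lam h z.1 z.2 - c| * fderiv ℝ φ z (1, 0)
          + kruzkovFlux V c (gridFun u lam h z.1 z.2) * fderiv ℝ φ z (0, 1)) ∂halfPlane)
        + ∫ x, |u 0 (cellIndex h x) - c| * φ (0, x) := by
  have hM : 0 ≤ A + L := add_nonneg hV.bound_nonneg hV.lip_nonneg
  obtain ⟨R, hR, Λ, hΛ, hex⟩ := exists_isTestBound hφ hs hnn
  set X := (R + lam) * ((A + L) * (2 * (R + 1))) with hX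
  set Y := (R + lam) * (Λ * e) with hY
  have hX0 : 0 ≤ X := by positivity
  have hY0 : 0 ≤ Y := by positivity
  obtain ⟨θ, hθ, hT⟩ := hex (η / 2 / (X + 1)) (by positivity)
  refine ⟨min (min 1 θ) (min (θ / lam) (η / 2 / (Y + 1))), by positivity,
    fun h hh hlt B u Q E H hE => ?_⟩
  simp only [lt_min_iff] at hlt
  obtain ⟨⟨h1, h2⟩, h3, h4⟩ := hlt
  have hτ : 0 < lam * h := mul_pos hl hh
  have hN := (div_lt_iff₀ hτ).1 (Nat.lt_floor_add_one (R / (lam * h)))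
  have hN' := (le_div_iff₀ hτ).1 (Nat.floor_le (div_nonneg hR hτ.le))
  have key := H.entropy_integral_ge hV hl hh h1.le hc hT h2
    (by rw [lt_div_iff₀ hl] at h3; linarith) hR (N := ⌊R / (lam * h)⌋₊ + 1)
    (by push_cast; exact hN) he hE
  refine le_trans (neg_le_neg ?_) key
  have hNle : ((⌊R / (lam * h)⌋₊ + 1 : ℕ) : ℝ) * (lam * h) ≤ R + lam := by
    push_cast
    have : lam * h ≤ lam := mul_le_of_le_one_right hl.le h1.le
    linarith
  calc _ ≤ (R + lam) * ((A + L) * (η / 2 / (X + 1)) * (2 * (R + 1)) + Λ * (h * e)) := by gcongr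
    _ = X * (η / 2 / (X + 1)) + Y * h := by rw [hX, hY]; ring
    _ ≤ (X + 1) * (η / 2 / (X + 1)) + (Y + 1) * (η / 2 / (Y + 1)) := by
        gcongr <;> linarith
    _ = η := by field_simp; ring

lemma lintegral_enorm_sample_sub_le (f : ℝ → ℝ) {s : ℝ} (hs : 0 < s) :
    ∫⁻ x, ‖f (⌊x * s⌋ / s) - f x‖ₑ ≤ ENNReal.ofReal (1 / s) * eVariationOn f univ := by
  rw [lintegral_eq_tsum_Ico (z := 1 / s) (by positivity) 0]
  have hmono : Monotone fun k : ℤ => (k : ℝ) / s := fun a b hab => by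
    have : (a : ℝ) ≤ b := by exact_mod_cast hab
    simp only; gcongr
  refine le_trans ?_ (mul_le_mul_right (tsum_eVariationOn_Icc_le f hmono) _)
  rw [← ENNReal.tsum_mul_left]
  refine ENNReal.tsum_le_tsum fun k => ?_
  calc _ ≤ ∫⁻ x in Ico 0 (0 + 1 / s), eVariationOn f (Icc ((k : ℝ) / s) (((k + 1 : ℤ) : ℝ) / s)) := by
        refine setLIntegral_mono' measurableSet_Ico fun x hx => ?_
        rw [zero_add] at hx
        have hx2 := (lt_div_iff₀ hs).1 hx.2
        have hfl : ⌊(x + k * (1 / s)) * s⌋ = k := by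
          rw [Int.floor_eq_iff, add_mul, mul_assoc, one_div_mul_cancel hs.ne', mul_one]
          constructor
          · linarith [mul_nonneg hx.1 hs.le]
          · linarith
        rw [hfl]
        refine enorm_sub_le_eVariationOn f ⟨le_rfl, ?_⟩ ⟨?_, ?_⟩
        · push_cast; gcongr; linarith
        · rw [mul_one_div]; linarith [hx.1]
        · push_cast; rw [add_div, mul_one_div]; linarith [hx.2]
    _ = _ := by
        rw [setLIntegral_const, Real.volume_Ico, mul_comm]; congr 2; ring

/-- Functions of time and space of uniformly bounded variation in space that are almost Lipschitz
continuous in time with values in `L¹` are relatively compact in `L¹_loc` at all times. -/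
theorem exists_subseq_tendsto_of_variation {u : ℕ → ℝ → ℝ → ℝ} {B : ℝ≥0∞} {lam : ℝ} {h : ℕ → ℝ}
    (hB : B ≠ ⊤) (hl : 0 < lam) (hh0 : ∀ m, 0 ≤ h m) (hh : Tendsto h atTop (𝓝 0))
    (hmem : ∀ m t x, u m t x ∈ Icc (0 : ℝ) 1) (hmeas : ∀ m t, Measurable (u m t))
    (hvar : ∀ m t, eVariationOn (u m t) univ ≤ B)
    (htime : ∀ m, ∀ s ≥ 0, ∀ t ≥ 0,
      ∫⁻ x, ‖u m t x - u m s x‖ₑ ≤ ENNReal.ofReal (|t - s| / lam + h m) * B) :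
    ∃ ρ : ℝ → ℝ → ℝ, Measurable (Function.uncurry ρ) ∧ (∀ t x, ρ t x ∈ Icc (0 : ℝ) 1) ∧
      ∃ σ : ℕ → ℕ, StrictMono σ ∧ ∀ t ≥ 0, ∀ R : ℝ,
        Tendsto (fun m => ∫⁻ x in Icc (-R) R, ‖u (σ m) t x - ρ t x‖ₑ) atTop (𝓝 0) := by
  obtain ⟨U, σ, hσ, hU⟩ := CompactSpace.tendsto_subseq
    (fun m => (fun i : ℕ × ℕ × ℤ => (⟨u m (i.2.1 / 2 ^ i.1) (i.2.2 / 2 ^ i.1), hmem _ _ _⟩ :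
      Icc (0 : ℝ) 1)))
  have hUlim : ∀ (k n : ℕ) (i : ℤ), Tendsto (fun m => u (σ m) (n / 2 ^ k) (i / 2 ^ k)) atTop
      (𝓝 (U (k, n, i) : ℝ)) := fun k n i =>
    (continuous_subtype_val.tendsto _).comp ((tendsto_pi_nhds.1 hU) (k, n, i))
  have hUmem : ∀ i, (U i : ℝ) ∈ Icc (0 : ℝ) 1 := fun i => (U i).2
  set g : ℕ → ℝ → ℝ → ℝ := fun k t x => U (k, ⌊t * 2 ^ k⌋₊, ⌊x * 2 ^ k⌋) with hg
  have hgmeas : ∀ k, Measurable (Function.uncurry (g k)) := fun k => by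
    have h1 : Measurable fun z : ℝ × ℝ => (⌊z.1 * 2 ^ k⌋₊, ⌊z.2 * 2 ^ k⌋) :=
      (Nat.measurable_floor.comp (by fun_prop)).prodMk (Int.measurable_floor.comp (by fun_prop))
    exact (measurable_of_countable (fun p : ℕ × ℤ => (U (k, p.1, p.2) : ℝ))).comp h1
  have hgm : ∀ k t, Measurable (g k t) := fun k t => (hgmeas k).of_uncurry_left
  set c : ℕ → ℝ≥0∞ := fun k => ENNReal.ofReal ((1 + 1 / lam) * (1 / 2) ^ k) * B with hc
  have hcsum : ∑' k, c k ≠ ⊤ := by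
    simp only [hc]
    rw [ENNReal.tsum_mul_right, ← ENNReal.ofReal_tsum_of_nonneg (fun k => by positivity)
      (summable_geometric_two.mul_left _)]
    exact ENNReal.mul_ne_top ENNReal.ofReal_ne_top hB
  have hc0 : Tendsto c atTop (𝓝 0) := ENNReal.tendsto_atTop_zero_of_tsum_ne_top hcsum
  -- comparison with the dyadic samples
  have hnear : ∀ (R : ℝ) (k : ℕ), ∀ t ≥ 0, ∀ η > 0, ∀ᶠ m in atTop,
      ∫⁻ x in Icc (-R) R, ‖g k t x - u (σ m) t x‖ₑ ≤ c k + η := fun R k t ht η hη => by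
    set n := ⌊t * 2 ^ k⌋₊ with hn
    have h2k : (0 : ℝ) < 2 ^ k := by positivity
    have hn1 : (n : ℝ) / 2 ^ k ≤ t := by
      rw [div_le_iff₀ h2k]; exact Nat.floor_le (by positivity)
    have hn2 : t - n / 2 ^ k ≤ (1 / 2) ^ k := by
      have : t < (n + 1) / 2 ^ k := by
        rw [lt_div_iff₀ h2k]; exact Nat.lt_floor_add_one _
      rw [add_div] at this
      rw [one_div_pow]; linarith
    have hsamp : ∀ m, Measurable fun x : ℝ =>
        ‖(U (k, n, ⌊x * 2 ^ k⌋) : ℝ) - u (σ m) (n / 2 ^ k) (⌊x * 2 ^ k⌋ / 2 ^ k)‖ₑ := fun m => by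
      have h1 : Measurable fun x : ℝ => ⌊x * 2 ^ k⌋ := Int.measurable_floor.comp (by fun_prop)
      exact (measurable_of_countable (fun i : ℤ =>
        ‖(U (k, n, i) : ℝ) - u (σ m) (n / 2 ^ k) (i / 2 ^ k)‖ₑ)).comp h1
    have hlim1 : Tendsto (fun m => ∫⁻ x in Icc (-R) R,
        ‖(U (k, n, ⌊x * 2 ^ k⌋) : ℝ) - u (σ m) (n / 2 ^ k) (⌊x * 2 ^ k⌋ / 2 ^ k)‖ₑ) atTop (𝓝 0) := by
      have := tendsto_lintegral_of_dominated_convergence (μ := volume.restrict (Icc (-R) R))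
        (f := fun _ => 0) (fun _ => 1) hsamp (fun m => ae_of_all _ fun x => ?_) ?_
        (ae_of_all _ fun x => ?_)
      · simpa using this
      · simp only [Real.enorm_eq_ofReal_abs]
        exact ENNReal.ofReal_le_one.2 (abs_sub_le_one_of_mem (hUmem _) (hmem _ _ _))
      · simp
      · have h1 := (hUlim k n ⌊x * 2 ^ k⌋).const_sub (U (k, n, ⌊x * 2 ^ k⌋) : ℝ)
        rw [sub_self] at h1
        simpa using h1.enorm
    have hlim2 : Tendsto (fun m => ENNReal.ofReal (h (σ m)) * B) atTop (𝓝 0) := by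
      have := ENNReal.Tendsto.mul_const (b := B)
        (ENNReal.tendsto_ofReal (hh.comp hσ.tendsto_atTop)) (Or.inr hB)
      simpa using this
    have hlim := hlim1.add hlim2
    rw [add_zero] at hlim
    filter_upwards [(ENNReal.tendsto_nhds_zero.1 hlim) η hη] with m hm
    have hm1 := hsamp m
    have hm2 : Measurable fun x : ℝ => ‖u (σ m) (n / 2 ^ k) x - u (σ m) t x‖ₑ :=
      ((hmeas _ _).sub (hmeas _ _)).enorm
    calc _ ≤ ∫⁻ x in Icc (-R) R,
          (‖(U (k, n, ⌊x * 2 ^ k⌋) : ℝ) - u (σ m) (n / 2 ^ k) (⌊x * 2 ^ k⌋ / 2 ^ k)‖ₑ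
          + (‖u (σ m) (n / 2 ^ k) (⌊x * 2 ^ k⌋ / 2 ^ k) - u (σ m) (n / 2 ^ k) x‖ₑ
            + ‖u (σ m) (n / 2 ^ k) x - u (σ m) t x‖ₑ)) := by
          refine lintegral_mono fun x => ?_
          refine le_trans (le_of_eq ?_) ((enorm_add_le _ _).trans
            (add_le_add le_rfl (enorm_add_le _ _)))
          simp only [hg, ← hn]
          congr 1; ring
      _ ≤ (∫⁻ x in Icc (-R) R,
            ‖(U (k, n, ⌊x * 2 ^ k⌋) : ℝ) - u (σ m) (n / 2 ^ k) (⌊x * 2 ^ k⌋ / 2 ^ k)‖ₑ)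
          + (ENNReal.ofReal (1 / 2 ^ k) * B
            + ENNReal.ofReal ((1 / 2) ^ k / lam + h (σ m)) * B) := by
          rw [lintegral_add_left hm1, lintegral_add_right _ hm2]
          refine add_le_add le_rfl (add_le_add ?_ ?_)
          · refine (setLIntegral_le_lintegral _ _).trans
              ((lintegral_enorm_sample_sub_le _ h2k).trans ?_)
            gcongr
            exact hvar _ _
          · refine (setLIntegral_le_lintegral _ _).trans
              ((htime (σ m) t ht (n / 2 ^ k) (by positivity)).trans ?_)
            gcongr
            rw [abs_sub_comm, abs_of_nonneg (by linarith)]; exact hn2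
      _ = c k + ((∫⁻ x in Icc (-R) R,
            ‖(U (k, n, ⌊x * 2 ^ k⌋) : ℝ) - u (σ m) (n / 2 ^ k) (⌊x * 2 ^ k⌋ / 2 ^ k)‖ₑ)
          + ENNReal.ofReal (h (σ m)) * B) := by
          simp only [hc]
          rw [ENNReal.ofReal_add (by positivity) (hh0 _), add_mul 1, one_mul,
            ENNReal.ofReal_add (by positivity) (by positivity), one_div_pow,
            show 1 / lam * (1 / 2 ^ k) = 1 / 2 ^ k / lam by ring]
          ring
      _ ≤ c k + η := by gcongr
  have hcauchy : ∀ (R : ℝ) (k l : ℕ), ∀ t ≥ 0,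
      ∫⁻ x in Icc (-R) R, ‖g k t x - g l t x‖ₑ ≤ c k + c l := fun R k l t ht => by
    refine ENNReal.le_of_forall_pos_le_add fun η hη _ => ?_
    have hη2 : (0 : ℝ≥0∞) < η / 2 := by simpa using hη.ne'
    obtain ⟨m, hm1, hm2⟩ := ((hnear R k t ht _ hη2).and (hnear R l t ht _ hη2)).exists
    have hm : Measurable fun x => ‖g l t x - u (σ m) t x‖ₑ := ((hgm l t).sub (hmeas _ _)).enorm
    calc _ ≤ ∫⁻ x in Icc (-R) R, (‖g k t x - u (σ m) t x‖ₑ + ‖g l t x - u (σ m) t x‖ₑ) := by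
          refine lintegral_mono fun x => ?_
          rw [← sub_sub_sub_cancel_right _ _ (u (σ m) t x)]
          exact enorm_sub_le
      _ ≤ (c k + (η : ℝ≥0∞) / 2) + (c l + (η : ℝ≥0∞) / 2) := by
          rw [lintegral_add_right _ hm]; exact add_le_add hm1 hm2
      _ = c k + c l + ((η : ℝ≥0∞) / 2 + (η : ℝ≥0∞) / 2) := by ring
      _ = _ := by rw [ENNReal.add_halves]
  set ρ : ℝ → ℝ → ℝ := fun t x => max 0 (min 1 (limsup (fun k => g k t x) atTop)) with hρ
  have hρm : Measurable (Function.uncurry ρ) :=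
    measurable_const.max (measurable_const.min (Measurable.limsup hgmeas))
  have hgρ : ∀ R : ℝ, ∀ t ≥ 0, ∀ᵐ x ∂(volume.restrict (Icc (-R) R)),
      Tendsto (fun k => g k t x) atTop (𝓝 (ρ t x)) := fun R t ht => by
    have hm : ∀ k, AEMeasurable (fun x => ‖g k t x - g (k + 1) t x‖ₑ)
        (volume.restrict (Icc (-R) R)) := fun k => ((hgm k t).sub (hgm _ t)).enorm.aemeasurable
    have hfin : ∫⁻ x in Icc (-R) R, ∑' k, ‖g k t x - g (k + 1) t x‖ₑ ≠ ⊤ := by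
      rw [lintegral_tsum hm]
      refine ne_top_of_le_ne_top ?_ (ENNReal.tsum_le_tsum fun k => hcauchy R k (k + 1) t ht)
      rw [ENNReal.tsum_add]
      refine ENNReal.add_ne_top.2 ⟨hcsum, ne_top_of_le_ne_top hcsum ?_⟩
      exact ENNReal.tsum_comp_le_tsum_of_injective (add_left_injective 1) c
    filter_upwards [ae_lt_top' (AEMeasurable.tsum hm) hfin] with x hx
    have hcs : CauchySeq fun k => g k t x :=
      cauchySeq_of_edist_le_of_tsum_ne_top _ (fun k => (edist_eq_enorm_sub _ _).le) hx.ne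
    obtain ⟨y, hy⟩ := cauchySeq_tendsto_of_complete hcs
    have hyI : y ∈ Icc (0 : ℝ) 1 := isClosed_Icc.mem_of_tendsto hy (Eventually.of_forall
      fun k => hUmem _)
    have : ρ t x = y := by
      simp only [hρ]
      rw [hy.limsup_eq, min_eq_right hyI.2, max_eq_right hyI.1]
    rwa [this]
  have hgρ' : ∀ (R : ℝ) (k : ℕ), ∀ t ≥ 0, ∫⁻ x in Icc (-R) R, ‖g k t x - ρ t x‖ₑ ≤ c k :=
    fun R k t ht => by
      have h1 := lintegral_enorm_le_liminf_of_tendsto (μ := volume.restrict (Icc (-R) R))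
        (G := fun l x => g k t x - g l t x) (f := fun x => g k t x - ρ t x)
        ((hgρ R t ht).mono fun x hx => hx.const_sub _)
        (fun l => ((hgm k t).sub (hgm l t)).enorm.aemeasurable)
      refine h1.trans ((liminf_le_liminf (Eventually.of_forall fun l => hcauchy R k l t ht)).trans
        (le_of_eq ?_))
      have h2 : Tendsto (fun l => c k + c l) atTop (𝓝 (c k + 0)) := hc0.const_add _
      rw [h2.liminf_eq, add_zero]
  refine ⟨ρ, hρm, fun t x => ⟨le_max_left _ _, max_le zero_le_one (min_le_left _ _)⟩, σ, hσ,
    fun t ht R => ?_⟩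
  refine ENNReal.tendsto_nhds_zero.2 fun η hη => ?_
  have hη3 : (0 : ℝ≥0∞) < η / 3 := ENNReal.div_pos hη.ne' (by norm_num)
  obtain ⟨k, hk⟩ := ((ENNReal.tendsto_nhds_zero.1 hc0) _ hη3).exists
  filter_upwards [hnear R k t ht _ hη3] with m hm
  have hmm : Measurable fun x => ‖g k t x - u (σ m) t x‖ₑ := ((hgm k t).sub (hmeas _ _)).enorm
  calc _ ≤ ∫⁻ x in Icc (-R) R, (‖g k t x - u (σ m) t x‖ₑ + ‖g k t x - ρ t x‖ₑ) := by
        refine lintegral_mono fun x => ?_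
        rw [add_comm, ← sub_sub_sub_cancel_left _ _ (g k t x)]
        exact enorm_sub_le
    _ ≤ (c k + η / 3) + c k := by
        rw [lintegral_add_left hmm]; exact add_le_add hm (hgρ' R k t ht)
    _ ≤ (η / 3 + η / 3) + η / 3 := by gcongr
    _ = η := ENNReal.add_thirds η

/-! ### Existence of the entropy solution -/

section Convergence

variable {ι : Type*} {l : Filter ι} {u : ι → ℝ → ℝ → ℝ} {ρ : ℝ → ℝ → ℝ}

lemma tendsto_lintegral_box [l.IsCountablyGenerated] (hum : ∀ i, Measurable (Function.uncurry (u i)))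
    (hρm : Measurable (Function.uncurry ρ)) (humem : ∀ᶠ i in l, ∀ t x, u i t x ∈ Icc (0 : ℝ) 1)
    (hρmem : ∀ t x, ρ t x ∈ Icc (0 : ℝ) 1) {R : ℝ}
    (hconv : ∀ t ≥ 0, Tendsto (fun i => ∫⁻ x in Icc (-R) R, ‖u i t x - ρ t x‖ₑ) l (𝓝 0)) :
    Tendsto (fun i => ∫⁻ z in Icc 0 R ×ˢ Icc (-R) R, ‖u i z.1 z.2 - ρ z.1 z.2‖ₑ) l (𝓝 0) := by
  have hle : ∀ i, ∫⁻ z in Icc 0 R ×ˢ Icc (-R) R, ‖u i z.1 z.2 - ρ z.1 z.2‖ₑ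
      ≤ ∫⁻ t in Icc 0 R, ∫⁻ x in Icc (-R) R, ‖u i t x - ρ t x‖ₑ := fun i => by
    rw [Measure.volume_eq_prod, ← Measure.prod_restrict]
    exact lintegral_prod_le _
  have hlim := tendsto_lintegral_filter_of_dominated_convergence
    (μ := volume.restrict (Icc 0 R)) (l := l)
    (F := fun i t => ∫⁻ x in Icc (-R) R, ‖u i t x - ρ t x‖ₑ) (f := fun _ => 0)
    (fun _ => volume (Icc (-R) R)) (Eventually.of_forall fun i => ?_) ?_ ?_ ?_
  · rw [lintegral_zero] at hlim
    exact tendsto_of_tendsto_of_tendsto_of_le_of_le tendsto_const_nhds hlim (fun _ => zero_le) hle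
  · have : Measurable fun z : ℝ × ℝ => ‖u i z.1 z.2 - ρ z.1 z.2‖ₑ := ((hum i).sub hρm).enorm
    exact this.lintegral_prod_right'
  · filter_upwards [humem] with i hi
    refine ae_of_all _ fun t => ?_
    calc ∫⁻ x in Icc (-R) R, ‖u i t x - ρ t x‖ₑ ≤ ∫⁻ _ in Icc (-R) R, 1 := by
          refine lintegral_mono fun x => ?_
          simp only [Real.enorm_eq_ofReal_abs]
          exact ENNReal.ofReal_le_one.2 (abs_sub_le_one_of_mem (hi t x) (hρmem t x))
      _ = _ := by simp
  · rw [lintegral_const]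
    simp only [Real.volume_Icc, Measure.restrict_apply_univ]
    exact ENNReal.mul_ne_top ENNReal.ofReal_ne_top ENNReal.ofReal_ne_top
  · filter_upwards [ae_restrict_mem measurableSet_Icc] with t ht
    exact hconv t ht.1

lemma tendsto_lintegral_halfPlane_mul
    (hbox : ∀ R : ℝ, Tendsto (fun i => ∫⁻ z in Icc 0 R ×ˢ Icc (-R) R,
      ‖u i z.1 z.2 - ρ z.1 z.2‖ₑ) l (𝓝 0)) {k : ℝ × ℝ → ℝ} (hk : Continuous k)
    (hks : HasCompactSupport k) :
    Tendsto (fun i => ∫⁻ z, ENNReal.ofReal (k z) * ‖u i z.1 z.2 - ρ z.1 z.2‖ₑ ∂halfPlane) l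
      (𝓝 0) := by
  obtain ⟨R, hR⟩ := hks.isBounded.subset_closedBall (0 : ℝ × ℝ)
  obtain ⟨b, hb⟩ := hk.bounded_above_of_compact_support hks
  have hlim := ENNReal.Tendsto.const_mul (a := ENNReal.ofReal b) (hbox R)
    (Or.inr ENNReal.ofReal_ne_top)
  rw [mul_zero] at hlim
  refine tendsto_of_tendsto_of_tendsto_of_le_of_le tendsto_const_nhds hlim (fun _ => zero_le)
    fun i => ?_
  simp only
  rw [← lintegral_const_mul' _ _ ENNReal.ofReal_ne_top,
    ← lintegral_indicator (measurableSet_Icc.prod measurableSet_Icc)]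
  refine le_trans ?_ (setLIntegral_le_lintegral (Ioi (0 : ℝ) ×ˢ univ) _)
  refine setLIntegral_mono' (measurableSet_Ioi.prod MeasurableSet.univ) fun z hz => ?_
  by_cases hm : z ∈ Icc 0 R ×ˢ Icc (-R) R
  · rw [indicator_of_mem hm]
    gcongr
    exact (le_abs_self _).trans (hb z)
  · rw [indicator_of_notMem hm]
    have : k z = 0 := by
      refine image_eq_zero_of_notMem_tsupport fun hmem => hm ?_
      have h1 := hR hmem
      rw [mem_closedBall_zero_iff, Prod.norm_def, max_le_iff] at h1
      exact ⟨⟨le_of_lt hz.1, (le_abs_self _).trans h1.1⟩, abs_le.1 h1.2⟩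
    simp [this]

end Convergence

section Existence

variable {V ρ₀ : ℝ → ℝ} {A L lam : ℝ}

lemma SchemeData.tsum_fluxError_pointWeight_le {h : ℝ}
    (H : SchemeData V A L ρ₀ pointWeight lam h) (n : ℕ) :
    ∑' j, ENNReal.ofReal (fluxError A L pointWeight (schemeImpact V ρ₀ pointWeight lam h n) j)
      ≤ ENNReal.ofReal (2 * A * (totalVariation ρ₀).toReal) := by
  have hA := H.vel.bound_nonneg
  unfold fluxError
  simp_rw [spread_pointWeight, mul_zero, add_zero]
  rw [tsum_ofReal_mul_abs_sub (by positivity), ENNReal.ofReal_mul (p := 2 * A) (by positivity),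
    ENNReal.ofReal_toReal H.datum.totalVariation_lt_top.ne]
  gcongr
  exact H.seqVar_le n

lemma gridFun_zero (u : ℕ → ℤ → ℝ) (lam h x : ℝ) : gridFun u lam h 0 x = u 0 (cellIndex h x) := by
  simp [gridFun]

/-- The entropy inequality passes to the limit. -/
lemma entropy_of_tendsto (hV : IsVelocity V A L) (hρ₀ : IsAdmissibleDatum ρ₀) (hl : 0 < lam)
    (hcfl : lam * (A + L) ≤ 1) {h : ℕ → ℝ} (hh0 : ∀ m, 0 < h m) (hh : Tendsto h atTop (𝓝 0))
    {ρ : ℝ → ℝ → ℝ} (hρm : Measurable (Function.uncurry ρ))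
    (hρmem : ∀ t x, ρ t x ∈ Icc (0 : ℝ) 1)
    (hconv : ∀ t ≥ 0, ∀ R : ℝ, Tendsto (fun m => ∫⁻ x in Icc (-R) R,
      ‖gridFun (schemeImpact V ρ₀ pointWeight lam (h m)) lam (h m) t x - ρ t x‖ₑ) atTop (𝓝 0))
    (hinit : ρ 0 =ᵐ[volume] ρ₀) : IsEntropySolution V ρ₀ ρ := by
  have hM : 0 ≤ A + L := add_nonneg hV.bound_nonneg hV.lip_nonneg
  have H : ∀ m, SchemeData V A L ρ₀ pointWeight lam (h m) := fun m =>
    ⟨hV, hρ₀, isWeight_pointWeight, hl, hcfl, hh0 m⟩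
  have hD := fun m => (H m).isDiscreteEntropySolution
  set u : ℕ → ℝ → ℝ → ℝ :=
    fun m => gridFun (schemeImpact V ρ₀ pointWeight lam (h m)) lam (h m) with hu
  have hum : ∀ m, Measurable (Function.uncurry (u m)) := fun m => measurable_gridFun _ _ _
  have humem : ∀ m t x, u m t x ∈ Icc (0 : ℝ) 1 := fun m t x => (hD m).gridFun_mem _ t x
  refine ⟨hρm.aestronglyMeasurable, ae_of_all _ fun z => hρmem _ _, fun c hc φ hφ hs hnn => ?_⟩
  have hq : Continuous fun w => kruzkovFlux V c w :=
    hV.continuous_kruzkovFlux.comp (by fun_prop : Continuous fun w : ℝ => (c, w))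
  have hc1 := continuous_fderiv_const hφ (1, 0)
  have hc2 := continuous_fderiv_const hφ (0, 1)
  have hs1 := hasCompactSupport_fderiv_const hs (1, 0)
  have hs2 := hasCompactSupport_fderiv_const hs (0, 1)
  set f : (ℝ → ℝ → ℝ) → ℝ × ℝ → ℝ := fun v z => |v z.1 z.2 - c| * fderiv ℝ φ z (1, 0)
    + kruzkovFlux V c (v z.1 z.2) * fderiv ℝ φ z (0, 1) with hf
  have hfi : ∀ v : ℝ → ℝ → ℝ, Measurable (Function.uncurry v) → (∀ t x, v t x ∈ Icc (0 : ℝ) 1) →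
      Integrable (f v) halfPlane := fun v hvm hv => by
    have hvm' : Measurable fun z : ℝ × ℝ => v z.1 z.2 := hvm
    refine Integrable.add (integrable_bounded_mul (K := 1) ?_ (ae_of_all _ fun z => ?_) hc1 hs1)
      (integrable_bounded_mul (K := A + L) ?_ (ae_of_all _ fun z => ?_) hc2 hs2)
    · exact (hvm'.sub_const c).abs.aestronglyMeasurable
    · rw [abs_abs]; exact abs_sub_le_one_of_mem (hv _ _) hc
    · exact (hq.measurable.comp hvm').aestronglyMeasurable
    · exact (hV.abs_kruzkovFlux_le (hv _ _)).trans
        (mul_le_of_le_one_right hM (abs_sub_le_one_of_mem (hv _ _) hc))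
  have hlim1 : Tendsto (fun m => ∫ z, f (u m) z ∂halfPlane) atTop (𝓝 (∫ z, f ρ z ∂halfPlane)) := by
    refine tendsto_integral_of_L1 _ (hfi ρ hρm hρmem).1
      (Eventually.of_forall fun m => hfi _ (hum m) (humem m)) ?_
    refine tendsto_of_tendsto_of_tendsto_of_le_of_le tendsto_const_nhds
      (tendsto_lintegral_halfPlane_mul (fun R => tendsto_lintegral_box hum hρm
        (Eventually.of_forall humem) hρmem fun t ht => hconv t ht R)
        (k := fun z => |fderiv ℝ φ z (1, 0)| + (A + L) * |fderiv ℝ φ z (0, 1)|)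
        (by fun_prop) ?_) (fun _ => zero_le) fun m => lintegral_mono fun z => ?_
    · exact hs1.abs.add (hs2.abs.mul_left (f := fun _ => A + L))
    · rw [Real.enorm_eq_ofReal_abs, Real.enorm_eq_ofReal_abs, ← ENNReal.ofReal_mul (by positivity)]
      refine ENNReal.ofReal_le_ofReal ?_
      have e : f (u m) z - f ρ z = (|u m z.1 z.2 - c| - |ρ z.1 z.2 - c|) * fderiv ℝ φ z (1, 0)
          + (kruzkovFlux V c (u m z.1 z.2) - kruzkovFlux V c (ρ z.1 z.2)) * fderiv ℝ φ z (0, 1) := by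
        simp only [hf]; ring
      rw [e]
      refine (abs_add_le _ _).trans ?_
      rw [abs_mul, abs_mul]
      have h1 : |(|u m z.1 z.2 - c| - |ρ z.1 z.2 - c|)| ≤ |u m z.1 z.2 - ρ z.1 z.2| := by
        refine (abs_abs_sub_abs_le_abs_sub _ _).trans (le_of_eq ?_)
        rw [sub_sub_sub_cancel_right]
      have h2 := hV.abs_kruzkovFlux_sub_le (c := c) (humem m z.1 z.2) (hρmem z.1 z.2)
      have h3 := mul_le_mul_of_nonneg_right h1 (abs_nonneg (fderiv ℝ φ z (1, 0)))
      have h4 := mul_le_mul_of_nonneg_right h2 (abs_nonneg (fderiv ℝ φ z (0, 1)))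
      nlinarith
  have hφ0c : Continuous fun x => φ (0, x) := hφ.continuous.comp (by fun_prop)
  have hφ0s : HasCompactSupport fun x => φ (0, x) := hasCompactSupport_slice hs 0
  have hai : ∀ v : ℝ → ℝ, Measurable v → (∀ x, v x ∈ Icc (0 : ℝ) 1) →
      Integrable fun x => |v x - c| * φ (0, x) := fun v hvm hv =>
    integrable_bounded_mul (K := 1) (hvm.sub_const c).abs.aestronglyMeasurable
      (ae_of_all _ fun x => by rw [abs_abs]; exact abs_sub_le_one_of_mem (hv _) hc) hφ0c hφ0s
  have hlim2 : Tendsto (fun m => ∫ x, |u m 0 x - c| * φ (0, x)) atTop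
      (𝓝 (∫ x, |ρ₀ x - c| * φ (0, x))) := by
    have hρ0 : ∫ x, |ρ₀ x - c| * φ (0, x) = ∫ x, |ρ 0 x - c| * φ (0, x) :=
      integral_congr_ae (hinit.mono fun x hx => by simp only [hx])
    rw [hρ0]
    refine tendsto_integral_of_L1 _ (hai _ hρm.of_uncurry_left (hρmem 0)).1
      (Eventually.of_forall fun m => hai _ (hum m).of_uncurry_left (humem m 0)) ?_
    obtain ⟨R, hR⟩ := hφ0s.isBounded.subset_closedBall (0 : ℝ)
    obtain ⟨b, hb⟩ := hφ0c.bounded_above_of_compact_support hφ0s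
    have hlim := ENNReal.Tendsto.const_mul (a := ENNReal.ofReal b) (hconv 0 le_rfl R)
      (Or.inr ENNReal.ofReal_ne_top)
    rw [mul_zero] at hlim
    refine tendsto_of_tendsto_of_tendsto_of_le_of_le tendsto_const_nhds hlim (fun _ => zero_le)
      fun m => ?_
    simp only
    rw [← lintegral_const_mul' _ _ ENNReal.ofReal_ne_top, ← lintegral_indicator measurableSet_Icc]
    refine lintegral_mono fun x => ?_
    rw [← sub_mul, enorm_mul]
    by_cases hx : x ∈ Icc (-R) R
    · rw [indicator_of_mem hx, mul_comm]
      refine mul_le_mul' ?_ ?_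
      · rw [Real.enorm_eq_ofReal_abs]; exact ENNReal.ofReal_le_ofReal (hb x)
      · rw [Real.enorm_eq_ofReal_abs, Real.enorm_eq_ofReal_abs]
        refine ENNReal.ofReal_le_ofReal ((abs_abs_sub_abs_le_abs_sub _ _).trans (le_of_eq ?_))
        rw [sub_sub_sub_cancel_right]
    · rw [indicator_of_notMem hx]
      have : φ (0, x) = 0 := by
        refine image_eq_zero_of_notMem_tsupport (f := fun x => φ (0, x)) fun hmem => hx ?_
        have h1 := hR hmem
        rw [mem_closedBall_zero_iff] at h1
        exact abs_le.1 h1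
      simp [this]
  refine le_of_forall_pos_sub_le fun η hη => ?_
  obtain ⟨h₀, hh₀, hmesh⟩ := exists_mesh_entropy_ge hV hl hc hφ hs hnn
    (e := 2 * A * (totalVariation ρ₀).toReal)
    (mul_nonneg (mul_nonneg zero_le_two hV.bound_nonneg) ENNReal.toReal_nonneg) hη
  rw [zero_sub]
  refine ge_of_tendsto (hlim1.add hlim2) ?_
  filter_upwards [hh.eventually_lt_const hh₀] with m hm
  have := hmesh (h m) (hh0 m) hm _ _ _ _ (hD m) (H m).tsum_fluxError_pointWeight_le
  simpa only [hf, hu, gridFun_zero] using this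

end Existence

section Solution

variable {V ρ₀ : ℝ → ℝ} {A L lam : ℝ}

lemma isTimeContinuous_of_lintegral_le {ρ : ℝ → ℝ → ℝ} (hρm : Measurable (Function.uncurry ρ))
    (hρmem : ∀ t x, ρ t x ∈ Icc (0 : ℝ) 1) {B : ℝ≥0∞} (hB : B ≠ ⊤)
    (hlip : ∀ s ≥ 0, ∀ t ≥ 0, ∀ R : ℝ,
      ∫⁻ x in Icc (-R) R, ‖ρ s x - ρ t x‖ₑ ≤ ENNReal.ofReal (|s - t| / lam) * B) :
    IsTimeContinuous ρ := by
  refine ⟨fun t _ => ?_, fun t ht K hK => ?_⟩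
  · refine (locallyIntegrable_const (1 : ℝ)).mono (hρm.of_uncurry_left).aestronglyMeasurable
      (ae_of_all _ fun x => ?_)
    rw [Real.norm_of_nonneg (hρmem t x).1, norm_one]
    exact (hρmem t x).2
  · obtain ⟨R, hR⟩ := hK.isBounded.subset_closedBall (0 : ℝ)
    have hsub : K ⊆ Icc (-R) R := fun x hx => by
      have := hR hx
      rw [mem_closedBall_zero_iff] at this
      exact abs_le.1 this
    have hlim : Tendsto (fun s => ENNReal.ofReal (|s - t| / lam) * B) (𝓝[Ici 0] t) (𝓝 0) := by
      have h1 : Tendsto (fun s => |s - t| / lam) (𝓝[Ici 0] t) (𝓝 0) :=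
        tendsto_nhdsWithin_of_tendsto_nhds (Continuous.tendsto' (by fun_prop) _ _ (by simp))
      have h2 := ENNReal.Tendsto.mul_const (b := B) (ENNReal.tendsto_ofReal h1) (Or.inr hB)
      simpa using h2
    refine tendsto_of_tendsto_of_tendsto_of_le_of_le' tendsto_const_nhds hlim
      (Eventually.of_forall fun _ => zero_le) ?_
    filter_upwards [self_mem_nhdsWithin] with s hs
    rw [eLpNorm_one_eq_lintegral_enorm]
    exact (lintegral_mono_set hsub).trans (hlip s hs t ht R)

lemma ae_eq_of_lintegral_Icc_eq_zero {f g : ℝ → ℝ} (hf : AEMeasurable f) (hg : AEMeasurable g)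
    (h : ∀ R : ℝ, ∫⁻ x in Icc (-R) R, ‖f x - g x‖ₑ = 0) : f =ᵐ[volume] g := by
  have key : ∀ N : ℕ, ∀ᵐ x : ℝ, x ∈ Icc (-(N : ℝ)) N → f x = g x := fun N => by
    have hm : AEMeasurable (fun x => ‖f x - g x‖ₑ) (volume.restrict (Icc (-(N : ℝ)) N)) :=
      (hf.sub hg).enorm.mono_measure Measure.restrict_le_self
    have h1 := (lintegral_eq_zero_iff' hm).1 (h N)
    refine ((ae_restrict_iff' measurableSet_Icc).1 h1).mono fun x hx hmem => ?_
    have := hx hmem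
    simpa [sub_eq_zero] using this
  filter_upwards [ae_all_iff.2 key] with x hx
  obtain ⟨N, hN⟩ := exists_nat_ge |x|
  exact hx N (abs_le.1 hN)

/-- Existence of a time-continuous entropy solution. -/
theorem exists_isEntropySolution (hV : IsVelocity V A L) (hρ₀ : IsAdmissibleDatum ρ₀) (hl : 0 < lam)
    (hcfl : lam * (A + L) ≤ 1) :
    ∃ ρ : ℝ → ℝ → ℝ, Measurable (Function.uncurry ρ) ∧ (∀ t x, ρ t x ∈ Icc (0 : ℝ) 1) ∧
      IsEntropySolution V ρ₀ ρ ∧ IsTimeContinuous ρ ∧ ρ 0 =ᵐ[volume] ρ₀ := by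
  set B := totalVariation ρ₀ with hB
  have hBtop : B ≠ ⊤ := hρ₀.totalVariation_lt_top.ne
  set h : ℕ → ℝ := fun m => 1 / ((m : ℝ) + 1) with hh
  have hh0 : ∀ m, 0 < h m := fun m => by simp only [hh]; positivity
  have hhlim : Tendsto h atTop (𝓝 0) := tendsto_one_div_add_atTop_nhds_zero_nat
  have H : ∀ m, SchemeData V A L ρ₀ pointWeight lam (h m) := fun m =>
    ⟨hV, hρ₀, isWeight_pointWeight, hl, hcfl, hh0 m⟩
  have hD := fun m => (H m).isDiscreteEntropySolution
  obtain ⟨ρ, hρm, hρmem, σ, hσ, hconv⟩ := exists_subseq_tendsto_of_variation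
    (u := fun m => gridFun (schemeImpact V ρ₀ pointWeight lam (h m)) lam (h m)) hBtop hl
    (fun m => (hh0 m).le) hhlim (fun m t x => (hD m).gridFun_mem _ t x)
    (fun m t => measurable_gridFun_apply _ _ _ t)
    (fun m t => (hD m).eVariationOn_gridFun_le (hh0 m) t)
    (fun m s hs t ht => (hD m).lintegral_gridFun_sub_le (hh0 m) hl hs ht)
  set u : ℕ → ℝ → ℝ → ℝ := fun m => gridFun (schemeImpact V ρ₀ pointWeight lam (h m)) lam (h m)
    with hu
  have hum : ∀ m t, Measurable (u m t) := fun m t => measurable_gridFun_apply _ _ _ t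
  have hρmt : ∀ t, Measurable (ρ t) := fun t => hρm.of_uncurry_left
  have hσh : Tendsto (fun m => h (σ m)) atTop (𝓝 0) := hhlim.comp hσ.tendsto_atTop
  have hinit : ρ 0 =ᵐ[volume] ρ₀ := by
    refine ae_eq_of_lintegral_Icc_eq_zero (hρmt 0).aemeasurable hρ₀.aemeasurable fun R => ?_
    have hle : ∀ m, ∫⁻ x in Icc (-R) R, ‖ρ 0 x - ρ₀ x‖ₑ
        ≤ (∫⁻ x in Icc (-R) R, ‖u (σ m) 0 x - ρ 0 x‖ₑ) + ENNReal.ofReal (h (σ m)) * B := fun m => by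
      have hm : Measurable fun x => ‖u (σ m) 0 x - ρ 0 x‖ₑ := ((hum _ _).sub (hρmt 0)).enorm
      obtain ⟨J, hJ⟩ := exists_nat_ge ((R + h (σ m)) / h (σ m))
      rw [div_le_iff₀ (hh0 _)] at hJ
      have h1 := (H (σ m)).lintegral_datum_sub_le hJ (spreadBound_pointWeight B (h (σ m)) J)
      rw [add_zero] at h1
      calc _ ≤ ∫⁻ x in Icc (-R) R, (‖u (σ m) 0 x - ρ 0 x‖ₑ + ‖ρ₀ x - u (σ m) 0 x‖ₑ) := by
            refine lintegral_mono fun x => ?_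
            rw [← enorm_neg, show -(ρ 0 x - ρ₀ x) = (u (σ m) 0 x - ρ 0 x) + (ρ₀ x - u (σ m) 0 x) by
              ring]
            exact enorm_add_le _ _
        _ ≤ _ := by
            rw [lintegral_add_left hm]
            refine add_le_add le_rfl ?_
            simpa only [hu, gridFun_zero] using h1
    have hlim := (hconv 0 le_rfl R).add (ENNReal.Tendsto.mul_const (b := B)
      (ENNReal.tendsto_ofReal hσh) (Or.inr hBtop))
    simp only [ENNReal.ofReal_zero, zero_mul, add_zero] at hlim
    exact le_antisymm (ge_of_tendsto' hlim hle) zero_le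
  have hlip : ∀ s ≥ 0, ∀ t ≥ 0, ∀ R : ℝ,
      ∫⁻ x in Icc (-R) R, ‖ρ s x - ρ t x‖ₑ ≤ ENNReal.ofReal (|s - t| / lam) * B :=
    fun s hs t ht R => by
      have hle : ∀ m, ∫⁻ x in Icc (-R) R, ‖ρ s x - ρ t x‖ₑ
          ≤ (∫⁻ x in Icc (-R) R, ‖u (σ m) s x - ρ s x‖ₑ)
            + ((∫⁻ x in Icc (-R) R, ‖u (σ m) t x - ρ t x‖ₑ)
              + ENNReal.ofReal (|s - t| / lam + h (σ m)) * B) := fun m => by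
        have hm1 : Measurable fun x => ‖u (σ m) s x - ρ s x‖ₑ := ((hum _ _).sub (hρmt s)).enorm
        have hm2 : Measurable fun x => ‖u (σ m) t x - ρ t x‖ₑ := ((hum _ _).sub (hρmt t)).enorm
        calc _ ≤ ∫⁻ x in Icc (-R) R, (‖u (σ m) s x - ρ s x‖ₑ
              + (‖u (σ m) t x - ρ t x‖ₑ + ‖u (σ m) s x - u (σ m) t x‖ₑ)) := by
              refine lintegral_mono fun x => ?_
              rw [show ρ s x - ρ t x = -(u (σ m) s x - ρ s x)
                + ((u (σ m) t x - ρ t x) + (u (σ m) s x - u (σ m) t x)) by ring]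
              refine (enorm_add_le _ _).trans ?_
              rw [enorm_neg]
              exact add_le_add le_rfl (enorm_add_le _ _)
          _ ≤ _ := by
              rw [lintegral_add_left hm1, lintegral_add_left hm2]
              refine add_le_add le_rfl (add_le_add le_rfl ((setLIntegral_le_lintegral _ _).trans ?_))
              exact (hD (σ m)).lintegral_gridFun_sub_le (hh0 _) hl ht hs
      have hlim := (hconv s hs R).add ((hconv t ht R).add (ENNReal.Tendsto.mul_const (b := B)
        (ENNReal.tendsto_ofReal (hσh.const_add (|s - t| / lam))) (Or.inr hBtop)))
      simp only [zero_add, add_zero] at hlim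
      exact ge_of_tendsto' hlim hle
  exact ⟨ρ, hρm, hρmem, entropy_of_tendsto hV hρ₀ hl hcfl (fun m => hh0 (σ m)) hσh hρm hρmem hconv
    hinit, isTimeContinuous_of_lintegral_le hρm hρmem hBtop hlip, hinit⟩

end Solution

/-! ### Convergence of the scheme -/

lemma SpreadBound.mono {w : ℕ → ℝ} {B : ℝ≥0∞} {h : ℝ} {J : ℕ} {s s' : ℝ≥0∞}
    (hs : SpreadBound w B h J s) (hle : s ≤ s') : SpreadBound w B h J s' :=
  fun r hr hB => (hs r hr hB).trans hle

/-- The mass of the weights beyond the distance `R`, uniformly in the parameters. -/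
noncomputable def tailMass (γ : ℝ → ℝ → ℕ → ℝ) (R : ℝ) : ℝ≥0∞ :=
  ⨆ (ε : ℝ) (_ : 0 < ε) (h : ℝ) (_ : 0 < h),
    ∑' k : ℕ, if R ≤ (k : ℝ) * h / ε then ENNReal.ofReal (γ ε h k) else 0

section Limit

variable {V ρ₀ : ℝ → ℝ} {ρ : ℝ → ℝ → ℝ} {A L lam : ℝ} {γ : ℝ → ℝ → ℕ → ℝ}

lemma IsAdmissibleWeights.spreadBound (hγ : IsAdmissibleWeights γ) {ε h G : ℝ} (hε : 0 < ε)
    (hh : 0 < h) (R : ℝ) (B : ℝ≥0∞) {J : ℕ} (hJ : (2 * J + 1) * h ≤ G) :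
    SpreadBound (γ ε h) B h J
      (ENNReal.ofReal (R * ε) * B + ENNReal.ofReal G * tailMass γ R) := by
  refine ((hγ.isWeight hε hh).spreadBound_of_tail (R * ε / h) hh B J).mono ?_
  have h1 : h * (R * ε / h) = R * ε := by field_simp
  rw [h1]
  refine add_le_add le_rfl (mul_le_mul' (ENNReal.ofReal_le_ofReal hJ) ?_)
  unfold tailMass
  refine le_trans (le_of_eq (tsum_congr fun k => ?_)) (le_iSup₂_of_le ε hε
    (le_iSup₂_of_le h hh le_rfl))
  have : R * ε / h ≤ k ↔ R ≤ k * h / ε := by rw [div_le_iff₀ hh, le_div_iff₀ hε]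
  simp only [this]

theorem tendsto_lintegral_slice (hV : IsVelocity V A L) (hρ₀ : IsAdmissibleDatum ρ₀)
    (hγ : IsAdmissibleWeights γ) (hl : 0 < lam) (hcfl : lam * (A + L) ≤ 1)
    (hρ : IsEntropySolution V ρ₀ ρ) (hρc : IsTimeContinuous ρ) {t R : ℝ} (ht : 0 ≤ t)
    (hR : 0 ≤ R) :
    Tendsto (fun p : ℝ × ℝ => ∫⁻ x in Icc (-R) R,
      ‖gridFun (schemeImpact V ρ₀ (γ p.1 p.2) lam p.2) lam p.2 t x - ρ t x‖ₑ)
      (𝓝[>] (0 : ℝ) ×ˢ 𝓝[>] (0 : ℝ)) (𝓝 0) := by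
  obtain ⟨C, hC, hF⟩ := exists_isSmoothStep
  have hM : 0 ≤ A + L := add_nonneg hV.bound_nonneg hV.lip_nonneg
  set B := totalVariation ρ₀ with hB
  have hBtop : B ≠ ⊤ := hρ₀.totalVariation_lt_top.ne
  refine ENNReal.tendsto_nhds_zero.2 fun η hη => ?_
  have hη2 : 0 < η / 2 := ENNReal.half_pos hη.ne'
  have hδ : ∀ᶠ δ in 𝓝[>] (0 : ℝ), ENNReal.ofReal (2 * δ) * B < η / 2 := by
    have h1 : Tendsto (fun δ : ℝ => 2 * δ) (𝓝[>] 0) (𝓝 0) :=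
      tendsto_nhdsWithin_of_tendsto_nhds (Continuous.tendsto' (by fun_prop) _ _ (by simp))
    have h2 := ENNReal.Tendsto.mul_const (b := B) (ENNReal.tendsto_ofReal h1) (Or.inr hBtop)
    simp only [ENNReal.ofReal_zero, zero_mul] at h2
    exact h2.eventually_lt_const hη2
  obtain ⟨δ, hδ1, hδ0, hδle⟩ := (hδ.and (Ioo_mem_nhdsGT (zero_lt_one' ℝ))).exists
  set G := 2 * (R + 1 + (A + L) * (t + 1) + 1 + 3) + 3 with hG
  set b := ENNReal.ofReal (t * C * L / δ) + 1 with hb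
  have hbtop : b ≠ ⊤ := by simp [hb]
  have hS : Tendsto (fun r => b * (ENNReal.ofReal G * tailMass γ r)) atTop (𝓝 0) := by
    have h1 : Tendsto (tailMass γ) atTop (𝓝 0) := hγ.localized
    have h2 := ENNReal.Tendsto.const_mul (a := b) (ENNReal.Tendsto.const_mul
      (a := ENNReal.ofReal G) h1 (Or.inr ENNReal.ofReal_ne_top)) (Or.inr hbtop)
    simpa using h2
  obtain ⟨r, hr⟩ := (hS.eventually_lt_const hη2).exists
  obtain ⟨F, f, hFf⟩ := hF δ hδ0
  set s : ℝ → ℝ≥0∞ := fun ε => ENNReal.ofReal (r * ε) * B + ENNReal.ofReal G * tailMass γ r with hs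
  have hpos : ∀ᶠ p : ℝ × ℝ in 𝓝[>] (0 : ℝ) ×ˢ 𝓝[>] (0 : ℝ), 0 < p.1 ∧ 0 < p.2 ∧ p.2 < 1 := by
    have h1 : ∀ᶠ x in 𝓝[>] (0 : ℝ), 0 < x := eventually_mem_nhdsWithin
    have h2 : ∀ᶠ x in 𝓝[>] (0 : ℝ), 0 < x ∧ x < 1 := Ioo_mem_nhdsGT (zero_lt_one' ℝ)
    exact h1.prod_mk h2
  have hbound : ∀ᶠ p : ℝ × ℝ in 𝓝[>] (0 : ℝ) ×ˢ 𝓝[>] (0 : ℝ), ∫⁻ x in Icc (-R) R,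
      ‖gridFun (schemeImpact V ρ₀ (γ p.1 p.2) lam p.2) lam p.2 t x - ρ t x‖ₑ
      ≤ comparisonBound C A L lam p.2 δ t B (s p.1) := by
    filter_upwards [hpos] with p hp
    obtain ⟨hε, hh, hh1⟩ := hp
    have H : SchemeData V A L ρ₀ (γ p.1 p.2) lam p.2 :=
      ⟨hV, hρ₀, hγ.isWeight hε hh, hl, hcfl, hh⟩
    set X := R + 1 + (A + L) * (t + 1) + δ + 3 * p.2 with hX
    have hX0 : 0 ≤ X := by positivity
    have hJ1 := (div_le_iff₀ hh).1 (Nat.le_ceil (X / p.2))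
    have hJ2 : (⌈X / p.2⌉₊ : ℝ) * p.2 ≤ X + p.2 := by
      have := (Nat.ceil_lt_add_one (div_nonneg hX0 hh.le)).le
      calc (⌈X / p.2⌉₊ : ℝ) * p.2 ≤ (X / p.2 + 1) * p.2 := by gcongr
        _ = X + p.2 := by field_simp
    have hsb := hγ.spreadBound hε hh r B (J := ⌈X / p.2⌉₊) (G := G) (by
      rw [hG]; nlinarith)
    have := H.lintegral_slice_sub_le hρ hρc hFf hC ht hJ1 hsb
    refine le_trans (le_of_eq ?_) this
    refine lintegral_congr fun x => ?_
    rw [← enorm_neg, neg_sub]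
  have hlim : Tendsto (fun p : ℝ × ℝ => comparisonBound C A L lam p.2 δ t B (s p.1))
      (𝓝[>] (0 : ℝ) ×ˢ 𝓝[>] (0 : ℝ))
      (𝓝 (ENNReal.ofReal (2 * δ) * B + b * (0 + ENNReal.ofReal G * tailMass γ r))) := by
    have hle : 𝓝[>] (0 : ℝ) ×ˢ 𝓝[>] (0 : ℝ) ≤ 𝓝 ((0 : ℝ), (0 : ℝ)) := by
      rw [nhds_prod_eq]; exact prod_mono nhdsWithin_le_nhds nhdsWithin_le_nhds
    unfold comparisonBound
    refine Tendsto.add (ENNReal.Tendsto.mul_const (ENNReal.tendsto_ofReal ?_) (Or.inr hBtop))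
      (ENNReal.Tendsto.const_mul ?_ (Or.inr hbtop))
    · refine (Continuous.tendsto' (by fun_prop) _ _ (by simp)).mono_left hle
    · refine Tendsto.add ?_ tendsto_const_nhds
      have h1 : Tendsto (fun p : ℝ × ℝ => r * p.1) (𝓝[>] (0 : ℝ) ×ˢ 𝓝[>] (0 : ℝ)) (𝓝 0) :=
        (Continuous.tendsto' (by fun_prop) _ _ (by simp)).mono_left hle
      have h2 := ENNReal.Tendsto.mul_const (b := B) (ENNReal.tendsto_ofReal h1) (Or.inr hBtop)
      simpa only [ENNReal.ofReal_zero, zero_mul] using h2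
  have hlt : ENNReal.ofReal (2 * δ) * B + b * (0 + ENNReal.ofReal G * tailMass γ r) < η := by
    rw [zero_add]
    calc _ < η / 2 + η / 2 := ENNReal.add_lt_add hδ1 hr
      _ = η := ENNReal.add_halves η
  filter_upwards [hbound, hlim.eventually_lt_const hlt] with p hp1 hp2
  exact hp1.trans hp2.le

/-- The constant of the convergence rate. -/
noncomputable def rateConstant (C lam A L c : ℝ) : ℝ :=
  C * (3 * |A| + |L|) + 6 + √(1 / lam) + C * |L| * |c| + |c|

lemma rateConstant_pos {C : ℝ} (hC : 0 < C) (lam A L c : ℝ) : 0 < rateConstant C lam A L c := by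
  unfold rateConstant; positivity

lemma comparisonBound_le {C h ε t c : ℝ} (hC : 0 < C) (hA : 0 ≤ A) (hL : 0 ≤ L)
    (hh : 0 < h) (hε : 0 < ε) (ht : 0 < t) (hc : 0 < c) (B : ℝ≥0∞) :
    comparisonBound C A L lam h (√(t * (h + ε))) t B (ENNReal.ofReal (c * ε) * B)
      ≤ ENNReal.ofReal (rateConstant C lam A L c * (ε + h + √(ε * t) + √(h * t))) * B := by
  set D := √(t * (h + ε)) with hD
  have hD0 : 0 < D := Real.sqrt_pos.2 (by positivity)
  have hDD : D * D = t * (h + ε) := Real.mul_self_sqrt (by positivity)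
  set a := √(ε * t) with ha
  set b := √(h * t) with hb
  have ha0 : 0 ≤ a := Real.sqrt_nonneg _
  have hb0 : 0 ≤ b := Real.sqrt_nonneg _
  have hDle : D ≤ a + b := by
    have e1 : a ^ 2 = ε * t := Real.sq_sqrt (by positivity)
    have e2 : b ^ 2 = h * t := Real.sq_sqrt (by positivity)
    refine Real.sqrt_le_iff.2 ⟨by positivity, ?_⟩
    nlinarith [mul_nonneg ha0 hb0]
  have h1 : t * h / D ≤ D := by rw [div_le_iff₀ hD0, hDD]; nlinarith
  have h2 : t * ε / D ≤ D := by rw [div_le_iff₀ hD0, hDD]; nlinarith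
  have h3 : √(t * h / lam) = √(1 / lam) * b := by
    rw [hb, mul_comm (√(1 / lam)), ← Real.sqrt_mul (by positivity)]; congr 1; ring
  unfold comparisonBound
  rw [← mul_assoc, ← add_mul, ← ENNReal.ofReal_one, ← ENNReal.ofReal_add (by positivity) zero_le_one,
    ← ENNReal.ofReal_mul (by positivity), ← ENNReal.ofReal_add (by positivity) (by positivity)]
  gcongr
  unfold rateConstant
  rw [abs_of_nonneg hA, abs_of_nonneg hL, abs_of_pos hc, h3]
  set S := ε + h + a + b with hS
  have hSD : D ≤ S := by linarith
  calc t * C * (3 * A + L) * (h / D) + 4 * h + 2 * D + √(1 / lam) * b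
        + (t * C * L / D + 1) * (c * ε)
      = C * (3 * A + L) * (t * h / D) + (4 * h + 2 * D) + √(1 / lam) * b
        + C * L * c * (t * ε / D) + c * ε := by ring
    _ ≤ C * (3 * A + L) * S + (4 * S + 2 * S) + √(1 / lam) * S + C * L * c * S + c * S := by
        have e1 := h1.trans hSD
        have e2 := h2.trans hSD
        have e3 : h ≤ S := by linarith
        have e4 : b ≤ S := by linarith
        have e5 : ε ≤ S := by linarith
        gcongr
    _ = _ := by ring

theorem eLpNorm_slice_sub_le {C : ℝ} (hC : 0 < C) (hF : ∀ δ > 0, ∃ F f, IsSmoothStep C δ F f)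
    (hV : IsVelocity V A L) (hρ₀ : IsAdmissibleDatum ρ₀)
    (hγ : IsAdmissibleWeights γ) (hl : 0 < lam) (hcfl : lam * (A + L) ≤ 1)
    (hρ : IsEntropySolution V ρ₀ ρ) (hρc : IsTimeContinuous ρ) {c : ℝ} (hc : 0 < c)
    (hm : MomentBound γ c) {ε h t : ℝ} (hε : 0 < ε) (hh : 0 < h) (ht : 0 < t) :
    eLpNorm (fun x => gridFun (schemeImpact V ρ₀ (γ ε h) lam h) lam h t x - ρ t x) 1 volume
      ≤ ENNReal.ofReal (rateConstant C lam A L c * (ε + h + √(ε * t) + √(h * t)))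
        * totalVariation ρ₀ := by
  have H : SchemeData V A L ρ₀ (γ ε h) lam h := ⟨hV, hρ₀, hγ.isWeight hε hh, hl, hcfl, hh⟩
  obtain ⟨F, f, hFf⟩ := hF (√(t * (h + ε))) (Real.sqrt_pos.2 (by positivity))
  have hmeas : AEMeasurable fun x =>
      ‖gridFun (schemeImpact V ρ₀ (γ ε h) lam h) lam h t x - ρ t x‖ₑ :=
    ((measurable_gridFun_apply _ _ _ t).aemeasurable.sub
      (hρc.locallyIntegrable t ht.le).aestronglyMeasurable.aemeasurable).enorm
  have hcov : AECover volume atTop fun N : ℕ => Icc (-(N : ℝ)) N :=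
    aecover_Icc (tendsto_neg_atTop_atBot.comp tendsto_natCast_atTop_atTop)
      tendsto_natCast_atTop_atTop
  rw [eLpNorm_one_eq_lintegral_enorm]
  refine le_of_tendsto' (hcov.lintegral_tendsto_of_nat hmeas) fun N => ?_
  obtain ⟨J, hJ⟩ := exists_nat_ge
    (((N : ℝ) + 1 + (A + L) * (t + 1) + √(t * (h + ε)) + 3 * h) / h)
  rw [div_le_iff₀ hh] at hJ
  obtain ⟨hsum, hle⟩ := hm ε hε h hh
  have hs := (hγ.isWeight hε hh).spreadBound_of_moment (m := c * ε) hh hsum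
    (by rwa [mul_div_assoc]) (totalVariation ρ₀) J
  have h1 := H.lintegral_slice_sub_le hρ hρc hFf hC ht.le hJ hs
  refine le_trans (le_of_eq ?_) (h1.trans
    (comparisonBound_le hC hV.bound_nonneg hV.lip_nonneg hh hε ht hc _))
  refine lintegral_congr fun x => ?_
  rw [← enorm_neg, neg_sub]

end Limit

lemma IsEntropySolution.congr_velocity {V V' ρ₀ : ℝ → ℝ} {ρ : ℝ → ℝ → ℝ}
    (hVV : ∀ ξ ∈ Icc (0 : ℝ) 1, V ξ = V' ξ) (h : IsEntropySolution V ρ₀ ρ) :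
    IsEntropySolution V' ρ₀ ρ := by
  refine ⟨h.aestronglyMeasurable, h.mem_Icc, fun c hc φ hφ hs hnn => ?_⟩
  refine (h.entropy c hc φ hφ hs hnn).trans (le_of_eq ?_)
  congr 1
  refine integral_congr_ae ?_
  filter_upwards [h.mem_Icc] with z hz
  simp only [kruzkovFlux, hVV c hc, hVV _ hz]

theorem theorem2p1 :
    ∃ K : ℝ → ℝ → ℝ → ℝ → ℝ, (∀ a b c d, 0 < K a b c d) ∧
    ∀ (V ρ₀ : ℝ → ℝ) (γ : ℝ → ℝ → ℕ → ℝ) (lam : ℝ),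
      IsAdmissibleVelocity V → IsAdmissibleDatum ρ₀ → IsAdmissibleWeights γ →
      0 < lam → lam * (linftyNorm V + 2 * linftyNorm (deriv V)) ≤ 1 →
      ∃ ρ : ℝ → ℝ → ℝ,
        -- `ρ` is the unique entropy solution, in its time-continuous representative
        IsEntropySolution V ρ₀ ρ ∧ IsTimeContinuous ρ ∧ ρ 0 =ᵐ[volume] ρ₀ ∧
        (∀ ρ' : ℝ → ℝ → ℝ, IsEntropySolution V ρ₀ ρ' →
          Function.uncurry ρ' =ᵐ[volume.restrict (Ioi (0 : ℝ) ×ˢ (univ : Set ℝ))]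
            Function.uncurry ρ) ∧
        -- convergence in `L¹_loc([0,∞) × ℝ)` as `(ε, h) → (0, 0)`
        (∀ C : Set (ℝ × ℝ), IsCompact C → C ⊆ Ici (0 : ℝ) ×ˢ (univ : Set ℝ) →
          Tendsto
            (fun p : ℝ × ℝ => eLpNorm
              (fun z : ℝ × ℝ => reconstruction V ρ₀ (γ p.1 p.2) lam p.2 z.1 z.2 - ρ z.1 z.2)
              1 (volume.restrict C))
            (𝓝[>] (0 : ℝ) ×ˢ 𝓝[>] (0 : ℝ)) (𝓝 0)) ∧
        -- convergence rate under the moment bound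
        (∀ cγ > 0, MomentBound γ cγ →
          ∀ ε > 0, ∀ h > 0, ∀ t > 0,
            eLpNorm (fun x => reconstruction V ρ₀ (γ ε h) lam h t x - ρ t x) 1 volume ≤
              ENNReal.ofReal (K lam (linftyNorm V) (linftyNorm (deriv V)) cγ *
                (ε + h + √(ε * t) + √(h * t))) * totalVariation ρ₀) := by
  obtain ⟨S, hS, hF⟩ := exists_isSmoothStep
  refine ⟨rateConstant S, rateConstant_pos hS, fun V ρ₀ γ lam hV₀ hρ₀ hγ hl hcfl₀ => ?_⟩
  have hV := hV₀.isVelocity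
  have hcfl : lam * (linftyNorm V + linftyNorm (deriv V)) ≤ 1 := by
    nlinarith [mul_nonneg hl.le hV.lip_nonneg]
  have hext : ∀ ξ ∈ Icc (0 : ℝ) 1, clampExtend V ξ = V ξ := fun ξ hξ => clampExtend_of_mem hξ
  obtain ⟨ρ, hρm, hρmem, hρ, hρc, hinit⟩ := exists_isEntropySolution hV hρ₀ hl hcfl
  have hrec : ∀ ε > 0, ∀ h > 0, ∀ t ≥ 0, ∀ x, reconstruction V ρ₀ (γ ε h) lam h t x
      = gridFun (schemeImpact (clampExtend V) ρ₀ (γ ε h) lam h) lam h t x :=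
    fun ε hε h hh t ht x => by
      have H : SchemeData (clampExtend V) (linftyNorm V) (linftyNorm (deriv V)) ρ₀ (γ ε h) lam h :=
        ⟨hV, hρ₀, hγ.isWeight hε hh, hl, hcfl, hh⟩
      rw [reconstruction_eq_gridFun V ρ₀ _ hl hh ht]
      unfold gridFun schemeImpact
      rw [schemeDensity_clampExtend H]
  refine ⟨ρ, hρ.congr_velocity hext, hρc, hinit, fun ρ' hρ' => ?_, fun C hC hCsub => ?_,
    fun cγ hcγ hm ε hε h hh t ht => ?_⟩
  · exact IsEntropySolution.ae_eq hV hρ₀ hl hcfl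
      (hρ'.congr_velocity fun ξ hξ => (hext ξ hξ).symm) hρ
  · obtain ⟨R, hR0, hR⟩ := hC.isBounded.subset_closedBall_lt 0 (0 : ℝ × ℝ)
    have hsub : C ⊆ Icc 0 R ×ˢ Icc (-R) R := fun z hz => by
      have h1 := hR hz
      rw [mem_closedBall_zero_iff, Prod.norm_def, max_le_iff] at h1
      exact ⟨⟨(hCsub hz).1, (le_abs_self _).trans h1.1⟩, abs_le.1 h1.2⟩
    have hpos : ∀ᶠ p : ℝ × ℝ in 𝓝[>] (0 : ℝ) ×ˢ 𝓝[>] (0 : ℝ), 0 < p.1 ∧ 0 < p.2 :=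
      (eventually_mem_nhdsWithin (s := Ioi (0 : ℝ))).prod_mk
        (eventually_mem_nhdsWithin (s := Ioi (0 : ℝ)))
    have hbox := tendsto_lintegral_box (R := R) (l := 𝓝[>] (0 : ℝ) ×ˢ 𝓝[>] (0 : ℝ))
      (u := fun p => gridFun (schemeImpact (clampExtend V) ρ₀ (γ p.1 p.2) lam p.2) lam p.2)
      (fun p => measurable_gridFun _ _ _) hρm
      (hpos.mono fun p hp t x => SchemeData.isDiscreteEntropySolution
        ⟨hV, hρ₀, hγ.isWeight hp.1 hp.2, hl, hcfl, hp.2⟩ |>.gridFun_mem _ t x) hρmem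
      fun t ht => tendsto_lintegral_slice hV hρ₀ hγ hl hcfl hρ hρc ht hR0.le
    refine tendsto_of_tendsto_of_tendsto_of_le_of_le' tendsto_const_nhds hbox
      (Eventually.of_forall fun _ => zero_le) ?_
    filter_upwards [hpos] with p hp
    rw [eLpNorm_one_eq_lintegral_enorm]
    refine le_trans (le_of_eq ?_) (lintegral_mono_set hsub)
    refine setLIntegral_congr_fun hC.measurableSet fun z hz => ?_
    rw [hrec _ hp.1 _ hp.2 _ (hCsub hz).1]
  · have heq : (fun x => reconstruction V ρ₀ (γ ε h) lam h t x - ρ t x) = fun x =>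
        gridFun (schemeImpact (clampExtend V) ρ₀ (γ ε h) lam h) lam h t x - ρ t x :=
      funext fun x => by rw [hrec ε hε h hh t ht.le]
    rw [heq]
    exact eLpNorm_slice_sub_le hS hF hV hρ₀ hγ hl hcfl hρ hρc hcγ hm hε hh ht
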